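/- Let $N_1=p_1^{2u_1+1}\cdots p_w^{2u_w+1}$ with distinct primes $p_i$, integers $u_i\ge 0$ and $w$ odd, and let $N_2\ge 1$ be an integer with $\gcd(N_1,N_2)=1$. Let $Q$ be a definite quaternion algebra over $\mathbb{Q}$ and $Q_p=\mathbb{Q}_p\otimes_{\mathbb{Q}}Q$; for a lattice $I\subset Q$ let $I_p=\mathbb{Z}_pI\subset Q_p$. For a prime $p$ let $L_p=\mathbb{Q}_p+\mathbb{Q}_pi$ be the unramified quadratic extension of $\mathbb{Q}_p$, where $i^2=\epsilon$ with $\epsilon\in\mathbb{Z}$ a quadratic nonresidue modulo $p$ if $p$ is odd and $\epsilon=-3$ if $p=2$, let $\alpha\mapsto\bar\alpha$ be its conjugation, and $R_p=\mathbb{Z}_p+\mathbb{Z}_pi$ ($p$ odd), $R_2=\mathbb{Z}_2+\mathbb{Z}_2\frac{1+i}{2}$. Let $\mathcal{O}\subset Q$ be an order of level $(N_1,N_2)$, that is, an order such that $\mathcal{O}_p$ is isomorphic over $\mathbb{Z}_p$ to $$\left\{\begin{pmatrix}\alpha&p^{u}\beta\\p^{u+1}\bar\beta&\bar\alpha\end{pmatrix}:\alpha,\beta\in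 R_p\right\}\quad\text{if } p^{2u+1}\parallel N_1,\qquad \begin{pmatrix}\mathbb{Z}_p&\mathbb{Z}_p\\N_2\mathbb{Z}_p&\mathbb{Z}_p\end{pmatrix}\quad\text{if }p\nmid N_1$$ (so the finite primes at which $Q$ ramifies are exactly $p_1,\dots,p_w$). A left (right) $\mathcal{O}$-ideal is a full $\mathbb{Z}$-lattice $I\subset Q$ such that for every prime $p$ there is $x_p\in Q_p^\times$ with $I_p=\mathcal{O}_px_p$ (resp. $I_p=x_p\mathcal{O}_p$); a two-sided $\mathcal{O}$-ideal is a lattice that is both. Left $\mathcal{O}$-ideals $I,J$ are in the same class if $J=Ix$ for some $x\in Q^\times$. Let $m(\mathcal{O})$ be the number of left $\mathcal{O}$-ideal classes that contain a two-sided $\mathcal{O}$-ideal, $\mathfrak{B}(\mathcal{O})$ the group of two-sided $\mathcal{O}$-ideals of the form $\mathcal{O}x$, $x\in Q^\times$, and $e(N)$ the number of distinct prime factors of $N$. Then $m(\mathcal{O})$ is a positive finite number, $\mathcal{O}^\times$ is finite, and $$\mathrm{card}(\mathfrak{B}(\mathcal{O})/\mathbb{Q}^\times)=\frac{2^{e(N_1N_2)}}{m(\mathcal{O})}.$$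 Moreover, fix for each $p$ an isomorphism of $\mathcal{O}_p$ with the above order of matrices, and let $c_{11}(x_p)$ be the upper left entry of the matrix corresponding to $x\in\mathcal{O}$. For integers $n,r$ the polynomial $X^2-rX+n$ has only finitely many zeros in $\mathcal{O}$. Let $\rho'_{\mathcal{O}}(n,r)$ be the number of those zeros $x\in\mathcal{O}$ for which, with $\mathrm{n}(x)=x\bar x$ the reduced norm, (i) $c_{11}(x_p)\in p^{2u+1}R_p$ whenever $p^{2u+1}\parallel N_1$ and $p^{2u+1}\parallel \mathrm{n}(x)$; (ii) $c_{11}(x_p)\in p^{v}\mathbb{Z}_p$ whenever $v\ge1$, $p^{v}\parallel N_2$ and $p^{v}\parallel \mathrm{n}(x)$. Then, for every choice of these isomorphisms, $$\mathrm{card}(\mathfrak{B}(\mathcal{O})/\mathbb{Q}^\times)=\sum_{n\parallel N_1N_2}\ \sum_{\substack{r\in\mathbb{Z},\ n\mid r\\ r^2\le 4n}}\frac{\rho'_{\mathcal{O}}(n,r)}{\mathrm{card}(\mathcal{O}^\times)},$$ where $n\parallel N$ means that $n\ge1$ divides $N$ and $\gcd(n,N/n)=1$. Finally, the group $\mathrm{Aut}(\mathcal{O})$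 of ring automorphisms of $\mathcal{O}$ satisfies $$\mathrm{card}(\mathrm{Aut}(\mathcal{O}))=\frac{2^{e(N_1N_2)}\,\mathrm{card}(\mathcal{O}^\times)}{2\,m(\mathcal{O})}.$$ -/

import Mathlib

open scoped TensorProduct Quaternion

noncomputable section

namespace QuatLevel

/-- The conditions on a pair `(N₁, N₂)`: `N₁ = p₁^(2u₁+1) ⋯ p_w^(2u_w+1)` with `w` odd, `N₂ ≥ 1`,
and `gcd(N₁, N₂) = 1`. -/
structure IsLevelPair (N₁ N₂ : ℕ) : Prop where
  ne_zero₁ : N₁ ≠ 0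
  odd_exponent : ∀ p ∈ N₁.primeFactors, Odd (N₁.factorization p)
  odd_card : Odd N₁.primeFactors.card
  ne_zero₂ : N₂ ≠ 0
  coprime : Nat.Coprime N₁ N₂

/-- The number of (distinct) prime factors. -/
def e (N : ℕ) : ℕ := N.primeFactors.card

/-- The divisors `n` of `N` with `n ∥ N`, that is, `n ∣ N` and `gcd(n, N / n) = 1`. -/
def exactDivisors (N : ℕ) : Finset ℕ := N.divisors.filter fun n => Nat.Coprime n (N / n)

/-- The integers `r` with `n ∣ r` and `r² ≤ 4n`
(for every natural number `n`, `r² ≤ 4n` and `n ∣ r` force `|r| ≤ 2n`). -/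
def traceRange (n : ℕ) : Finset ℤ :=
  (Finset.Icc (-(2 * n : ℤ)) (2 * n)).filter fun r => (n : ℤ) ∣ r ∧ r ^ 2 ≤ 4 * n

/-! ### Local objects -/

/-- For `p` odd, `ε` is a quadratic nonresidue modulo `p`; for `p = 2`, `ε = -3`. -/
def IsUnramifiedParam (p : ℕ) [Fact p.Prime] (ε : ℤ) : Prop :=
  if p = 2 then ε = -3 else legendreSym p ε = -1

/-- The unramified quadratic extension `ℚ_p + iℚ_p`, `i² = ε`; `star` is its conjugation. -/
abbrev UnramExt (p : ℕ) [Fact p.Prime] (ε : ℤ) : Type := QuadraticAlgebra ℚ_[p] (ε : ℚ_[p]) 0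

/-- The ring `R_p`: `ℤ_p + iℤ_p` for `p` odd, `ℤ_2 + ((1 + i)/2)ℤ_2` for `p = 2`. -/
def unramInt (p : ℕ) [Fact p.Prime] (ε : ℤ) : Set (UnramExt p ε) :=
  {z | ∃ s t : ℤ_[p], z = if p = 2 then ⟨(s : ℚ_[p]) + t / 2, (t : ℚ_[p]) / 2⟩ else ⟨s, t⟩}

/-- The matrices `(α, p^u β; p^(u+1) β̄, ᾱ)` with `α, β ∈ R_p`. -/
def stdRamified (p : ℕ) [Fact p.Prime] (ε : ℤ) (u : ℕ) :
    Set (Matrix (Fin 2) (Fin 2) (UnramExt p ε)) :=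
  {M | ∃ α ∈ unramInt p ε, ∃ β ∈ unramInt p ε,
    M = !![α, (p : UnramExt p ε) ^ u * β; (p : UnramExt p ε) ^ (u + 1) * star β, star α]}

/-- The matrices `(s, t; N v, w)` with `s, t, v, w ∈ ℤ_p`. -/
def stdSplit (p : ℕ) [Fact p.Prime] (N : ℕ) : Set (Matrix (Fin 2) (Fin 2) ℚ_[p]) :=
  {M | ∃ s t v w : ℤ_[p], M = !![(s : ℚ_[p]), (t : ℚ_[p]); (N : ℚ_[p]) * v, (w : ℚ_[p])]}

variable {a b : ℚ}

/-- The completion `ℚ_p ⊗ Q` of the quaternion algebra `Q = (a, b / ℚ)`. -/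
abbrev Compl (p : ℕ) [Fact p.Prime] (a b : ℚ) : Type := ℚ_[p] ⊗[ℚ] ℍ[ℚ,a,b]

/-- The image of `x ∈ Q` in `ℚ_p ⊗ Q`. -/
def toCompl (p : ℕ) [Fact p.Prime] (x : ℍ[ℚ,a,b]) : Compl p a b := (1 : ℚ_[p]) ⊗ₜ[ℚ] x

/-- The localization `I_p = ℤ_p I ⊆ ℚ_p ⊗ Q`. -/
def localize (p : ℕ) [Fact p.Prime] (I : AddSubgroup ℍ[ℚ,a,b]) :
    Submodule ℤ_[p] (Compl p a b) :=
  Submodule.span ℤ_[p] (toCompl p '' (I : Set ℍ[ℚ,a,b]))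

/-! ### Orders of level `(N₁, N₂)` -/

/-- Full `ℤ`-lattices in `Q`. -/
def IsFullLattice (I : AddSubgroup ℍ[ℚ,a,b]) : Prop :=
  I.FG ∧ Submodule.span ℚ (I : Set ℍ[ℚ,a,b]) = ⊤

/-- Orders in `Q`: subrings that are full lattices. -/
def IsOrder (O : Subring ℍ[ℚ,a,b]) : Prop := IsFullLattice O.toAddSubgroup

/-- An isomorphism of `O_p` with the order of all `(α, p^u β; p^(u+1) β̄, ᾱ)`, `α, β ∈ R_p`,
given through its `ℚ_p`-linear extension to `ℚ_p ⊗ Q`. -/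
structure RamifiedCoord (O : Subring ℍ[ℚ,a,b]) (p : ℕ) [Fact p.Prime] (u : ℕ) where
  ε : ℤ
  isUnramifiedParam : IsUnramifiedParam p ε
  toHom : Compl p a b →ₐ[ℚ_[p]] Matrix (Fin 2) (Fin 2) (UnramExt p ε)
  injective : Function.Injective toHom
  image_eq : toHom '' (localize p O.toAddSubgroup : Set (Compl p a b)) = stdRamified p ε u

/-- An isomorphism of `O_p` with the order of all `(s, t; N v, w)`, `s, t, v, w ∈ ℤ_p`,
given through its `ℚ_p`-linear extension to `ℚ_p ⊗ Q`. -/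
structure SplitCoord (O : Subring ℍ[ℚ,a,b]) (p : ℕ) [Fact p.Prime] (N : ℕ) where
  toHom : Compl p a b →ₐ[ℚ_[p]] Matrix (Fin 2) (Fin 2) ℚ_[p]
  injective : Function.Injective toHom
  image_eq : toHom '' (localize p O.toAddSubgroup : Set (Compl p a b)) = stdSplit p N

/-- A choice, for every prime `p`, of an isomorphism of `O_p` with the standard local order of
level `(N₁, N₂)`. -/
structure LevelCoords (O : Subring ℍ[ℚ,a,b]) (N₁ N₂ : ℕ) where
  ramified : ∀ (p : ℕ) [Fact p.Prime] (u : ℕ), N₁.factorization p = 2 * u + 1 →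
    RamifiedCoord O p u
  split : ∀ (p : ℕ) [Fact p.Prime], ¬ p ∣ N₁ → SplitCoord O p N₂

/-- `O` is an order of level `(N₁, N₂)`. -/
structure IsOfLevel (O : Subring ℍ[ℚ,a,b]) (N₁ N₂ : ℕ) : Prop where
  isLevelPair : IsLevelPair N₁ N₂
  isOrder : IsOrder O
  nonempty_coords : Nonempty (LevelCoords O N₁ N₂)

/-! ### Ideals -/

/-- Left `O`-ideals: full lattices `I` with `I_p = O_p x_p` for every `p`. -/
def IsLeftIdeal (O : Subring ℍ[ℚ,a,b]) (I : AddSubgroup ℍ[ℚ,a,b]) : Prop :=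
  IsFullLattice I ∧ ∀ (p : ℕ) [Fact p.Prime], ∃ x : (Compl p a b)ˣ,
    (localize p I : Set (Compl p a b)) =
      (fun y => y * (x : Compl p a b)) '' (localize p O.toAddSubgroup : Set (Compl p a b))

/-- Right `O`-ideals: full lattices `I` with `I_p = x_p O_p` for every `p`. -/
def IsRightIdeal (O : Subring ℍ[ℚ,a,b]) (I : AddSubgroup ℍ[ℚ,a,b]) : Prop :=
  IsFullLattice I ∧ ∀ (p : ℕ) [Fact p.Prime], ∃ x : (Compl p a b)ˣ,
    (localize p I : Set (Compl p a b)) =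
      (fun y => (x : Compl p a b) * y) '' (localize p O.toAddSubgroup : Set (Compl p a b))

/-- Two-sided `O`-ideals. -/
def IsTwoSidedIdeal (O : Subring ℍ[ℚ,a,b]) (I : AddSubgroup ℍ[ℚ,a,b]) : Prop :=
  IsLeftIdeal O I ∧ IsRightIdeal O I

/-- The lattice `I x`. -/
def mulRight (I : AddSubgroup ℍ[ℚ,a,b]) (x : ℍ[ℚ,a,b]) : AddSubgroup ℍ[ℚ,a,b] :=
  I.map (AddMonoidHom.mulRight x)

lemma mulRight_one (I : AddSubgroup ℍ[ℚ,a,b]) : mulRight I 1 = I := by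
  ext y; simp [mulRight]

lemma mulRight_mul (I : AddSubgroup ℍ[ℚ,a,b]) (x y : ℍ[ℚ,a,b]) :
    mulRight (mulRight I x) y = mulRight I (x * y) := by
  ext z; simp [mulRight, mul_assoc]

/-- Left `O`-ideals modulo multiplication by elements of `Q^×` from the right. -/
def leftIdealSetoid (O : Subring ℍ[ℚ,a,b]) :
    Setoid {I : AddSubgroup ℍ[ℚ,a,b] // IsLeftIdeal O I} where
  r I J := ∃ x : (ℍ[ℚ,a,b])ˣ, J.1 = mulRight I.1 x
  iseqv :=
    { refl := fun I => ⟨1, (mulRight_one I.1).symm⟩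
      symm := by
        rintro I J ⟨x, h⟩
        exact ⟨x⁻¹, by rw [h, mulRight_mul, Units.mul_inv, mulRight_one]⟩
      trans := by
        rintro I J K ⟨x, h⟩ ⟨y, h'⟩
        exact ⟨x * y, by rw [h', h, mulRight_mul, Units.val_mul]⟩ }

/-- `m(O)`: the number of left `O`-ideal classes that contain a two-sided `O`-ideal. -/
def m (O : Subring ℍ[ℚ,a,b]) : ℕ :=
  Nat.card {c : Quotient (leftIdealSetoid O) //
    ∃ I : {I : AddSubgroup ℍ[ℚ,a,b] // IsLeftIdeal O I},
      IsTwoSidedIdeal O I.1 ∧ Quotient.mk (leftIdealSetoid O) I = c}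

/-- The set of two-sided principal `O`-ideals: the two-sided `O`-ideals `O x`, `x ∈ Q^×`. -/
def PrincipalTwoSided (O : Subring ℍ[ℚ,a,b]) : Type :=
  {I : AddSubgroup ℍ[ℚ,a,b] //
    IsTwoSidedIdeal O I ∧ ∃ x : (ℍ[ℚ,a,b])ˣ, I = mulRight O.toAddSubgroup x}

/-- Two-sided principal `O`-ideals modulo multiplication by the (central) elements of `ℚ^×`. -/
def principalSetoid (O : Subring ℍ[ℚ,a,b]) : Setoid (PrincipalTwoSided O) where
  r I J := ∃ q : ℚˣ, J.1 = mulRight I.1 (algebraMap ℚ ℍ[ℚ,a,b] q)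
  iseqv :=
    { refl := fun I => ⟨1, by simp [mulRight_one]⟩
      symm := by
        rintro I J ⟨q, h⟩
        exact ⟨q⁻¹, by rw [h, mulRight_mul, ← map_mul, Units.mul_inv, map_one, mulRight_one]⟩
      trans := by
        rintro I J K ⟨q, h⟩ ⟨q', h'⟩
        exact ⟨q * q', by rw [h', h, mulRight_mul, ← map_mul, Units.val_mul]⟩ }

/-- The number of two-sided principal `O`-ideals modulo `ℚ^×`. -/
def cardPrincipal (O : Subring ℍ[ℚ,a,b]) : ℕ := Nat.card (Quotient (principalSetoid O))

/-! ### Zeros of quadratic polynomials in `O` -/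

/-- The reduced norm `x x̄`. -/
def nrd (x : ℍ[ℚ,a,b]) : ℚ := (x * star x).re

/-- The zeros of `X² - rX + n` in `O`. -/
def zeros (O : Subring ℍ[ℚ,a,b]) (n r : ℤ) : Set ℍ[ℚ,a,b] :=
  {x | x ∈ O ∧ x ^ 2 - (r : ℍ[ℚ,a,b]) * x + (n : ℍ[ℚ,a,b]) = 0}

/-- The restriction on `x ∈ O` in terms of the upper left entry `c₁₁(x_p)` of the matrix of `x`
in the chosen local coordinates: if `p^(2u+1) ∥ N₁` and `p^(2u+1) ∥ n(x)`, then
`c₁₁(x_p) ∈ p^(2u+1) R_p`; if `p^v ∥ N₂`, `v ≥ 1`, and `p^v ∥ n(x)`, then `c₁₁(x_p) ∈ p^v ℤ_p`. -/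
def CornerCondition {O : Subring ℍ[ℚ,a,b]} {N₁ N₂ : ℕ} (φ : LevelCoords O N₁ N₂)
    (x : ℍ[ℚ,a,b]) : Prop :=
  (∀ (p : ℕ) [Fact p.Prime] (u : ℕ) (h : N₁.factorization p = 2 * u + 1),
    padicValRat p (nrd x) = 2 * u + 1 →
      ∃ y ∈ unramInt p (φ.ramified p u h).ε,
        (φ.ramified p u h).toHom (toCompl p x) 0 0 =
          (p : UnramExt p (φ.ramified p u h).ε) ^ (2 * u + 1) * y) ∧
  (∀ (p : ℕ) [Fact p.Prime] (h : ¬ p ∣ N₁) (v : ℕ), 0 < v → N₂.factorization p = v →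
    padicValRat p (nrd x) = v →
      ∃ y : ℤ_[p], (φ.split p h).toHom (toCompl p x) 0 0 = (p : ℚ_[p]) ^ v * y)

/-- The number of zeros of `X² - rX + n` in `O` that satisfy the restriction. -/
def restrictedRho {O : Subring ℍ[ℚ,a,b]} {N₁ N₂ : ℕ} (φ : LevelCoords O N₁ N₂) (n r : ℤ) : ℕ :=
  Nat.card {x : ℍ[ℚ,a,b] // x ∈ zeros O n r ∧ CornerCondition φ x}

end QuatLevel

end

noncomputable section

namespace QuatLevel

/-! Write `N = N₁ N₂` and `v = v_p(N)`. The local input is that the normalizer of `O_p` in `Q_p^×`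
is generated by the scalars, by `O_p^×` and by one element `w_p` of `O_p` with `w_p² = p^v`; if `v >
0`, then `w_p` is not a scalar times a unit. For the two families of standard orders this is
`split_classify` and `ramified_classify`, packaged in `splitModel` and `ramifiedModel` and carried
over to `Q_p` by `LocalModel.exists_isLocalNormalizer`.

A two-sided ideal is locally `y_p O_p` with `y_p` in the normalizer (`isTwoSidedIdeal_iff`). Since
every system of exponents, almost all zero, is the system of valuations of a rational number, such
an ideal is determined modulo `ℚ^×` by the set of those primes dividing `N` at which `w_p` occurs.
Every set of prime divisors of `N` does occur, so there are `2^e(N)` two-sided ideals modulo `ℚ^×`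
(`LocalData.card_twoSidedMod`).

The normalizer of `O` in `Q^×` acts on these by right multiplication. Two two-sided ideals lie in
the same left class exactly if an element of the normalizer takes one to the other, so the orbits
modulo `ℚ^×` are counted by `m O`. The stabilizer of every point is `ℚ^× O^×`; hence all orbits are
as large as that of `O`, which consists of the principal two-sided ideals. This gives `2^e(N) = m O
* cardPrincipal O` (`card_twoSidedMod_eq_mul`).

The other two formulas count one finite set in three ways: the set `primitiveSet` of those `x` that
are, at every prime, a unit or `w_p` times a unit. Every principal two-sided ideal has such a
generator after scaling by `ℚ^×`, and it is unique up to `O^×`; so the set has `card O^× *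
cardPrincipal O` elements. By Skolem–Noether every automorphism of `O` is conjugation by such an
`x`, and `x` is determined up to sign; so the set has `2 * card Aut O` elements. Finally, being a
unit or `w_p` times a unit can be read off from the reduced norm, the reduced trace and the upper
left entry: `x ∈ O`, `n = n(x)` is an exact divisor of `N`, the trace `r` is divisible by `n`, and
the corner condition holds. Definiteness adds `r² ≤ 4n`, and the set is the disjoint union of the
sets counted by `restrictedRho` (`card_primitiveSet_eq_sum`). -/

/-- The determinant of `z` is a unit of `ℤ_p`. -/
def HasUnitDet (p : ℕ) [Fact p.Prime] {L : Type*} [CommRing L] [Algebra ℚ_[p] L]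
    (z : Matrix (Fin 2) (Fin 2) L) : Prop :=
  ∃ d : ℚ_[p], z.det = algebraMap ℚ_[p] L d ∧ ‖d‖ = 1

/-- What is used of a local order `Γ` of `2 × 2` matrices: an element `w` with `w² = p^v` that
generates its normalizer modulo scalars and units, and a description of the generators of the
two-sided ideal `w Γ`. The matrices of the ambient algebra lie in `B`. -/
structure LocalModel (p : ℕ) [Fact p.Prime] {L : Type*} [CommRing L] [Algebra ℚ_[p] L]
    (Γ B : Set (Matrix (Fin 2) (Fin 2) L)) (v : ℕ) (corner : Matrix (Fin 2) (Fin 2) L → Prop)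
    (w : Matrix (Fin 2) (Fin 2) L) : Prop where
  mem : w ∈ Γ
  sq : w * w = algebraMap ℚ_[p] _ ((p : ℚ_[p]) ^ v)
  swap : ∀ z ∈ Γ, ∃ z' ∈ Γ, w * z = z' * w
  det_mem : ∀ z ∈ Γ, ∃ d : ℚ_[p], z.det = algebraMap ℚ_[p] L d ∧ ‖d‖ ≤ 1
  trace_mem : ∀ z ∈ Γ, ∃ t : ℚ_[p], z.trace = algebraMap ℚ_[p] L t ∧ ‖t‖ ≤ 1
  adjugate_mem : ∀ z ∈ Γ, z.adjugate ∈ Γ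
  classify : ∀ M ∈ B, ∀ D : ℚ_[p], D ≠ 0 → M.det = algebraMap ℚ_[p] L D →
    (∀ z ∈ Γ, ∃ z' ∈ Γ, M * z = z' * M) →
    ∃ k : ℤ, ∃ z ∈ Γ, HasUnitDet p z ∧
      (M = (p : ℚ_[p]) ^ k • z ∨ M = (p : ℚ_[p]) ^ k • (w * z))
  not_unit : 0 < v → ∀ k : ℤ, ∀ z ∈ Γ, HasUnitDet p z → w ≠ (p : ℚ_[p]) ^ k • z
  corner_iff : 0 < v → ∀ z ∈ Γ, ∀ d t : ℚ_[p], z.det = algebraMap ℚ_[p] L d →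
    z.trace = algebraMap ℚ_[p] L t →
    ((‖d‖ = (p : ℝ) ^ (-v : ℤ) ∧ ‖t‖ ≤ (p : ℝ) ^ (-v : ℤ) ∧ corner z) ↔
      ∃ u ∈ Γ, HasUnitDet p u ∧ z = w * u)

/-! ### Absolute values on `ℚ_p` -/

section Padic

variable {p : ℕ} [hp : Fact p.Prime]

lemma prime_cast_pos : (0 : ℝ) < p := by exact_mod_cast hp.out.pos

lemma one_lt_prime_cast : (1 : ℝ) < p := by exact_mod_cast hp.out.one_lt

lemma padic_prime_ne_zero : (p : ℚ_[p]) ≠ 0 := by exact_mod_cast hp.out.ne_zero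

lemma exists_norm_eq_zpow {x : ℚ_[p]} (hx : x ≠ 0) : ∃ k : ℤ, ‖x‖ = (p : ℝ) ^ (-k) :=
  ⟨_, Padic.norm_eq_zpow_neg_valuation hx⟩

lemma exists_padicInt_mul_pow_iff {x : ℚ_[p]} {n : ℕ} :
    (∃ y : ℤ_[p], x = (p : ℚ_[p]) ^ n * y) ↔ ‖x‖ ≤ (p : ℝ) ^ (-n : ℤ) := by
  have h0 : (p : ℚ_[p]) ^ n ≠ 0 := pow_ne_zero _ padic_prime_ne_zero
  constructor
  · rintro ⟨y, rfl⟩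
    rw [norm_mul, Padic.norm_p_pow]
    exact mul_le_of_le_one_right (by positivity) y.2
  · intro h
    refine ⟨⟨x / (p : ℚ_[p]) ^ n, ?_⟩, by field_simp⟩
    rw [norm_div, Padic.norm_p_pow]
    exact div_le_one_of_le₀ h (by positivity)

end Padic

/-! ### The local order at primes not dividing `N₁` -/

section Split

variable {p : ℕ} [hp : Fact p.Prime]

lemma norm_natCast_eq_factorization {N : ℕ} (hN : N ≠ 0) :
    ‖(N : ℚ_[p])‖ = (p : ℝ) ^ (-(N.factorization p) : ℤ) := by
  rw [Padic.norm_eq_zpow_neg_valuation (by exact_mod_cast hN), Padic.valuation_natCast,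
    Nat.factorization_def _ hp.out]

lemma mem_stdSplit {N : ℕ} (hN : N ≠ 0) {a b c d : ℚ_[p]} :
    !![a, b; c, d] ∈ stdSplit p N ↔
      ‖a‖ ≤ 1 ∧ ‖b‖ ≤ 1 ∧ ‖c‖ ≤ (p : ℝ) ^ (-(N.factorization p) : ℤ) ∧ ‖d‖ ≤ 1 := by
  have hN' : (N : ℚ_[p]) ≠ 0 := by exact_mod_cast hN
  have hN'' : 0 < ‖(N : ℚ_[p])‖ := norm_pos_iff.mpr hN'
  rw [← norm_natCast_eq_factorization hN]
  constructor
  · rintro ⟨s, t, v, w, h⟩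
    have h00 := congr_fun₂ h 0 0
    have h01 := congr_fun₂ h 0 1
    have h10 := congr_fun₂ h 1 0
    have h11 := congr_fun₂ h 1 1
    simp at h00 h01 h10 h11
    subst h00 h01 h10 h11
    refine ⟨s.2, t.2, ?_, w.2⟩
    rw [norm_mul]
    exact mul_le_of_le_one_right hN''.le v.2
  · rintro ⟨ha, hb, hc, hd⟩
    refine ⟨⟨a, ha⟩, ⟨b, hb⟩, ⟨c / N, ?_⟩, ⟨d, hd⟩, ?_⟩
    · rw [norm_div]; exact div_le_one_of_le₀ hc hN''.le
    · simp [mul_div_cancel₀ _ hN']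

/-- The element `(0, 1; p^v, 0)` normalizing the split local order. -/
def splitSwap (p : ℕ) [Fact p.Prime] (v : ℕ) : Matrix (Fin 2) (Fin 2) ℚ_[p] :=
  !![0, 1; (p : ℚ_[p]) ^ v, 0]

lemma exists_eq_algebraMap_self {P : ℚ_[p] → Prop} {d : ℚ_[p]} (h : P d) :
    ∃ d', d = algebraMap ℚ_[p] ℚ_[p] d' ∧ P d' := ⟨d, rfl, h⟩

lemma norm_sub_le_max' (x y : ℚ_[p]) : ‖x - y‖ ≤ max ‖x‖ ‖y‖ := by
  simpa [sub_eq_add_neg] using Padic.nonarchimedean x (-y)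

/-- Conjugating the matrix units contained in the order by `M = (a, b; c, d)` bounds the products of
entries of `M` by `δ = |det M|`. As `δ ≤ max(|ad|, |bc|)`, one of the two products must attain its
bound, and then all four entries are under control: a dominant diagonal gives a scalar times a unit,
a dominant antidiagonal gives the coset of `splitSwap`. -/
lemma split_classify {N : ℕ} (hN : N ≠ 0) (M : Matrix (Fin 2) (Fin 2) ℚ_[p])
    (hD : M.det ≠ 0) (hM : ∀ z ∈ stdSplit p N, ∃ z' ∈ stdSplit p N, M * z = z' * M) :
    ∃ k : ℤ, ∃ z ∈ stdSplit p N, HasUnitDet p z ∧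
      (M = (p : ℚ_[p]) ^ k • z ∨
        M = (p : ℚ_[p]) ^ k • (splitSwap p (N.factorization p) * z)) := by
  set v := N.factorization p with hv
  obtain ⟨a, b, c, d, rfl⟩ : ∃ a b c d, M = !![a, b; c, d] :=
    ⟨_, _, _, _, Matrix.eta_fin_two M⟩
  have hp0 : (p : ℚ_[p]) ≠ 0 := padic_prime_ne_zero
  have hpp : (0 : ℝ) < p := prime_cast_pos
  set ρ : ℝ := (p : ℝ) ^ (-v : ℤ) with hρ
  have hρ0 : 0 < ρ := by positivity
  have hρ1 : ρ ≤ 1 := zpow_le_one_of_nonpos₀ one_lt_prime_cast.le (by omega)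
  set δ := ‖!![a, b; c, d].det‖ with hδ
  have hδ0 : 0 < δ := norm_pos_iff.mpr hD
  have hdet : !![a, b; c, d].det = a * d - b * c := Matrix.det_fin_two_of ..
  -- Multiplying `M z = z' M` on the right by the adjugate avoids inverses: the entries of `M z
  -- adj(M)` are `det M` times elements with known bounds.
  have key : ∀ z ∈ stdSplit p N, ∃ q r s t : ℚ_[p], ‖q‖ ≤ 1 ∧ ‖r‖ ≤ 1 ∧ ‖s‖ ≤ ρ ∧ ‖t‖ ≤ 1 ∧
      !![a, b; c, d] * z * !![d, -b; -c, a] = (a * d - b * c) • !![q, r; s, t] := by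
    intro z hz
    obtain ⟨z', hz', h⟩ := hM z hz
    obtain ⟨q, r, s, t, rfl⟩ : ∃ a b c d, z' = !![a, b; c, d] :=
      ⟨_, _, _, _, Matrix.eta_fin_two z'⟩
    obtain ⟨h1, h2, h3, h4⟩ := (mem_stdSplit hN).1 hz'
    refine ⟨q, r, s, t, h1, h2, h3, h4, ?_⟩
    rw [h]
    simp only [Matrix.mul_fin_two, Matrix.smul_of, Matrix.smul_cons, Matrix.smul_empty,
      smul_eq_mul]
    congr 1
    ext i j; fin_cases i <;> fin_cases j <;> simp <;> ring
  have bound : ∀ x y z: ℚ_[p], ∀ r : ℝ, ‖z‖ ≤ r → x * y = (a * d - b * c) * z →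
      ‖x‖ * ‖y‖ ≤ δ * r := by
    intro x y z r hz h
    rw [← norm_mul, h, norm_mul, hδ, hdet]
    exact mul_le_mul_of_nonneg_left hz (norm_nonneg _)
  have e11 : ‖a‖ * ‖b‖ ≤ δ * 1 ∧ ‖c‖ * ‖d‖ ≤ δ * ρ := by
    obtain ⟨q, r, s, t, hq, hr, hs, ht, h⟩ := key !![1, 0; 0, 0]
      ((mem_stdSplit hN).2 (by simp))
    have h01 := congr_fun₂ h 0 1
    have h10 := congr_fun₂ h 1 0
    simp at h01 h10
    exact ⟨bound _ _ (-r) _ (by simpa using hr) (by linear_combination -h01),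
      bound _ _ s _ hs (by linear_combination h10)⟩
  have e12 : ‖a‖ * ‖a‖ ≤ δ * 1 ∧ ‖c‖ * ‖c‖ ≤ δ * ρ := by
    obtain ⟨q, r, s, t, hq, hr, hs, ht, h⟩ := key !![0, 1; 0, 0]
      ((mem_stdSplit hN).2 (by simp))
    have h01 := congr_fun₂ h 0 1
    have h10 := congr_fun₂ h 1 0
    simp at h01 h10
    exact ⟨bound _ _ r _ hr (by linear_combination h01),
      bound _ _ (-s) _ (by simpa using hs) (by linear_combination -h10)⟩
  -- The test matrix needs the entry `p^v` to lie in the order. This costs a factor `ρ`, which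
  -- cancels in the bound for `d` but not in that for `b`.
  have e21 : ‖b‖ * ‖b‖ * ρ ≤ δ ∧ ‖d‖ * ‖d‖ ≤ δ := by
    obtain ⟨q, r, s, t, hq, hr, hs, ht, h⟩ := key !![0, 0; (p : ℚ_[p]) ^ v, 0]
      ((mem_stdSplit hN).2 (by simp [hv]))
    have h01 := congr_fun₂ h 0 1
    have h10 := congr_fun₂ h 1 0
    simp at h01 h10
    have hpv : ‖(p : ℚ_[p]) ^ v‖ = ρ := by simp [hρ]
    have h1 := bound b (b * (p : ℚ_[p]) ^ v) (-r) 1 (by simpa using hr)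
      (by linear_combination -h01)
    have h2 := bound d (d * (p : ℚ_[p]) ^ v) s ρ hs (by linear_combination h10)
    rw [norm_mul, hpv] at h1 h2
    constructor
    · linarith
    · have : ‖d‖ * ‖d‖ * ρ ≤ δ * ρ := by linarith
      exact le_of_mul_le_mul_right this hρ0
  obtain ⟨hab, hcd⟩ := e11
  obtain ⟨haa, hcc⟩ := e12
  obtain ⟨hbb, hdd⟩ := e21
  have hmax : δ ≤ max (‖a‖ * ‖d‖) (‖b‖ * ‖c‖) := by
    rw [hδ, hdet, ← norm_mul, ← norm_mul]; exact norm_sub_le_max' _ _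
  have ha0 := norm_nonneg a
  have hb0 := norm_nonneg b
  have hc0 := norm_nonneg c
  have hd0 := norm_nonneg d
  rcases le_max_iff.1 hmax with hcase | hcase
  · have ha' : a ≠ 0 := by
      rintro rfl; simp at hcase; linarith
    have hapos : 0 < ‖a‖ := norm_pos_iff.mpr ha'
    have hsq : (‖a‖ * ‖d‖) * (‖a‖ * ‖d‖) ≤ δ * (‖d‖ * ‖d‖) := by nlinarith
    have hd2 : ‖d‖ * ‖d‖ = δ := by
      apply le_antisymm hdd
      have : δ * δ ≤ δ * (‖d‖ * ‖d‖) := le_trans (by nlinarith) hsq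
      exact le_of_mul_le_mul_left this hδ0
    have ha2 : ‖a‖ * ‖a‖ = δ := by
      apply le_antisymm (by linarith)
      have : δ * δ ≤ δ * (‖a‖ * ‖a‖) := by
        calc δ * δ ≤ (‖a‖ * ‖d‖) * (‖a‖ * ‖d‖) := by nlinarith
          _ = (‖d‖ * ‖d‖) * (‖a‖ * ‖a‖) := by ring
          _ = _ := by rw [hd2]
      exact le_of_mul_le_mul_left this hδ0
    have had : ‖d‖ = ‖a‖ := by
      rw [← Real.sqrt_mul_self hd0, ← Real.sqrt_mul_self ha0, hd2, ha2]
    -- Here `|a| = |d| = √δ`, so dividing by the power of `p` in `a` makes the matrix a unit of the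
    -- order.
    obtain ⟨k, hk⟩ := exists_norm_eq_zpow ha'
    have hpk : (p : ℚ_[p]) ^ k ≠ 0 := zpow_ne_zero _ hp0
    have hnk : ∀ x : ℚ_[p], ∀ r : ℝ, ‖x‖ ≤ ‖a‖ * r → ‖((p : ℚ_[p]) ^ k)⁻¹ * x‖ ≤ r := by
      intro x r hx
      rw [norm_mul, norm_inv, Padic.norm_p_zpow, ← hk]
      rwa [inv_mul_le_iff₀ hapos]
    refine ⟨k, !![(((p : ℚ_[p]) ^ k)⁻¹ * a), (((p : ℚ_[p]) ^ k)⁻¹ * b);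
      (((p : ℚ_[p]) ^ k)⁻¹ * c), (((p : ℚ_[p]) ^ k)⁻¹ * d)], ?_, ?_, Or.inl ?_⟩
    · refine (mem_stdSplit hN).2 ⟨hnk _ _ (by simp), hnk _ _ ?_, hnk _ _ ?_, hnk _ _ (by simp [had])⟩
      · have : ‖a‖ * ‖b‖ ≤ ‖a‖ * (‖a‖ * 1) := by linarith
        exact le_of_mul_le_mul_left this hapos
      · have : ‖a‖ * ‖c‖ ≤ ‖a‖ * (‖a‖ * ρ) := by
          rw [had] at hcd; nlinarith
        exact le_of_mul_le_mul_left this hapos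
    · refine exists_eq_algebraMap_self (P := fun d => ‖d‖ = 1) ?_
      rw [Matrix.det_fin_two_of, show ((p : ℚ_[p]) ^ k)⁻¹ * a * (((p : ℚ_[p]) ^ k)⁻¹ * d) -
        ((p : ℚ_[p]) ^ k)⁻¹ * b * (((p : ℚ_[p]) ^ k)⁻¹ * c) =
        ((p : ℚ_[p]) ^ k)⁻¹ * ((p : ℚ_[p]) ^ k)⁻¹ * (a * d - b * c) by ring, ← hdet, norm_mul, ← hδ,
        norm_mul, norm_inv, Padic.norm_p_zpow, ← hk, ← ha2]
      field_simp
    · ext i j; fin_cases i <;> fin_cases j <;> simp [mul_inv_cancel_left₀ hpk]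
  · have hb' : b ≠ 0 := by
      rintro rfl; simp at hcase; linarith
    have hbpos : 0 < ‖b‖ := norm_pos_iff.mpr hb'
    have hb2 : ‖b‖ * ‖b‖ * ρ = δ := by
      apply le_antisymm hbb
      have : δ * δ ≤ δ * (‖b‖ * ‖b‖ * ρ) := by
        calc δ * δ ≤ (‖b‖ * ‖c‖) * (‖b‖ * ‖c‖) := by nlinarith
          _ = (‖b‖ * ‖b‖) * (‖c‖ * ‖c‖) := by ring
          _ ≤ (‖b‖ * ‖b‖) * (δ * ρ) := mul_le_mul_of_nonneg_left hcc (by positivity)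
          _ = _ := by ring
      exact le_of_mul_le_mul_left this hδ0
    have hc2 : ‖c‖ = ‖b‖ * ρ := by
      apply le_antisymm
      · refine abs_le_of_sq_le_sq' ?_ (by positivity) |>.2
        calc ‖c‖ ^ 2 ≤ δ * ρ := by rw [sq]; exact hcc
          _ = _ := by rw [← hb2]; ring
      · have : ‖b‖ * (‖b‖ * ρ) ≤ ‖b‖ * ‖c‖ := by linarith
        exact le_of_mul_le_mul_left this hbpos
    have ha3 : ‖a‖ ≤ ‖b‖ * ρ := by
      have : ‖b‖ * ‖a‖ ≤ ‖b‖ * (‖b‖ * ρ) := by linarith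
      exact le_of_mul_le_mul_left this hbpos
    have hd3 : ‖d‖ ≤ ‖b‖ * ρ := by
      have : (‖b‖ * ρ) * ‖d‖ ≤ (‖b‖ * ρ) * (‖b‖ * ρ) := by
        rw [← hc2]; calc _ ≤ _ := hcd
          _ = (‖b‖ * ρ) * (‖b‖ * ρ) := by rw [← hb2]; ring
          _ = _ := by rw [hc2]
      exact le_of_mul_le_mul_left this (by positivity)
    -- Here `|c| = |b| ρ` while `a` and `d` are at most `|b| ρ`; the scalar is the power of `p` in
    -- `b`, and swapping the rows absorbs the remaining `p^v`.
    obtain ⟨k, hk⟩ := exists_norm_eq_zpow hb'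
    have hpk : (p : ℚ_[p]) ^ k ≠ 0 := zpow_ne_zero _ hp0
    have hpv : (p : ℚ_[p]) ^ v ≠ 0 := pow_ne_zero _ hp0
    have hnv : ‖(p : ℚ_[p]) ^ v‖ = ρ := by simp [hρ]
    have hnk : ∀ x : ℚ_[p], ∀ r : ℝ, ‖x‖ ≤ ‖b‖ * r → ‖((p : ℚ_[p]) ^ k)⁻¹ * x‖ ≤ r := by
      intro x r hx
      rw [norm_mul, norm_inv, Padic.norm_p_zpow, ← hk]
      rwa [inv_mul_le_iff₀ hbpos]
    have hnk' : ∀ x : ℚ_[p], ‖x‖ ≤ ‖b‖ * ρ →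
        ‖((p : ℚ_[p]) ^ v)⁻¹ * (((p : ℚ_[p]) ^ k)⁻¹ * x)‖ ≤ 1 := by
      intro x hx
      rw [norm_mul, norm_inv, hnv, inv_mul_le_iff₀ hρ0, mul_one]
      exact hnk _ _ hx
    refine ⟨k, !![((p : ℚ_[p]) ^ v)⁻¹ * (((p : ℚ_[p]) ^ k)⁻¹ * c),
      ((p : ℚ_[p]) ^ v)⁻¹ * (((p : ℚ_[p]) ^ k)⁻¹ * d);
      (((p : ℚ_[p]) ^ k)⁻¹ * a), (((p : ℚ_[p]) ^ k)⁻¹ * b)], ?_, ?_, Or.inr ?_⟩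
    · exact (mem_stdSplit hN).2 ⟨hnk' _ hc2.le, hnk' _ hd3, hnk _ _ ha3, hnk _ _ (by simp)⟩
    · refine exists_eq_algebraMap_self (P := fun d => ‖d‖ = 1) ?_
      rw [Matrix.det_fin_two_of, show ((p : ℚ_[p]) ^ v)⁻¹ * (((p : ℚ_[p]) ^ k)⁻¹ * c) *
        (((p : ℚ_[p]) ^ k)⁻¹ * b) - ((p : ℚ_[p]) ^ v)⁻¹ * (((p : ℚ_[p]) ^ k)⁻¹ * d) *
        (((p : ℚ_[p]) ^ k)⁻¹ * a) = - (((p : ℚ_[p]) ^ v)⁻¹ * (((p : ℚ_[p]) ^ k)⁻¹ *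
        ((p : ℚ_[p]) ^ k)⁻¹) * (a * d - b * c)) by ring, ← hdet, norm_neg, norm_mul, ← hδ,
        norm_mul, norm_mul, norm_inv, norm_inv, hnv, Padic.norm_p_zpow, ← hk, ← hb2]
      field_simp
    · rw [splitSwap]
      ext i j; fin_cases i <;> fin_cases j <;>
        simp [mul_inv_cancel_left₀ hpk, mul_inv_cancel_left₀ hpv]

/-- For the corner criterion, `w⁻¹ z` has rows `p^(-v)` times the lower row of `z`, and the upper
row of `z`. It lies in the order as soon as both diagonal entries of `z` are divisible by `p^v`, and
its determinant is a unit if `det z` has valuation `v`. -/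
lemma splitModel {N : ℕ} (hN : N ≠ 0) :
    LocalModel p (stdSplit p N) Set.univ (N.factorization p)
      (fun M => ∃ y : ℤ_[p], M 0 0 = (p : ℚ_[p]) ^ (N.factorization p) * y)
      (splitSwap p (N.factorization p)) := by
  set v := N.factorization p with hv
  have hp0 : (p : ℚ_[p]) ≠ 0 := padic_prime_ne_zero
  have hpp : (0 : ℝ) < p := prime_cast_pos
  have hpv : (p : ℚ_[p]) ^ v ≠ 0 := pow_ne_zero _ hp0
  set ρ : ℝ := (p : ℝ) ^ (-v : ℤ) with hρ
  have hρ0 : 0 < ρ := by positivity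
  have hρ1 : ρ ≤ 1 := zpow_le_one_of_nonpos₀ one_lt_prime_cast.le (by omega)
  have hnv : ‖(p : ℚ_[p]) ^ v‖ = ρ := by simp [hρ]
  have eta (z : Matrix (Fin 2) (Fin 2) ℚ_[p]) : ∃ a b c d, z = !![a, b; c, d] :=
    ⟨_, _, _, _, Matrix.eta_fin_two z⟩
  have hdiv : ∀ x : ℚ_[p], ‖x‖ ≤ ρ → ‖((p : ℚ_[p]) ^ v)⁻¹ * x‖ ≤ 1 := by
    intro x hx
    rwa [norm_mul, norm_inv, hnv, inv_mul_le_iff₀ hρ0, mul_one]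
  have hmul : ∀ x : ℚ_[p], ‖x‖ ≤ 1 → ‖(p : ℚ_[p]) ^ v * x‖ ≤ ρ := by
    intro x hx
    rw [norm_mul, hnv]; exact mul_le_of_le_one_right hρ0.le hx
  refine ⟨?_, ?_, ?_, ?_, ?_, ?_, ?_, ?_, ?_⟩
  · exact (mem_stdSplit hN).2 (by simp [hv])
  · ext i j; fin_cases i <;> fin_cases j <;>
      simp [splitSwap, Matrix.algebraMap_matrix_apply]
  · intro z hz
    obtain ⟨a, b, c, d, rfl⟩ := eta z
    obtain ⟨h1, h2, h3, h4⟩ := (mem_stdSplit hN).1 hz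
    refine ⟨!![d, ((p : ℚ_[p]) ^ v)⁻¹ * c; (p : ℚ_[p]) ^ v * b, a],
      (mem_stdSplit hN).2 ⟨h4, hdiv _ h3, hmul _ h2, h1⟩, ?_⟩
    ext i j; fin_cases i <;> fin_cases j <;> simp [splitSwap] <;> field_simp
  · intro z hz
    obtain ⟨a, b, c, d, rfl⟩ := eta z
    obtain ⟨h1, h2, h3, h4⟩ := (mem_stdSplit hN).1 hz
    refine exists_eq_algebraMap_self (P := fun d => ‖d‖ ≤ 1) ?_
    rw [Matrix.det_fin_two_of]
    refine (norm_sub_le_max' _ _).trans (max_le ?_ ?_) <;> rw [norm_mul]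
    · exact mul_le_one₀ h1 (norm_nonneg _) h4
    · exact mul_le_one₀ h2 (norm_nonneg _) (h3.trans hρ1)
  · intro z hz
    obtain ⟨a, b, c, d, rfl⟩ := eta z
    obtain ⟨h1, h2, h3, h4⟩ := (mem_stdSplit hN).1 hz
    refine exists_eq_algebraMap_self (P := fun d => ‖d‖ ≤ 1) ?_
    rw [Matrix.trace_fin_two_of]
    exact (Padic.nonarchimedean _ _).trans (max_le h1 h4)
  · intro z hz
    obtain ⟨a, b, c, d, rfl⟩ := eta z
    obtain ⟨h1, h2, h3, h4⟩ := (mem_stdSplit hN).1 hz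
    rw [Matrix.adjugate_fin_two_of]
    exact (mem_stdSplit hN).2 ⟨h4, by simpa using h2, by simpa using h3, h1⟩
  · intro M _ D hD hdet hM
    exact split_classify hN M (by rw [hdet]; simpa using hD) hM
  · rintro hv0 k z hz ⟨d, hd, hd1⟩ h
    obtain ⟨a, b, c, e, rfl⟩ := eta z
    obtain ⟨h1, h2, h3, h4⟩ := (mem_stdSplit hN).1 hz
    -- The determinant gives `v = 2k`, whereas the upper right entry `1 = p^k b` forces `k ≤ 0`;
    -- this contradicts `v > 0`.
    have hdet := congr_arg (fun M => ‖Matrix.det M‖) h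
    simp only [Matrix.det_smul, hd, splitSwap, Matrix.det_fin_two_of] at hdet
    rw [zero_mul, one_mul, zero_sub, norm_neg, hnv, Algebra.algebraMap_self, RingHom.id_apply,
      norm_mul, hd1, mul_one, Fintype.card_fin, norm_pow, Padic.norm_p_zpow, ← zpow_natCast,
      ← zpow_mul, hρ] at hdet
    have hb := congr_arg norm (congr_fun₂ h 0 1)
    simp [splitSwap, -zpow_neg] at hb
    have hb' : (1 : ℝ) ≤ (p : ℝ) ^ (-k) := by
      rw [hb]; exact mul_le_of_le_one_right (by positivity) h2
    rw [← zpow_zero (p : ℝ), zpow_le_zpow_iff_right₀ one_lt_prime_cast] at hb'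
    have := zpow_right_injective₀ hpp one_lt_prime_cast.ne' hdet
    omega
  · intro hv0 z hz d t hd ht
    obtain ⟨a, b, c, e, rfl⟩ := eta z
    obtain ⟨h1, h2, h3, h4⟩ := (mem_stdSplit hN).1 hz
    have hρlt : ρ < 1 := by
      rw [hρ, ← zpow_zero (p : ℝ)]
      exact zpow_lt_zpow_right₀ one_lt_prime_cast (by omega)
    rw [Matrix.det_fin_two_of] at hd
    rw [Matrix.trace_fin_two_of] at ht
    simp only [Algebra.algebraMap_self, RingHom.id_apply] at hd ht
    subst hd ht
    rw [exists_padicInt_mul_pow_iff]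
    simp only [Matrix.of_apply, Matrix.cons_val', Matrix.cons_val_zero]
    rw [← hρ]
    constructor
    · rintro ⟨hd, ht, ha⟩
      -- The other diagonal entry is the trace minus the corner; this is why the condition on the
      -- trace is part of the criterion.
      have he : ‖e‖ ≤ ρ := by
        have := norm_sub_le_max' (a + e) a
        rw [add_sub_cancel_left] at this
        exact this.trans (max_le ht ha)
      refine ⟨!![((p : ℚ_[p]) ^ v)⁻¹ * c, ((p : ℚ_[p]) ^ v)⁻¹ * e; a, b],
        (mem_stdSplit hN).2 ⟨hdiv _ h3, hdiv _ he, ha, h2⟩, exists_eq_algebraMap_self (P := fun d => ‖d‖ = 1) ?_, ?_⟩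
      · rw [Matrix.det_fin_two_of, show ((p : ℚ_[p]) ^ v)⁻¹ * c * b -
          ((p : ℚ_[p]) ^ v)⁻¹ * e * a = - (((p : ℚ_[p]) ^ v)⁻¹ * (a * e - b * c)) by ring,
          norm_neg, norm_mul, hd, norm_inv, hnv, inv_mul_cancel₀ hρ0.ne']
      · ext i j; fin_cases i <;> fin_cases j <;>
          simp [splitSwap, mul_inv_cancel_left₀ hpv]
    · rintro ⟨u, hu, ⟨d, hd, hd1⟩, h⟩
      obtain ⟨a', b', c', e', rfl⟩ := eta u
      obtain ⟨h1', h2', h3', h4'⟩ := (mem_stdSplit hN).1 hu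
      have h00 := congr_fun₂ h 0 0
      have h01 := congr_fun₂ h 0 1
      have h10 := congr_fun₂ h 1 0
      have h11 := congr_fun₂ h 1 1
      simp [splitSwap] at h00 h01 h10 h11
      subst h00 h01 h10 h11
      rw [Matrix.det_fin_two_of] at hd
      simp only [Algebra.algebraMap_self, RingHom.id_apply] at hd
      subst hd
      refine ⟨?_, ?_, h3'⟩
      · rw [show a * (p ^ v * b') - b * (p ^ v * a') = -((p : ℚ_[p]) ^ v * (a' * b - b' * a)) by ring,
          norm_neg, norm_mul, hd1, hnv, mul_one]
      · exact (Padic.nonarchimedean _ _).trans (max_le h3' (hmul _ h2'))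

end Split

/-! ### The unramified quadratic extension and the local order at primes dividing `N₁` -/

lemma zmod_two_sq_add_add_one_ne_zero : ∀ u : ZMod 2, u ^ 2 + u + 1 ≠ 0 := by decide

section Ramified

variable {p : ℕ} [hp : Fact p.Prime] {ε : ℤ}

lemma padicInt_norm_eq_one_iff_toZMod (x : ℤ_[p]) : ‖x‖ = 1 ↔ PadicInt.toZMod x ≠ 0 := by
  rw [← PadicInt.isUnit_iff, Ne, ← RingHom.mem_ker, PadicInt.ker_toZMod,
    IsLocalRing.mem_maximalIdeal, mem_nonunits_iff, not_not]

/-- A binary quadratic form over `ℤ` that is anisotropic modulo `p` has norm `max(|s|, |t|)²`. -/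
lemma norm_anisotropic_form (c e : ℤ) (h : ∀ u : ZMod p, u ^ 2 + c * u + e ≠ 0) (s t : ℚ_[p]) :
    ‖s ^ 2 + c * s * t + e * t ^ 2‖ = max ‖s‖ ‖t‖ ^ 2 := by
  rcases le_or_gt ‖s‖ ‖t‖ with hst | hst
  · rw [max_eq_right hst]
    by_cases ht : t = 0
    · subst ht
      have : s = 0 := by simpa using hst
      simp [this]
    have ht' : 0 < ‖t‖ := norm_pos_iff.mpr ht
    -- By homogeneity the larger variable can be divided out; anisotropy modulo `p` then makes the
    -- value at the integral quotient a unit.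
    let u : ℤ_[p] := ⟨s / t, by rw [norm_div]; exact div_le_one_of_le₀ hst ht'.le⟩
    have hu : ‖u ^ 2 + c * u + e‖ = 1 := by
      rw [padicInt_norm_eq_one_iff_toZMod]
      simpa using h (PadicInt.toZMod u)
    rw [PadicInt.norm_def] at hu
    push_cast at hu
    rw [show s ^ 2 + c * s * t + e * t ^ 2 = t ^ 2 * ((s / t) ^ 2 + c * (s / t) + e) by
      field_simp, norm_mul, norm_pow]
    change ‖t‖ ^ 2 * ‖(u : ℚ_[p]) ^ 2 + c * u + e‖ = _
    rw [hu, mul_one]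
  · rw [max_eq_left hst.le]
    have hs' : 0 < ‖s‖ := (norm_nonneg _).trans_lt hst
    have hs : s ≠ 0 := norm_pos_iff.mp hs'
    have hlt : ‖t / s‖ < 1 := by rw [norm_div]; exact (div_lt_one hs').2 hst
    let u : ℤ_[p] := ⟨t / s, hlt.le⟩
    have hu0 : PadicInt.toZMod u = 0 := by
      by_contra h0
      exact hlt.ne ((padicInt_norm_eq_one_iff_toZMod u).2 h0)
    have hu : ‖1 + c * u + e * u ^ 2‖ = 1 := by
      rw [padicInt_norm_eq_one_iff_toZMod]
      simp [hu0]
    rw [PadicInt.norm_def] at hu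
    push_cast at hu
    rw [show s ^ 2 + c * s * t + e * t ^ 2 = s ^ 2 * (1 + c * (t / s) + e * (t / s) ^ 2) by
      field_simp, norm_mul, norm_pow]
    change ‖s‖ ^ 2 * ‖1 + c * (u : ℚ_[p]) + e * u ^ 2‖ = _
    rw [hu, mul_one]

/-- The element of the unramified extension with coordinates `s, t` with respect to the standard
basis of `R_p`. -/
def unramMk (p : ℕ) [Fact p.Prime] (ε : ℤ) (s t : ℚ_[p]) : UnramExt p ε :=
  if p = 2 then ⟨s + t / 2, t / 2⟩ else ⟨s, t⟩

lemma unramMk_surjective (z : UnramExt p ε) : ∃ s t, z = unramMk p ε s t := by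
  unfold unramMk
  split_ifs
  · refine ⟨z.re - z.im, 2 * z.im, ?_⟩
    ext <;> simp
  · exact ⟨z.re, z.im, rfl⟩

/-- In the standard basis the norm form is `s² - ε t²` for odd `p` and `s² + s t + t²` for `p = 2`;
both have no zero with `t = 1` modulo `p`. -/
lemma norm_unramMk (hε : IsUnramifiedParam p ε) (s t : ℚ_[p]) :
    ‖(unramMk p ε s t).norm‖ = max ‖s‖ ‖t‖ ^ 2 := by
  unfold unramMk
  unfold IsUnramifiedParam at hε
  split_ifs at hε ⊢ with h2
  · subst h2 hε
    rw [← norm_anisotropic_form 1 1 (by simpa using zmod_two_sq_add_add_one_ne_zero)]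
    congr 1
    simp [QuadraticAlgebra.norm_def]
    ring
  · rw [← norm_anisotropic_form 0 (-ε)]
    · congr 1
      simp [QuadraticAlgebra.norm_def]
      ring
    · intro u hu
      rw [legendreSym.eq_neg_one_iff] at hε
      exact hε ⟨u, by push_cast at hu; linear_combination -hu⟩

/-- `R_p` is the unit ball for the norm. From here on the shape of its elements, and with it the
distinction between `p = 2` and odd `p`, plays almost no role. -/
lemma mem_unramInt_iff (hε : IsUnramifiedParam p ε) (z : UnramExt p ε) :
    z ∈ unramInt p ε ↔ ‖z.norm‖ ≤ 1 := by
  constructor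
  · rintro ⟨s, t, h⟩
    have h' : z = unramMk p ε s t := h
    rw [h', norm_unramMk hε]
    exact pow_le_one₀ (by positivity) (max_le s.2 t.2)
  · intro h
    obtain ⟨s, t, rfl⟩ := unramMk_surjective z
    rw [norm_unramMk hε, sq_le_one_iff₀ (by positivity)] at h
    exact ⟨⟨s, (le_max_left _ _).trans h⟩, ⟨t, (le_max_right _ _).trans h⟩, rfl⟩

/-- Norms from the unramified extension have even valuation; this separates `N(α)` from `p N(β)`
below. -/
lemma exists_unramNorm_eq (hε : IsUnramifiedParam p ε) {z : UnramExt p ε} (h : z.norm ≠ 0) :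
    ∃ k : ℤ, ‖z.norm‖ = ((p : ℝ) ^ (-k)) ^ 2 := by
  obtain ⟨s, t, rfl⟩ := unramMk_surjective z
  have h1 := norm_unramMk hε s t
  have hm : max ‖s‖ ‖t‖ ≠ 0 := by
    intro h0
    rw [h0] at h1
    simp at h1
    exact h h1
  rw [h1]
  rcases max_choice ‖s‖ ‖t‖ with h2 | h2 <;> rw [h2] at hm ⊢ <;>
  · obtain ⟨k, hk⟩ := exists_norm_eq_zpow (norm_ne_zero_iff.1 hm)
    exact ⟨k, by rw [hk]⟩

/-- The extension is unramified, so a generator of `R_p` differs from its conjugate by a unit: `i`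
serves for odd `p`, `(1 + i)/2` for `p = 2`. -/
lemma exists_unramInt_star_sub (hε : IsUnramifiedParam p ε) :
    ∃ z ∈ unramInt p ε, ‖(star z - z).norm‖ = 1 := by
  by_cases h2 : p = 2
  · refine ⟨unramMk p ε 0 1, ⟨0, 1, by simp [unramMk]⟩, ?_⟩
    rw [show star (unramMk p ε 0 1) - unramMk p ε 0 1 = unramMk p ε 1 (-2) by
      simp only [unramMk, if_pos h2]; ext <;> simp; norm_num, norm_unramMk hε]
    rw [norm_one, norm_neg, max_eq_left, one_pow]
    exact_mod_cast Padic.norm_int_le_one 2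
  · refine ⟨unramMk p ε 0 1, ⟨0, 1, by simp [unramMk]⟩, ?_⟩
    rw [show star (unramMk p ε 0 1) - unramMk p ε 0 1 = unramMk p ε 0 (-2) by
      simp only [unramMk, if_neg h2]; ext <;> simp; norm_num, norm_unramMk hε]
    have : ‖((2 : ℕ) : ℚ_[p])‖ = 1 :=
      Padic.norm_natCast_eq_one_iff.2 ((Nat.coprime_primes hp.out Nat.prime_two).2 h2)
    rw [Nat.cast_ofNat] at this
    simp [this]

lemma unramTrace_norm_le {z : UnramExt p ε} (h : z ∈ unramInt p ε) :
    ‖2 * z.re‖ ≤ 1 := by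
  obtain ⟨s, t, rfl⟩ := h
  have h2 : ((2 : ℤ_[p]) : ℚ_[p]) = 2 := rfl
  split_ifs
  · have : (2 * ((s : ℚ_[p]) + t / 2)) = ((2 * s + t : ℤ_[p]) : ℚ_[p]) := by
      push_cast [h2]; ring
    change ‖2 * ((s : ℚ_[p]) + t / 2)‖ ≤ 1
    rw [this]; exact (2 * s + t : ℤ_[p]).2
  · change ‖2 * (s : ℚ_[p])‖ ≤ 1
    have : 2 * (s : ℚ_[p]) = ((2 * s : ℤ_[p]) : ℚ_[p]) := by push_cast [h2]; ring
    rw [this]; exact (2 * s : ℤ_[p]).2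

lemma unramNorm_smul (c : ℚ_[p]) (z : UnramExt p ε) : (c • z).norm = c ^ 2 * z.norm := by
  simp [QuadraticAlgebra.norm_def]; ring

lemma unram_natCast_pow_mul (n : ℕ) (z : UnramExt p ε) :
    (p : UnramExt p ε) ^ n * z = (p : ℚ_[p]) ^ (n : ℤ) • z := by
  rw [Algebra.smul_def, zpow_natCast, map_pow, map_natCast]

lemma unram_star_smul (c : ℚ_[p]) (z : UnramExt p ε) : star (c • z) = c • star z := by
  ext <;> simp

/-- The matrix `(α, p^u β; p^(u+1) β̄, ᾱ)`. -/
def ramMk (p : ℕ) [Fact p.Prime] (ε : ℤ) (u : ℕ) (α β : UnramExt p ε) :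
    Matrix (Fin 2) (Fin 2) (UnramExt p ε) :=
  !![α, (p : UnramExt p ε) ^ u * β; (p : UnramExt p ε) ^ (u + 1) * star β, star α]

lemma ramMk_mem {u : ℕ} {α β : UnramExt p ε} (hα : α ∈ unramInt p ε) (hβ : β ∈ unramInt p ε) :
    ramMk p ε u α β ∈ stdRamified p ε u := ⟨α, hα, β, hβ, rfl⟩

lemma star_mem_unramInt (hε : IsUnramifiedParam p ε) {α : UnramExt p ε}
    (hα : α ∈ unramInt p ε) : star α ∈ unramInt p ε := by
  rw [mem_unramInt_iff hε] at hα ⊢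
  rwa [QuadraticAlgebra.norm_star]

lemma det_ramMk (u : ℕ) (α β : UnramExt p ε) :
    (ramMk p ε u α β).det =
      algebraMap ℚ_[p] _ (α.norm - (p : ℚ_[p]) ^ (2 * u + 1) * β.norm) := by
  rw [ramMk, Matrix.det_fin_two_of, map_sub, map_mul, QuadraticAlgebra.algebraMap_norm_eq_mul_star,
    QuadraticAlgebra.algebraMap_norm_eq_mul_star, map_pow, map_natCast]
  ring

lemma trace_ramMk (u : ℕ) (α β : UnramExt p ε) :
    (ramMk p ε u α β).trace = algebraMap ℚ_[p] _ (2 * α.re) := by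
  rw [ramMk, Matrix.trace_fin_two_of]
  ext <;> simp; ring

lemma ramMk_swap_mul (u : ℕ) (α β : UnramExt p ε) :
    ramMk p ε u 0 1 * ramMk p ε u α β =
      ramMk p ε u ((p : UnramExt p ε) ^ (2 * u + 1) * star β) (star α) := by
  ext1 i j
  fin_cases i <;> fin_cases j <;> simp [ramMk, Matrix.mul_apply] <;> ring

lemma norm_prime_pow_lt {n : ℕ} (hn : 0 < n) : ‖(p : ℚ_[p]) ^ n‖ < 1 := by
  rw [norm_pow]
  exact pow_lt_one₀ (norm_nonneg _) Padic.norm_p_lt_one hn.ne'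

lemma hasUnitDet_ramMk (u : ℕ) {α β : UnramExt p ε} (hα : ‖α.norm‖ = 1) (hβ : ‖β.norm‖ ≤ 1) :
    HasUnitDet p (ramMk p ε u α β) := by
  refine ⟨_, det_ramMk u α β, ?_⟩
  have h : ‖(p : ℚ_[p]) ^ (2 * u + 1) * β.norm‖ < 1 := by
    rw [norm_mul]
    exact mul_lt_one_of_nonneg_of_lt_one_left (norm_nonneg _) (norm_prime_pow_lt (by omega)) hβ
  rw [sub_eq_add_neg, Padic.add_eq_max_of_ne (by rw [norm_neg, hα]; exact h.ne'), norm_neg, hα,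
    max_eq_left h.le]

lemma norm_eq_of_lt_norm_sub {x y : ℚ_[p]} (h : ‖x‖ < ‖x - y‖) : ‖y‖ = ‖x - y‖ := by
  apply le_antisymm
  · have := norm_sub_le_max' x (x - y)
    rw [sub_sub_cancel] at this
    exact this.trans (max_le h.le le_rfl)
  · rcases le_max_iff.1 (norm_sub_le_max' x y) with h1 | h1
    · exact absurd h (not_lt.2 h1)
    · exact h1

lemma det_fin_two_smul {L : Type*} [CommRing L] [Algebra ℚ_[p] L] (c : ℚ_[p])
    (z : Matrix (Fin 2) (Fin 2) L) : (c • z).det = algebraMap ℚ_[p] L (c ^ 2) * z.det := by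
  simp only [Matrix.det_fin_two, Matrix.smul_apply, map_pow]
  simp only [Algebra.smul_def]
  ring

/-- Only one test element is needed, the diagonal matrix of `ρ` and its conjugate: it gives `|N(α)|
|N(β)| ≤ p^(-2u) |D|²`. Since `N(α)` and `p N(β)` have valuations of different parity, `|D|` is the
larger of `|N(α)|` and `|p N(β)|`, and the inequality makes the other coordinate small enough for a
unit of the order, or for the coset of `ramMk p ε u 0 1`. -/
lemma ramified_classify (hε : IsUnramifiedParam p ε) (u : ℕ) (α β : UnramExt p ε) (D : ℚ_[p])
    (hD : D ≠ 0) (hdet : D = α.norm - p * β.norm)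
    (hM : ∀ z ∈ stdRamified p ε u, ∃ z' ∈ stdRamified p ε u,
      !![α, β; (p : UnramExt p ε) * star β, star α] * z =
        z' * !![α, β; (p : UnramExt p ε) * star β, star α]) :
    ∃ k : ℤ, ∃ z ∈ stdRamified p ε u, HasUnitDet p z ∧
      (!![α, β; (p : UnramExt p ε) * star β, star α] = (p : ℚ_[p]) ^ k • z ∨
        !![α, β; (p : UnramExt p ε) * star β, star α] =
          (p : ℚ_[p]) ^ k • (ramMk p ε u 0 1 * z)) := by
  have hp0 : (p : ℚ_[p]) ≠ 0 := padic_prime_ne_zero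
  have hpp : (0 : ℝ) < p := prime_cast_pos
  obtain ⟨ρ, hρ, hρ1⟩ := exists_unramInt_star_sub hε
  have hz0 : (0 : UnramExt p ε) ∈ unramInt p ε := (mem_unramInt_iff hε _).2 (by simp)
  have key : ‖α.norm‖ * ‖β.norm‖ ≤ ((p : ℝ) ^ (-u : ℤ)) ^ 2 * ‖D‖ ^ 2 := by
    obtain ⟨z', ⟨x, hx, y, hy, rfl⟩, h⟩ := hM _ (ramMk_mem (u := u) hρ hz0)
    have h00 := congr_fun₂ h 0 0
    have h01 := congr_fun₂ h 0 1
    simp [ramMk] at h00 h01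
    have hDL : algebraMap ℚ_[p] (UnramExt p ε) D = α * star α - p * (β * star β) := by
      rw [hdet, map_sub, map_mul, QuadraticAlgebra.algebraMap_norm_eq_mul_star,
        QuadraticAlgebra.algebraMap_norm_eq_mul_star, map_natCast]
    -- Eliminating the diagonal entry `x` of `z'` from the upper row leaves `D` times its upper
    -- right entry.
    have h1 : α * β * (star ρ - ρ) = D • ((p : UnramExt p ε) ^ u * y) := by
      rw [Algebra.smul_def, hDL]
      linear_combination α * h01 - β * h00
    have h2 := congr_arg (fun z => ‖QuadraticAlgebra.norm z‖) h1
    simp only [map_mul, norm_mul, hρ1, unramNorm_smul, unram_natCast_pow_mul] at h2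
    rw [mul_one] at h2
    rw [h2, norm_pow, norm_pow, Padic.norm_p_zpow]
    have hy1 := (mem_unramInt_iff hε y).1 hy
    have h3 : ((p : ℝ) ^ (-u : ℤ)) ^ 2 * ‖y.norm‖ ≤ ((p : ℝ) ^ (-u : ℤ)) ^ 2 :=
      mul_le_of_le_one_right (by positivity) hy1
    calc _ ≤ ‖D‖ ^ 2 * ((p : ℝ) ^ (-u : ℤ)) ^ 2 :=
          mul_le_mul_of_nonneg_left h3 (by positivity)
      _ = _ := mul_comm _ _
  have hzp : ∀ n : ℤ, (p : ℚ_[p]) ^ n ≠ 0 := fun n => zpow_ne_zero _ hp0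
  have hne : α.norm ≠ 0 ∨ β.norm ≠ 0 := by
    by_contra! h
    apply hD
    rw [hdet, h.1, h.2]; simp
  have hpn : ‖(p : ℚ_[p]) * β.norm‖ = (p : ℝ)⁻¹ * ‖β.norm‖ := by rw [norm_mul, Padic.norm_p]
  -- An even valuation cannot equal an odd one.
  have hdiff : ‖α.norm‖ ≠ (p : ℝ)⁻¹ * ‖β.norm‖ := by
    intro h
    by_cases ha : α.norm = 0
    · rw [ha, norm_zero, eq_comm, mul_eq_zero, norm_eq_zero] at h
      rcases h with h | h
      · exact (inv_ne_zero hpp.ne') h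
      · exact hne.elim (· ha) (· h)
    · have hb : β.norm ≠ 0 := by
        intro hb
        rw [hb, norm_zero, mul_zero, norm_eq_zero] at h
        exact ha h
      obtain ⟨k, hk⟩ := exists_unramNorm_eq hε ha
      obtain ⟨j, hj⟩ := exists_unramNorm_eq hε hb
      rw [hk, hj, ← zpow_neg_one, ← zpow_natCast, ← zpow_natCast, ← zpow_mul, ← zpow_mul,
        ← zpow_add₀ hpp.ne'] at h
      have := zpow_right_injective₀ hpp one_lt_prime_cast.ne' h
      push_cast at this
      omega
  have hDmax : ‖D‖ = max ‖α.norm‖ ((p : ℝ)⁻¹ * ‖β.norm‖) := by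
    rw [hdet, sub_eq_add_neg, Padic.add_eq_max_of_ne (by rw [norm_neg, hpn]; exact hdiff),
      norm_neg, hpn]
  rcases lt_or_gt_of_ne hdiff with hlt | hlt
  · rw [max_eq_right hlt.le] at hDmax
    have hb : β.norm ≠ 0 := by
      intro hb
      rw [hb, norm_zero, mul_zero] at hlt
      exact absurd hlt (not_lt.2 (norm_nonneg _))
    have hbpos : 0 < ‖β.norm‖ := norm_pos_iff.2 hb
    obtain ⟨j, hj⟩ := exists_unramNorm_eq hε hb
    have hA : ‖α.norm‖ ≤ ((p : ℝ) ^ (-u : ℤ)) ^ 2 * ((p : ℝ)⁻¹) ^ 2 * ‖β.norm‖ := by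
      rw [hDmax] at key
      refine le_of_mul_le_mul_right (key.trans_eq ?_) hbpos
      ring
    have hα' : ‖QuadraticAlgebra.norm (star ((p : ℚ_[p]) ^ (-j) • β))‖ = 1 := by
      rw [QuadraticAlgebra.norm_star, unramNorm_smul, norm_mul, hj, norm_pow, Padic.norm_p_zpow,
        ← mul_pow, ← zpow_add₀ hpp.ne']
      simp
    have hβ' : ‖QuadraticAlgebra.norm (star ((p : ℚ_[p]) ^ (-(j + u + 1)) • α))‖ ≤ 1 := by
      rw [QuadraticAlgebra.norm_star, unramNorm_smul, norm_mul, norm_pow, Padic.norm_p_zpow]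
      refine (mul_le_mul_of_nonneg_left hA (by positivity)).trans_eq ?_
      rw [hj, ← mul_pow, ← mul_pow, ← mul_pow, ← zpow_neg_one, ← zpow_add₀ hpp.ne',
        ← zpow_add₀ hpp.ne', ← zpow_add₀ hpp.ne']
      rw [show - -(j + u + 1) + (-(u : ℤ) + -1 + -j) = 0 by ring]; simp
    -- The entry `β` has valuation `j` and the upper right entry of `w` contributes `u`, hence the
    -- scalar `p^(j - u)`.
    refine ⟨j - u, ramMk p ε u _ _, ramMk_mem ((mem_unramInt_iff hε _).2 hα'.le)
      ((mem_unramInt_iff hε _).2 hβ'), hasUnitDet_ramMk u hα' hβ', Or.inr ?_⟩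
    rw [ramMk_swap_mul]
    ext1 i j'
    fin_cases i <;> fin_cases j' <;>
      simp only [ramMk, unram_natCast_pow_mul, unram_star_smul, star_star, Matrix.of_apply,
        Matrix.cons_val', Matrix.cons_val_zero, Matrix.cons_val_one, Matrix.smul_apply,
        Matrix.cons_val_fin_one, Fin.zero_eta, Fin.mk_one, smul_smul, ← zpow_add₀ hp0]
    · rw [show (j - u + (((2 * u + 1 : ℕ) : ℤ) + -(j + u + 1))) = 0 by push_cast; ring]; simp
    · rw [show (j - u + ((u : ℤ) + -j)) = 0 by ring]; simp
    · rw [show (j - u + (((u + 1 : ℕ) : ℤ) + -j)) = ((1 : ℕ) : ℤ) by push_cast; ring]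
      rw [← unram_natCast_pow_mul, pow_one]
    · rw [show (j - u + (((2 * u + 1 : ℕ) : ℤ) + -(j + u + 1))) = 0 by push_cast; ring]; simp
  · rw [max_eq_left hlt.le] at hDmax
    have ha : α.norm ≠ 0 := by
      intro ha
      rw [ha, norm_zero] at hlt
      exact absurd hlt (not_lt.2 (by positivity))
    have hapos : 0 < ‖α.norm‖ := norm_pos_iff.2 ha
    obtain ⟨k, hk⟩ := exists_unramNorm_eq hε ha
    have hB : ‖β.norm‖ ≤ ((p : ℝ) ^ (-u : ℤ)) ^ 2 * ‖α.norm‖ := by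
      rw [hDmax] at key
      refine le_of_mul_le_mul_left (key.trans_eq ?_) hapos
      ring
    have hα' : ‖QuadraticAlgebra.norm ((p : ℚ_[p]) ^ (-k) • α)‖ = 1 := by
      rw [unramNorm_smul, norm_mul, hk, norm_pow, Padic.norm_p_zpow,
        ← mul_pow, ← zpow_add₀ hpp.ne']
      simp
    have hβ' : ‖QuadraticAlgebra.norm ((p : ℚ_[p]) ^ (-(k + u)) • β)‖ ≤ 1 := by
      rw [unramNorm_smul, norm_mul, norm_pow, Padic.norm_p_zpow]
      refine (mul_le_mul_of_nonneg_left hB (by positivity)).trans_eq ?_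
      rw [hk, ← mul_pow, ← mul_pow, ← zpow_add₀ hpp.ne', ← zpow_add₀ hpp.ne']
      rw [show - -(k + u) + (-(u : ℤ) + -k) = 0 by ring]; simp
    refine ⟨k, ramMk p ε u _ _, ramMk_mem ((mem_unramInt_iff hε _).2 hα'.le)
      ((mem_unramInt_iff hε _).2 hβ'), hasUnitDet_ramMk u hα' hβ', Or.inl ?_⟩
    ext1 i j'
    fin_cases i <;> fin_cases j' <;>
      simp only [ramMk, unram_natCast_pow_mul, unram_star_smul, Matrix.of_apply,
        Matrix.cons_val', Matrix.cons_val_zero, Matrix.cons_val_one, Matrix.smul_apply,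
        Matrix.cons_val_fin_one, Fin.zero_eta, Fin.mk_one, smul_smul, ← zpow_add₀ hp0]
    · simp
    · rw [show (k + ((u : ℤ) + -(k + u))) = 0 by ring]; simp
    · rw [show (k + (((u + 1 : ℕ) : ℤ) + -(k + u))) = ((1 : ℕ) : ℤ) by push_cast; ring]
      rw [← unram_natCast_pow_mul, pow_one]
    · simp

/-- The corner criterion rests on `det = N(α) - p^(2u+1) N(β)`: if `p^(2u+1)` divides `α`, then
`N(α)` is negligible, and the determinant has valuation `2u + 1` exactly if `N(β)` is a unit. -/
lemma ramifiedModel (hε : IsUnramifiedParam p ε) (u : ℕ) :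
    LocalModel p (stdRamified p ε u)
      {M | ∃ α β : UnramExt p ε, M = !![α, β; (p : UnramExt p ε) * star β, star α]} (2 * u + 1)
      (fun M => ∃ y ∈ unramInt p ε, M 0 0 = (p : UnramExt p ε) ^ (2 * u + 1) * y)
      (ramMk p ε u 0 1) := by
  have hp0 : (p : ℚ_[p]) ≠ 0 := padic_prime_ne_zero
  have hpp : (0 : ℝ) < p := prime_cast_pos
  have hz0 : (0 : UnramExt p ε) ∈ unramInt p ε := (mem_unramInt_iff hε _).2 (by simp)
  have hz1 : (1 : UnramExt p ε) ∈ unramInt p ε := (mem_unramInt_iff hε _).2 (by simp)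
  have hinj : Function.Injective (algebraMap ℚ_[p] (UnramExt p ε)) :=
    QuadraticAlgebra.algebraMap_injective
  have hdet1 : ∀ α ∈ unramInt p ε, ∀ β ∈ unramInt p ε,
      ‖α.norm - (p : ℚ_[p]) ^ (2 * u + 1) * β.norm‖ ≤ 1 := by
    intro α hα β hβ
    rw [mem_unramInt_iff hε] at hα hβ
    refine (norm_sub_le_max' _ _).trans (max_le hα ?_)
    rw [norm_mul]
    exact mul_le_one₀ (norm_prime_pow_lt (by omega)).le (norm_nonneg _) hβ
  refine ⟨ramMk_mem hz0 hz1, ?_, ?_, ?_, ?_, ?_, ?_, ?_, ?_⟩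
  · rw [ramMk_swap_mul]
    ext1 i j
    fin_cases i <;> fin_cases j <;> simp [ramMk, Matrix.algebraMap_matrix_apply]
  · rintro z ⟨α, hα, β, hβ, rfl⟩
    refine ⟨_, ramMk_mem (star_mem_unramInt hε hα) (star_mem_unramInt hε hβ), ?_⟩
    ext1 i j
    fin_cases i <;> fin_cases j <;> simp [ramMk] <;> ring
  · rintro z ⟨α, hα, β, hβ, rfl⟩
    exact ⟨_, det_ramMk u α β, hdet1 α hα β hβ⟩
  · rintro z ⟨α, hα, β, hβ, rfl⟩
    exact ⟨_, trace_ramMk u α β, unramTrace_norm_le hα⟩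
  · rintro z ⟨α, hα, β, hβ, rfl⟩
    have hβ' : -β ∈ unramInt p ε := by
      rw [mem_unramInt_iff hε] at hβ ⊢
      rwa [QuadraticAlgebra.norm_neg]
    convert ramMk_mem (u := u) (star_mem_unramInt hε hα) hβ' using 1
    rw [Matrix.adjugate_fin_two_of, ramMk]
    simp
  · rintro M ⟨α, β, rfl⟩ D hD hdet hM
    refine ramified_classify hε u α β D hD (hinj ?_) hM
    rw [← hdet, Matrix.det_fin_two_of, map_sub, map_mul,
      QuadraticAlgebra.algebraMap_norm_eq_mul_star, QuadraticAlgebra.algebraMap_norm_eq_mul_star,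
      map_natCast]
    ring
  -- The determinant of `w` has odd valuation, that of a scalar times a unit has even valuation.
  · rintro - k z hz ⟨d, hd, hd1⟩ h
    have h1 := congr_arg Matrix.det h
    rw [det_ramMk, det_fin_two_smul, hd, ← map_mul] at h1
    have h2 := congr_arg norm (hinj h1)
    rw [QuadraticAlgebra.norm_zero, QuadraticAlgebra.norm_one, mul_one, zero_sub, norm_neg, norm_mul, hd1, mul_one, norm_pow, norm_pow,
      Padic.norm_p_zpow, Padic.norm_p, ← zpow_natCast, ← zpow_natCast,
      ← zpow_mul, ← zpow_neg_one, ← zpow_mul] at h2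
    have := zpow_right_injective₀ hpp one_lt_prime_cast.ne' h2
    push_cast at this
    omega
  · rintro - z ⟨α, hα, β, hβ, rfl⟩ d t hd ht
    change (ramMk p ε u α β).det = _ at hd
    change (ramMk p ε u α β).trace = _ at ht
    rw [det_ramMk] at hd
    rw [trace_ramMk] at ht
    replace hd := hinj hd
    replace ht := hinj ht
    subst hd ht
    have hnp : ‖(p : ℚ_[p]) ^ (2 * u + 1)‖ = (p : ℝ) ^ (-(2 * u + 1 : ℕ) : ℤ) :=
      Padic.norm_p_pow _
    set ρ : ℝ := (p : ℝ) ^ (-(2 * u + 1 : ℕ) : ℤ) with hρ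
    have hρ0 : 0 < ρ := by positivity
    have hρ1 : ρ < 1 := hnp ▸ norm_prime_pow_lt (by omega)
    have hnsm : ∀ y : UnramExt p ε, ((p : UnramExt p ε) ^ (2 * u + 1) * y).norm =
        ((p : ℚ_[p]) ^ (2 * u + 1)) ^ 2 * y.norm := by
      intro y
      rw [unram_natCast_pow_mul, unramNorm_smul, zpow_natCast]
    have hsmall : ∀ y ∈ unramInt p ε, ‖((p : ℚ_[p]) ^ (2 * u + 1)) ^ 2 * y.norm‖ < ρ := by
      intro y hy
      rw [mem_unramInt_iff hε] at hy
      rw [norm_mul, norm_pow, hnp]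
      calc ρ ^ 2 * ‖y.norm‖ ≤ ρ ^ 2 := mul_le_of_le_one_right (by positivity) hy
        _ < ρ := by nlinarith
    constructor
    -- The condition on the trace is not needed here: the lower right entry is the conjugate of the
    -- corner.
    · rintro ⟨hd, -, y, hy, h⟩
      change α = _ at h
      subst h
      rw [hnsm] at hd
      have hβ1 : ‖β.norm‖ = 1 := by
        have h3 := norm_eq_of_lt_norm_sub ((hsmall y hy).trans_eq hd.symm)
        rw [hd, norm_mul, hnp] at h3
        exact mul_left_cancel₀ hρ0.ne' (h3.trans (mul_one _).symm)
      refine ⟨ramMk p ε u (star β) (star y), ramMk_mem (star_mem_unramInt hε hβ)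
        (star_mem_unramInt hε hy), hasUnitDet_ramMk u (by rwa [QuadraticAlgebra.norm_star]) ?_, ?_⟩
      · rw [QuadraticAlgebra.norm_star]; exact (mem_unramInt_iff hε _).1 hy
      · rw [ramMk_swap_mul, star_star, star_star]; rfl
    · rintro ⟨_, ⟨x, hx, y, hy, rfl⟩, ⟨d, hd, hd1⟩, h⟩
      change _ = ramMk p ε u 0 1 * ramMk p ε u x y at h
      change (ramMk p ε u x y).det = _ at hd
      rw [ramMk_swap_mul] at h
      have h00 : α = (p : UnramExt p ε) ^ (2 * u + 1) * star y := congr_fun₂ h 0 0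
      have hdet := congr_arg Matrix.det h
      have hdet' : (ramMk p ε u α β).det = _ := hdet
      rw [← ramMk_swap_mul, Matrix.det_mul, hd, det_ramMk, det_ramMk, ← map_mul] at hdet'
      have hy' := star_mem_unramInt hε hy
      refine ⟨?_, ?_, star y, hy', h00⟩
      · rw [hinj hdet', norm_mul, hd1, mul_one, QuadraticAlgebra.norm_zero, QuadraticAlgebra.norm_one, mul_one, zero_sub, norm_neg, hnp]
      · rw [h00, unram_natCast_pow_mul, QuadraticAlgebra.re_smul, zpow_natCast, smul_eq_mul,
          mul_left_comm, norm_mul, hnp]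
        exact mul_le_of_le_one_right hρ0.le (unramTrace_norm_le hy')

end Ramified

variable {a b : ℚ}

/-! ### The completions of `Q` and the localizations of lattices -/

section Basic

variable {p : ℕ} [hp : Fact p.Prime]

lemma toCompl_mul (x y : ℍ[ℚ,a,b]) : toCompl p (x * y) = toCompl p x * toCompl p y := by
  simp [toCompl]

lemma toCompl_one : toCompl p (1 : ℍ[ℚ,a,b]) = 1 := rfl

lemma toCompl_add (x y : ℍ[ℚ,a,b]) : toCompl p (x + y) = toCompl p x + toCompl p y :=
  TensorProduct.tmul_add _ _ _

lemma toCompl_smul (q : ℚ) (x : ℍ[ℚ,a,b]) :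
    toCompl p (q • x) = (q : ℚ_[p]) • toCompl p x := by
  rw [toCompl, toCompl, ← TensorProduct.smul_tmul, TensorProduct.smul_tmul', Algebra.smul_def]
  simp

/-- The embedding `Q^× → Q_p^×`. -/
def toComplUnits (p : ℕ) [Fact p.Prime] : (ℍ[ℚ,a,b])ˣ →* (Compl p a b)ˣ :=
  Units.map (Algebra.TensorProduct.includeRight : ℍ[ℚ,a,b] →ₐ[ℚ] Compl p a b).toMonoidHom

@[simp] lemma coe_toComplUnits (x : (ℍ[ℚ,a,b])ˣ) :
    (toComplUnits p x : Compl p a b) = toCompl p x := rfl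

lemma toCompl_mem_localize {I : AddSubgroup ℍ[ℚ,a,b]} {x : ℍ[ℚ,a,b]} (hx : x ∈ I) :
    toCompl p x ∈ localize p I := Submodule.subset_span ⟨x, hx, rfl⟩

lemma one_mem_localize (O : Subring ℍ[ℚ,a,b]) : (1 : Compl p a b) ∈ localize p O.toAddSubgroup := by
  rw [← toCompl_one]
  exact toCompl_mem_localize O.one_mem

lemma mul_mem_localize {O : Subring ℍ[ℚ,a,b]} {y z : Compl p a b}
    (hy : y ∈ localize p O.toAddSubgroup) (hz : z ∈ localize p O.toAddSubgroup) :
    y * z ∈ localize p O.toAddSubgroup := by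
  have h : localize p O.toAddSubgroup * localize p O.toAddSubgroup ≤ localize p O.toAddSubgroup := by
    rw [localize, Submodule.span_mul_span]
    refine Submodule.span_mono ?_
    rintro _ ⟨_, ⟨x, hx, rfl⟩, _, ⟨y, hy, rfl⟩, rfl⟩
    exact ⟨x * y, O.mul_mem hx hy, toCompl_mul x y⟩
  exact h (Submodule.mul_mem_mul hy hz)

lemma smul_mem_localize {I : AddSubgroup ℍ[ℚ,a,b]} {y : Compl p a b} {c : ℚ_[p]} (hc : ‖c‖ ≤ 1)
    (hy : y ∈ localize p I) : c • y ∈ localize p I := by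
  obtain ⟨c', rfl⟩ : ∃ c' : ℤ_[p], algebraMap ℤ_[p] ℚ_[p] c' = c := ⟨⟨c, hc⟩, rfl⟩
  rw [algebraMap_smul]
  exact Submodule.smul_mem _ _ hy

lemma span_toCompl_eq_top {S : Set ℍ[ℚ,a,b]} (hS : Submodule.span ℚ S = ⊤) :
    Submodule.span ℚ_[p] (toCompl p '' S) = ⊤ := by
  rw [eq_top_iff]
  rintro y -
  induction y using TensorProduct.induction_on with
  | zero => exact zero_mem _
  | add y z hy hz => exact add_mem hy hz
  | tmul c x =>
    have hx : x ∈ Submodule.span ℚ S := hS ▸ Submodule.mem_top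
    have : c ⊗ₜ[ℚ] x = c • toCompl p x := by
      rw [toCompl, TensorProduct.smul_tmul', smul_eq_mul, mul_one]
    rw [this]
    refine Submodule.smul_mem _ _ ?_
    induction hx using Submodule.span_induction with
    | mem x hx => exact Submodule.subset_span ⟨x, hx, rfl⟩
    | zero => simp [toCompl]
    | add x y _ _ hx hy =>
      rw [toCompl_add]
      exact add_mem (hx (by simp [toCompl, TensorProduct.smul_tmul'])) (hy (by simp [toCompl, TensorProduct.smul_tmul']))
    | smul q x _ hx =>
      rw [toCompl_smul]
      exact Submodule.smul_mem _ _ (hx (by simp [toCompl, TensorProduct.smul_tmul']))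

lemma norm_ratCast_eq_iff {q : ℚ} (hq : q ≠ 0) (n : ℤ) :
    ‖(q : ℚ_[p])‖ = (p : ℝ) ^ (-n) ↔ padicValRat p q = n := by
  rw [Padic.norm_eq_zpow_neg_valuation (by exact_mod_cast hq), Padic.valuation_ratCast]
  constructor
  · intro h
    have := zpow_right_injective₀ prime_cast_pos one_lt_prime_cast.ne' h
    omega
  · rintro rfl; rfl

end Basic

/-! ### Reduced norm and trace as determinant and trace -/

section Reduced

lemma nrd_eq (x : ℍ[ℚ,a,b]) :
    nrd x = x.re ^ 2 - a * x.imI ^ 2 - b * x.imJ ^ 2 + a * b * x.imK ^ 2 := by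
  simp [nrd]; ring

lemma nrd_mul (x y : ℍ[ℚ,a,b]) : nrd (x * y) = nrd x * nrd y := by
  simp [nrd_eq]; ring

lemma nrd_one : nrd (1 : ℍ[ℚ,a,b]) = 1 := by simp [nrd_eq]

lemma mul_star_eq_nrd (x : ℍ[ℚ,a,b]) : x * star x = algebraMap ℚ _ (nrd x) := by
  ext <;> simp [nrd_eq, QuaternionAlgebra.algebraMap_eq] <;> ring

lemma star_mul_eq_nrd (x : ℍ[ℚ,a,b]) : star x * x = algebraMap ℚ _ (nrd x) := by
  ext <;> simp [nrd_eq, QuaternionAlgebra.algebraMap_eq] <;> ring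

variable {p : ℕ} [hp : Fact p.Prime] {L : Type*} [CommRing L] [Algebra ℚ_[p] L]
  (f : Compl p a b →ₐ[ℚ_[p]] Matrix (Fin 2) (Fin 2) L)

lemma trace_toCompl_comm (x y : ℍ[ℚ,a,b]) :
    (f (toCompl p (x * y))).trace = (f (toCompl p (y * x))).trace := by
  rw [toCompl_mul, toCompl_mul, map_mul, map_mul, Matrix.trace_mul_comm]

lemma trace_toCompl_smul (q : ℚ) (x : ℍ[ℚ,a,b]) :
    (f (toCompl p (q • x))).trace = (q : ℚ_[p]) • (f (toCompl p x)).trace := by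
  rw [toCompl_smul, map_smul, Matrix.trace_smul]

lemma trace_toCompl_eq_zero_of_comm_eq {q : ℚ} (hq : q ≠ 0) {x y z : ℍ[ℚ,a,b]}
    (h1 : x * y = q • z) (h2 : y * x = (-q) • z) : (f (toCompl p z)).trace = 0 := by
  have h := trace_toCompl_comm f x y
  rw [h1, h2, trace_toCompl_smul, trace_toCompl_smul, ← sub_eq_zero, ← sub_smul] at h
  have hq' : ((q : ℚ_[p]) - ((-q : ℚ) : ℚ_[p])) ≠ 0 := by
    push_cast
    rw [sub_neg_eq_add, ← two_mul]
    exact mul_ne_zero two_ne_zero (by exact_mod_cast hq)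
  rw [← inv_smul_smul₀ hq' (f (toCompl p z)).trace, h, smul_zero]

/-- Any homomorphism to `2 × 2` matrices transports the reduced trace: each of `i`, `j`, `k` is, up
to a nonzero scalar, a product of two anticommuting elements, hence has trace zero. -/
lemma trace_toCompl (ha : a ≠ 0) (hb : b ≠ 0) (x : ℍ[ℚ,a,b]) :
    (f (toCompl p x)).trace = algebraMap ℚ_[p] L ((2 * x.re : ℚ) : ℚ_[p]) := by
  have hi : (f (toCompl p (⟨0, 1, 0, 0⟩ : ℍ[ℚ,a,b]))).trace = 0 :=
    trace_toCompl_eq_zero_of_comm_eq f hb (x := ⟨0, 0, 0, 1⟩) (y := ⟨0, 0, 1, 0⟩)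
      (by ext <;> simp) (by ext <;> simp)
  have hj : (f (toCompl p (⟨0, 0, 1, 0⟩ : ℍ[ℚ,a,b]))).trace = 0 :=
    trace_toCompl_eq_zero_of_comm_eq f ha (x := ⟨0, 1, 0, 0⟩) (y := ⟨0, 0, 0, 1⟩)
      (by ext <;> simp) (by ext <;> simp)
  have hk : (f (toCompl p (⟨0, 0, 0, 1⟩ : ℍ[ℚ,a,b]))).trace = 0 :=
    trace_toCompl_eq_zero_of_comm_eq f one_ne_zero (x := ⟨0, 1, 0, 0⟩) (y := ⟨0, 0, 1, 0⟩)
      (by ext <;> simp) (by ext <;> simp)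
  have hx : x = x.re • (1 : ℍ[ℚ,a,b]) + x.imI • (⟨0, 1, 0, 0⟩ : ℍ[ℚ,a,b]) +
      x.imJ • (⟨0, 0, 1, 0⟩ : ℍ[ℚ,a,b]) + x.imK • (⟨0, 0, 0, 1⟩ : ℍ[ℚ,a,b]) := by
    ext <;> simp
  conv_lhs => rw [hx]
  rw [toCompl_add, toCompl_add, toCompl_add, map_add, map_add, map_add, Matrix.trace_add,
    Matrix.trace_add, Matrix.trace_add, trace_toCompl_smul, trace_toCompl_smul,
    trace_toCompl_smul, trace_toCompl_smul, hi, hj, hk, toCompl_one, map_one, Matrix.trace_one]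
  simp [Algebra.smul_def, map_ofNat]
  ring

/-- In size two, `2 det = tr(x)² - tr(x²)`, so the determinant follows from the trace. -/
lemma det_toCompl (ha : a ≠ 0) (hb : b ≠ 0) (x : ℍ[ℚ,a,b]) :
    (f (toCompl p x)).det = algebraMap ℚ_[p] L (nrd x : ℚ_[p]) := by
  have h1 : (2 : ℚ_[p]) • (f (toCompl p x)).det =
      (f (toCompl p x)).trace ^ 2 - (f (toCompl p (x * x))).trace := by
    rw [toCompl_mul, map_mul, Matrix.det_fin_two, Matrix.trace_fin_two, Matrix.trace_fin_two,
      Matrix.mul_apply, Matrix.mul_apply, Fin.sum_univ_two, Fin.sum_univ_two, Algebra.smul_def,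
      map_ofNat]
    ring
  rw [trace_toCompl f ha hb, trace_toCompl f ha hb, ← map_pow, ← map_sub] at h1
  have h2 : (((2 * x.re : ℚ) : ℚ_[p]) ^ 2 - ((2 * (x * x).re : ℚ) : ℚ_[p])) = 2 * (nrd x : ℚ_[p]) := by
    rw [nrd_eq]
    simp
    ring
  rw [h2, map_mul, ← Algebra.smul_def] at h1
  rw [← inv_smul_smul₀ (two_ne_zero (α := ℚ_[p])) (f (toCompl p x)).det, h1, inv_smul_smul₀ two_ne_zero]

end Reduced

/-! ### Units and normalizer of `O_p`, transported from the matrix models -/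

/-- Units of the local order `Λ`. -/
def IsLocalUnit {p : ℕ} [Fact p.Prime] (Λ : Submodule ℤ_[p] (Compl p a b)) (u : (Compl p a b)ˣ) :
    Prop :=
  (u : Compl p a b) ∈ Λ ∧ ((u⁻¹ : (Compl p a b)ˣ) : Compl p a b) ∈ Λ

/-- `y Λ y⁻¹ = Λ`. -/
def Normalizes {p : ℕ} [Fact p.Prime] (Λ : Submodule ℤ_[p] (Compl p a b)) (y : (Compl p a b)ˣ) :
    Prop :=
  ∀ z : Compl p a b, (y : Compl p a b) * z * ((y⁻¹ : (Compl p a b)ˣ) : Compl p a b) ∈ Λ ↔ z ∈ Λ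

/-- `w` generates the normalizer of `O_p` modulo scalars and units, with `w² = p^v`; the generators
of `O_p` and of `w O_p` that lie in `Q` are described by norm, trace and `corner`. -/
structure IsLocalNormalizer (O : Subring ℍ[ℚ,a,b]) (p : ℕ) [Fact p.Prime] (v : ℕ)
    (corner : ℍ[ℚ,a,b] → Prop) (w : (Compl p a b)ˣ) : Prop where
  normalizes : Normalizes (localize p O.toAddSubgroup) w
  mem : (w : Compl p a b) ∈ localize p O.toAddSubgroup
  sq : (w : Compl p a b) * w = algebraMap ℚ_[p] _ ((p : ℚ_[p]) ^ v)
  classify : ∀ y, Normalizes (localize p O.toAddSubgroup) y → ∃ k : ℤ, ∃ u,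
    IsLocalUnit (localize p O.toAddSubgroup) u ∧
      ((y : Compl p a b) = (p : ℚ_[p]) ^ k • (u : Compl p a b) ∨
        (y : Compl p a b) = (p : ℚ_[p]) ^ k • ((w * u : (Compl p a b)ˣ) : Compl p a b))
  not_unit : 0 < v → ∀ k : ℤ, ∀ u, IsLocalUnit (localize p O.toAddSubgroup) u →
    (w : Compl p a b) ≠ (p : ℚ_[p]) ^ k • (u : Compl p a b)
  norm_le : ∀ x, toCompl p x ∈ localize p O.toAddSubgroup →
    ‖(nrd x : ℚ_[p])‖ ≤ 1 ∧ ‖((2 * x.re : ℚ) : ℚ_[p])‖ ≤ 1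
  isLocalUnit_iff : ∀ x : (ℍ[ℚ,a,b])ˣ, toCompl p (x : ℍ[ℚ,a,b]) ∈ localize p O.toAddSubgroup →
    (IsLocalUnit (localize p O.toAddSubgroup) (toComplUnits p x) ↔
      ‖(nrd (x : ℍ[ℚ,a,b]) : ℚ_[p])‖ = 1)
  corner_iff : 0 < v → ∀ x : (ℍ[ℚ,a,b])ˣ,
    toCompl p (x : ℍ[ℚ,a,b]) ∈ localize p O.toAddSubgroup →
    ((‖(nrd (x : ℍ[ℚ,a,b]) : ℚ_[p])‖ = (p : ℝ) ^ (-v : ℤ) ∧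
        ‖((2 * (x : ℍ[ℚ,a,b]).re : ℚ) : ℚ_[p])‖ ≤ (p : ℝ) ^ (-v : ℤ) ∧ corner x) ↔
      ∃ u, IsLocalUnit (localize p O.toAddSubgroup) u ∧ toComplUnits p x = w * u)

section Transport

variable {p : ℕ} [hp : Fact p.Prime] {L : Type*} [CommRing L] [Algebra ℚ_[p] L]

lemma LocalModel.exists_isLocalNormalizer [Nontrivial L] (ha : a ≠ 0) (hb : b ≠ 0)
    {O : Subring ℍ[ℚ,a,b]} {Γ B : Set (Matrix (Fin 2) (Fin 2) L)} {v : ℕ}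
    {corner : Matrix (Fin 2) (Fin 2) L → Prop} {w₀ : Matrix (Fin 2) (Fin 2) L}
    (hmod : LocalModel p Γ B v corner w₀)
    (f : Compl p a b →ₐ[ℚ_[p]] Matrix (Fin 2) (Fin 2) L) (hf : Function.Injective f)
    (himage : f '' (localize p O.toAddSubgroup : Set (Compl p a b)) = Γ)
    (hB : ∀ y, f y ∈ B ∧ ∃ D : ℚ_[p], (f y).det = algebraMap ℚ_[p] L D) :
    ∃ w, IsLocalNormalizer O p v (fun x => corner (f (toCompl p x))) w := by
  have hp0 : (p : ℚ_[p]) ≠ 0 := padic_prime_ne_zero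
  have hinj : Function.Injective (algebraMap ℚ_[p] L) := (algebraMap ℚ_[p] L).injective
  set Λ := localize p O.toAddSubgroup with hΛ
  have mem_iff : ∀ z, z ∈ Λ ↔ f z ∈ Γ := by
    intro z
    rw [← himage]
    exact ⟨fun h => ⟨z, h, rfl⟩, fun ⟨z', h, h'⟩ => hf h' ▸ h⟩
  have exists_pre : ∀ M ∈ Γ, ∃ z ∈ Λ, f z = M := by
    intro M hM; rw [← himage] at hM; exact hM
  have unit_det : ∀ u, IsLocalUnit Λ u → HasUnitDet p (f u) := by
    rintro u ⟨h1, h2⟩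
    obtain ⟨d, hd, hd1⟩ := hmod.det_mem _ ((mem_iff _).1 h1)
    obtain ⟨d', hd', hd1'⟩ := hmod.det_mem _ ((mem_iff _).1 h2)
    refine ⟨d, hd, le_antisymm hd1 ?_⟩
    have h3 : d * d' = 1 := by
      apply hinj
      rw [map_mul, ← hd, ← hd', ← Matrix.det_mul, ← map_mul, Units.mul_inv, map_one, Matrix.det_one,
        map_one]
    have h4 : ‖d‖ * ‖d'‖ = 1 := by rw [← norm_mul, h3, norm_one]
    nlinarith [norm_nonneg d, norm_nonneg d']
  -- The inverse is the adjugate divided by the unit determinant, and the order is closed under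
  -- adjugates.
  have det_unit : ∀ z ∈ Γ, HasUnitDet p z → ∃ u, IsLocalUnit Λ u ∧ f u = z := by
    rintro z hz ⟨d, hd, hd1⟩
    obtain ⟨y, hy, rfl⟩ := exists_pre z hz
    obtain ⟨y', hy', hyy⟩ := exists_pre _ (hmod.adjugate_mem _ hz)
    have hd0 : d ≠ 0 := by rintro rfl; simp at hd1
    have e1 : y * y' = algebraMap ℚ_[p] _ d := by
      apply hf
      rw [map_mul, hyy, Matrix.mul_adjugate, hd, AlgHom.commutes, algebraMap_smul,
        Algebra.algebraMap_eq_smul_one]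
    have e2 : y' * y = algebraMap ℚ_[p] _ d := by
      apply hf
      rw [map_mul, hyy, Matrix.adjugate_mul, hd, AlgHom.commutes, algebraMap_smul,
        Algebra.algebraMap_eq_smul_one]
    refine ⟨⟨y, d⁻¹ • y', ?_, ?_⟩, ⟨hy, ?_⟩, rfl⟩
    · rw [mul_smul_comm, e1, Algebra.algebraMap_eq_smul_one, inv_smul_smul₀ hd0]
    · rw [smul_mul_assoc, e2, Algebra.algebraMap_eq_smul_one, inv_smul_smul₀ hd0]
    · exact smul_mem_localize (by rw [norm_inv, hd1, inv_one]) hy'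
  obtain ⟨W, hW, rfl⟩ := exists_pre w₀ hmod.mem
  have hpv : (p : ℚ_[p]) ^ v ≠ 0 := pow_ne_zero _ hp0
  have hWW : W * W = algebraMap ℚ_[p] _ ((p : ℚ_[p]) ^ v) := by
    apply hf; rw [map_mul, hmod.sq, AlgHom.commutes]
  let w : (Compl p a b)ˣ := ⟨W, ((p : ℚ_[p]) ^ v)⁻¹ • W,
    by rw [mul_smul_comm, hWW, Algebra.algebraMap_eq_smul_one, inv_smul_smul₀ hpv],
    by rw [smul_mul_assoc, hWW, Algebra.algebraMap_eq_smul_one, inv_smul_smul₀ hpv]⟩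
  have hwinv : ((w⁻¹ : (Compl p a b)ˣ) : Compl p a b) = ((p : ℚ_[p]) ^ v)⁻¹ • W := rfl
  have conj : ∀ z ∈ Λ, (w : Compl p a b) * z * ((w⁻¹ : (Compl p a b)ˣ) : Compl p a b) ∈ Λ := by
    intro z hz
    obtain ⟨z', hz', h⟩ := hmod.swap _ ((mem_iff _).1 hz)
    obtain ⟨y, hy, rfl⟩ := exists_pre _ hz'
    rw [← map_mul, ← map_mul] at h
    have h' : (w : Compl p a b) * z = y * w := hf h
    rw [h', Units.mul_inv_cancel_right]
    exact hy
  refine ⟨w, ?_, hW, hWW, ?_, ?_, ?_, ?_, ?_⟩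
  · intro z
    refine ⟨fun h => ?_, conj z⟩
    -- Since `w²` is a scalar, conjugating twice by `w` is the identity; so one inclusion gives
    -- both.
    have h2 := conj _ h
    have : (w : Compl p a b) * (w * z * ((w⁻¹ : (Compl p a b)ˣ) : Compl p a b)) *
        ((w⁻¹ : (Compl p a b)ˣ) : Compl p a b) = z := by
      rw [hwinv]
      change W * (W * z * _) * _ = z
      rw [mul_smul_comm, mul_smul_comm, mul_smul_comm, smul_mul_assoc, smul_smul,
        show W * (W * z * W) * W = (W * W) * z * (W * W) by simp only [mul_assoc], hWW,
        mul_assoc, ← Algebra.commutes, ← Algebra.smul_def, ← Algebra.smul_def, smul_smul, smul_smul]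
      field_simp
      simp
    rwa [this] at h2
  · intro y hy
    obtain ⟨hyB, D, hD⟩ := hB y
    have hD0 : D ≠ 0 := by
      rintro rfl
      have h1 : f y * f ((y⁻¹ : (Compl p a b)ˣ) : Compl p a b) = 1 := by
        rw [← map_mul, Units.mul_inv, map_one]
      have h2 := congr_arg Matrix.det h1
      rw [Matrix.det_mul, hD, map_zero, zero_mul, Matrix.det_one] at h2
      exact zero_ne_one h2
    obtain ⟨k, z, hz, hzu, h⟩ := hmod.classify _ hyB D hD0 hD (by
      intro z hz
      obtain ⟨x, hx, rfl⟩ := exists_pre z hz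
      refine ⟨_, (mem_iff _).1 ((hy x).2 hx), ?_⟩
      rw [← map_mul, ← map_mul, Units.inv_mul_cancel_right])
    obtain ⟨u, hu, rfl⟩ := det_unit z hz hzu
    refine ⟨k, u, hu, h.imp (fun h => hf ?_) (fun h => hf ?_)⟩
    · rw [h, map_smul]
    · rw [h, map_smul, Units.val_mul, map_mul]
  · intro hv k u hu h
    refine hmod.not_unit hv k (f u) ((mem_iff _).1 hu.1) (unit_det u hu) ?_
    rw [← map_smul, ← h]
  · intro x hx
    obtain ⟨d, hd, hd1⟩ := hmod.det_mem _ ((mem_iff _).1 hx)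
    obtain ⟨t, ht, ht1⟩ := hmod.trace_mem _ ((mem_iff _).1 hx)
    rw [det_toCompl f ha hb] at hd
    rw [trace_toCompl f ha hb] at ht
    rw [hinj hd, hinj ht]
    exact ⟨hd1, ht1⟩
  · intro x hx
    constructor
    · intro h
      obtain ⟨d, hd, hd1⟩ := unit_det _ h
      rw [coe_toComplUnits, det_toCompl f ha hb] at hd
      rw [hinj hd, hd1]
    · intro h
      obtain ⟨u, hu, hux⟩ := det_unit _ ((mem_iff _).1 hx) ⟨_, det_toCompl f ha hb _, h⟩
      have : u = toComplUnits p x := Units.ext (hf hux)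
      rwa [← this]
  · intro hv x hx
    rw [hmod.corner_iff hv _ ((mem_iff _).1 hx) _ _ (det_toCompl f ha hb _)
      (trace_toCompl f ha hb _)]
    constructor
    · rintro ⟨z, hz, hzu, h⟩
      obtain ⟨u, hu, rfl⟩ := det_unit z hz hzu
      refine ⟨u, hu, Units.ext (hf ?_)⟩
      rw [coe_toComplUnits, h, Units.val_mul, map_mul]
    · rintro ⟨u, hu, h⟩
      refine ⟨f u, (mem_iff _).1 hu.1, unit_det u hu, ?_⟩
      rw [← map_mul, ← coe_toComplUnits, h]
      rfl

end Transport

/-- The condition on the upper left entry at `p`. -/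
def CornerAt {O : Subring ℍ[ℚ,a,b]} {N₁ N₂ : ℕ} (φ : LevelCoords O N₁ N₂) (p : ℕ) [Fact p.Prime]
    (x : ℍ[ℚ,a,b]) : Prop :=
  (∀ (u : ℕ) (h : N₁.factorization p = 2 * u + 1), ∃ y ∈ unramInt p (φ.ramified p u h).ε,
    (φ.ramified p u h).toHom (toCompl p x) 0 0 =
      (p : UnramExt p (φ.ramified p u h).ε) ^ (2 * u + 1) * y) ∧
  (∀ h : ¬ p ∣ N₁, ∃ y : ℤ_[p],
    (φ.split p h).toHom (toCompl p x) 0 0 = (p : ℚ_[p]) ^ (N₂.factorization p) * y)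

/-- As `N₁` and `N₂` are coprime, exactly one of the two models applies at `p`, with the exponent of
`p` in `N₁ N₂`. -/
lemma exists_isLocalNormalizer (ha : a ≠ 0) (hb : b ≠ 0) {O : Subring ℍ[ℚ,a,b]} {N₁ N₂ : ℕ}
    (hN : IsLevelPair N₁ N₂) (hO : IsOrder O) (φ : LevelCoords O N₁ N₂) (p : ℕ)
    [hp : Fact p.Prime] :
    ∃ w, IsLocalNormalizer O p ((N₁ * N₂).factorization p) (CornerAt φ p) w := by
  by_cases h : p ∣ N₁
  · have hmem : p ∈ N₁.primeFactors := Nat.mem_primeFactors.2 ⟨hp.out, h, hN.ne_zero₁⟩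
    obtain ⟨u, hu⟩ := hN.odd_exponent p hmem
    have h2 : ¬ p ∣ N₂ := fun h' => Nat.Prime.not_coprime_iff_dvd.2 ⟨p, hp.out, h, h'⟩ hN.coprime
    have hfac : (N₁ * N₂).factorization p = 2 * u + 1 := by
      rw [Nat.factorization_mul hN.ne_zero₁ hN.ne_zero₂, Finsupp.add_apply, hu,
        Nat.factorization_eq_zero_of_not_dvd h2, add_zero]
    have hcorner : CornerAt φ p = fun x => ∃ y ∈ unramInt p (φ.ramified p u hu).ε,
        (φ.ramified p u hu).toHom (toCompl p x) 0 0 =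
          (p : UnramExt p (φ.ramified p u hu).ε) ^ (2 * u + 1) * y := by
      funext x
      refine propext ⟨fun H => H.1 u hu, fun H => ⟨fun u' hu' => ?_, fun h' => absurd h h'⟩⟩
      obtain rfl : u = u' := by omega
      exact H
    rw [hfac, hcorner]
    refine (ramifiedModel (φ.ramified p u hu).isUnramifiedParam u).exists_isLocalNormalizer ha hb
      (φ.ramified p u hu).toHom (φ.ramified p u hu).injective (φ.ramified p u hu).image_eq ?_
    -- The coordinates describe only the image of `O_p`; its `ℚ_p`-span is the image of all of
    -- `Q_p`, and the shape of the matrices is stable under `ℚ_p`-linear combinations.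
    have hBmem : ∀ y, ∃ α β, (φ.ramified p u hu).toHom y = !![α, β; (p : UnramExt p _) * star β, star α] := by
      intro y
      have hy : y ∈ Submodule.span ℚ_[p] (toCompl p '' (O : Set ℍ[ℚ,a,b])) := by
        rw [span_toCompl_eq_top (S := (O : Set ℍ[ℚ,a,b])) hO.2]; trivial
      induction hy using Submodule.span_induction with
      | mem x hx =>
        obtain ⟨x, hx, rfl⟩ := hx
        have h1 : (φ.ramified p u hu).toHom (toCompl p x) ∈ stdRamified p (φ.ramified p u hu).ε u := by
          rw [← (φ.ramified p u hu).image_eq]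
          exact ⟨_, toCompl_mem_localize hx, rfl⟩
        obtain ⟨α, -, β, -, h1⟩ := h1
        refine ⟨α, (p : UnramExt p _) ^ u * β, h1.trans ?_⟩
        rw [unram_natCast_pow_mul, unram_star_smul, pow_succ', mul_assoc, unram_natCast_pow_mul]
      | zero => exact ⟨0, 0, by rw [map_zero]; ext1 i j; fin_cases i <;> fin_cases j <;> simp⟩
      | add x y _ _ hx hy =>
        obtain ⟨α, β, h1⟩ := hx
        obtain ⟨α', β', h2⟩ := hy
        refine ⟨α + α', β + β', ?_⟩
        rw [map_add, h1, h2]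
        ext1 i j; fin_cases i <;> fin_cases j <;> simp [mul_add]
      | smul c x _ hx =>
        obtain ⟨α, β, h1⟩ := hx
        refine ⟨c • α, c • β, ?_⟩
        rw [map_smul, h1, unram_star_smul, unram_star_smul]
        ext1 i j; fin_cases i <;> fin_cases j <;> simp
    intro y
    refine ⟨hBmem y, ?_⟩
    obtain ⟨α, β, h1⟩ := hBmem y
    refine ⟨α.norm - p * β.norm, ?_⟩
    rw [h1, Matrix.det_fin_two_of, map_sub, map_mul, QuadraticAlgebra.algebraMap_norm_eq_mul_star,
      QuadraticAlgebra.algebraMap_norm_eq_mul_star, map_natCast]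
    ring
  · have hfac : (N₁ * N₂).factorization p = N₂.factorization p := by
      rw [Nat.factorization_mul hN.ne_zero₁ hN.ne_zero₂, Finsupp.add_apply,
        Nat.factorization_eq_zero_of_not_dvd h, zero_add]
    have hcorner : CornerAt φ p = fun x => ∃ y : ℤ_[p],
        (φ.split p h).toHom (toCompl p x) 0 0 = (p : ℚ_[p]) ^ (N₂.factorization p) * y := by
      funext x
      refine propext ⟨fun H => H.2 h, fun H => ⟨fun u' hu' => ?_, fun h' => H⟩⟩
      rw [Nat.factorization_eq_zero_of_not_dvd h] at hu'
      omega
    rw [hfac, hcorner]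
    exact (splitModel hN.ne_zero₂).exists_isLocalNormalizer ha hb (φ.split p h).toHom
      (φ.split p h).injective (φ.split p h).image_eq fun y => ⟨trivial, _, rfl⟩

/-- This merges the two cases of the corner condition into one condition at the primes where the
norm has the full valuation of `N₁ N₂`. -/
lemma cornerCondition_iff {O : Subring ℍ[ℚ,a,b]} {N₁ N₂ : ℕ} (hN : IsLevelPair N₁ N₂)
    (φ : LevelCoords O N₁ N₂) (x : ℍ[ℚ,a,b]) :
    CornerCondition φ x ↔ ∀ (p : ℕ) [Fact p.Prime], 0 < (N₁ * N₂).factorization p →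
      padicValRat p (nrd x) = (N₁ * N₂).factorization p → CornerAt φ p x := by
  have hfac : ∀ p, (N₁ * N₂).factorization p = N₁.factorization p + N₂.factorization p := by
    intro p
    rw [Nat.factorization_mul hN.ne_zero₁ hN.ne_zero₂, Finsupp.add_apply]
  constructor
  · rintro ⟨h1, h2⟩ p hp hpos hval
    refine ⟨fun u hu => h1 p u hu ?_, fun h => h2 p h _ ?_ rfl ?_⟩
    · have hd : p ∣ N₁ := Nat.dvd_of_factorization_pos (by omega)
      have h2 : ¬ p ∣ N₂ := fun h' => Nat.Prime.not_coprime_iff_dvd.2 ⟨p, hp.out, hd, h'⟩ hN.coprime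
      rw [hval, hfac, Nat.factorization_eq_zero_of_not_dvd h2, hu]
      push_cast; ring
    · rw [hfac, Nat.factorization_eq_zero_of_not_dvd h] at hpos
      omega
    · rw [hval, hfac, Nat.factorization_eq_zero_of_not_dvd h, zero_add]
  · intro H
    refine ⟨fun p hp u hu hval => (H p ?_ ?_).1 u hu, fun p hp h v hv hv2 hval => ?_⟩
    · rw [hfac]; omega
    · have hd : p ∣ N₁ := Nat.dvd_of_factorization_pos (by omega)
      have h2 : ¬ p ∣ N₂ := fun h' => Nat.Prime.not_coprime_iff_dvd.2 ⟨p, hp.out, hd, h'⟩ hN.coprime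
      rw [hval, hfac, Nat.factorization_eq_zero_of_not_dvd h2, hu]
      push_cast; ring
    · subst hv2
      refine (H p ?_ ?_).2 h
      · rw [hfac]; omega
      · rw [hval, hfac, Nat.factorization_eq_zero_of_not_dvd h, zero_add]

/-! ### Lattices and their localizations -/

section Lattice

lemma rat_isInt_of_forall_norm_le {q : ℚ} (h : ∀ (p : ℕ) [Fact p.Prime], ‖(q : ℚ_[p])‖ ≤ 1) :
    ∃ z : ℤ, (z : ℚ) = q := by
  refine ⟨q.num, Rat.coe_int_num_of_den_eq_one ?_⟩
  by_contra hd
  obtain ⟨p, hp, hpd⟩ := Nat.exists_prime_and_dvd hd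
  have : Fact p.Prime := ⟨hp⟩
  have h1 := PadicInt.isUnit_den q (h p)
  rw [PadicInt.isUnit_iff, PadicInt.norm_natCast_eq_one_iff, Nat.Prime.coprime_iff_not_dvd hp] at h1
  exact h1 hpd

/-- With a basis that generates the lattice over `ℤ`, membership in the lattice and in its
localizations becomes integrality of coordinates. -/
lemma IsFullLattice.exists_basis {I : AddSubgroup ℍ[ℚ,a,b]} (hI : IsFullLattice I) :
    ∃ (n : ℕ) (B : Module.Basis (Fin n) ℚ ℍ[ℚ,a,b]),
      AddSubgroup.toIntSubmodule I = Submodule.span ℤ (Set.range B) := by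
  have : IsAddTorsionFree ℍ[ℚ,a,b] := IsAddTorsionFree.of_module_rat _
  have : Module.Finite ℤ (AddSubgroup.toIntSubmodule I) := by
    rw [Module.Finite.iff_addGroup_fg]
    exact (AddGroup.fg_iff_addSubgroup_fg I).2 hI.1
  let c := Module.finBasis ℤ (AddSubgroup.toIntSubmodule I)
  have hli : LinearIndependent ℤ (fun i => (c i : ℍ[ℚ,a,b])) :=
    c.linearIndependent.map' (AddSubgroup.toIntSubmodule I).subtype (Submodule.ker_subtype _)
  have hspan : Submodule.span ℤ (Set.range fun i => (c i : ℍ[ℚ,a,b])) =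
      AddSubgroup.toIntSubmodule I := by
    have := congr_arg (Submodule.map (AddSubgroup.toIntSubmodule I).subtype) c.span_eq
    rw [Submodule.map_span, Submodule.map_top, Submodule.range_subtype, ← Set.range_comp] at this
    exact this
  have hQ : ⊤ ≤ Submodule.span ℚ (Set.range fun i => (c i : ℍ[ℚ,a,b])) := by
    rw [← hI.2, Submodule.span_le]
    intro x hx
    have hx' : x ∈ Submodule.span ℤ (Set.range fun i => (c i : ℍ[ℚ,a,b])) := by rw [hspan]; exact hx
    exact Submodule.span_le_restrictScalars ℤ ℚ _ hx'
  refine ⟨_, Module.Basis.mk (hli.localization ℚ (nonZeroDivisors ℤ)) hQ, ?_⟩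
  rw [Module.Basis.coe_mk, hspan]

variable {p : ℕ} [hp : Fact p.Prime]

lemma mem_iff_repr {n : ℕ} {B : Module.Basis (Fin n) ℚ ℍ[ℚ,a,b]} {I : AddSubgroup ℍ[ℚ,a,b]}
    (hB : AddSubgroup.toIntSubmodule I = Submodule.span ℤ (Set.range B)) (x : ℍ[ℚ,a,b]) :
    x ∈ I ↔ ∀ i, ∃ z : ℤ, (z : ℚ) = B.repr x i := by
  have : x ∈ I ↔ x ∈ AddSubgroup.toIntSubmodule I := Iff.rfl
  have htf : IsAddTorsionFree ℍ[ℚ,a,b] := IsAddTorsionFree.of_module_rat _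
  rw [this, hB, B.mem_span_iff_repr_mem ℤ x]
  rfl

lemma mem_localize_iff_repr {n : ℕ} {B : Module.Basis (Fin n) ℚ ℍ[ℚ,a,b]}
    {I : AddSubgroup ℍ[ℚ,a,b]}
    (hB : AddSubgroup.toIntSubmodule I = Submodule.span ℤ (Set.range B)) (y : Compl p a b) :
    y ∈ localize p I ↔ ∀ i, ‖(Algebra.TensorProduct.basis ℚ_[p] B).repr y i‖ ≤ 1 := by
  have hspan : localize p I =
      Submodule.span ℤ_[p] (Set.range (Algebra.TensorProduct.basis ℚ_[p] B)) := by
    apply le_antisymm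
    · rw [localize, Submodule.span_le]
      rintro _ ⟨x, hx, rfl⟩
      rw [SetLike.mem_coe, Module.Basis.mem_span_iff_repr_mem]
      intro i
      obtain ⟨z, hz⟩ := (mem_iff_repr hB x).1 hx i
      refine ⟨z, ?_⟩
      rw [toCompl, Algebra.TensorProduct.basis_repr_tmul, one_smul, Finsupp.mapRange_apply, ← hz]
      simp
    · rw [Submodule.span_le]
      rintro _ ⟨i, rfl⟩
      refine Submodule.subset_span ⟨B i, ?_, by simp [toCompl]⟩
      have : B i ∈ AddSubgroup.toIntSubmodule I := by
        rw [hB]; exact Submodule.subset_span ⟨i, rfl⟩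
      exact this
  rw [hspan, Module.Basis.mem_span_iff_repr_mem]
  refine forall_congr' fun i => ⟨?_, fun h => ⟨⟨_, h⟩, rfl⟩⟩
  rintro ⟨z, hz⟩
  rw [← hz]; exact z.2

lemma toCompl_mem_localize_iff_repr {n : ℕ} {B : Module.Basis (Fin n) ℚ ℍ[ℚ,a,b]}
    {I : AddSubgroup ℍ[ℚ,a,b]}
    (hB : AddSubgroup.toIntSubmodule I = Submodule.span ℤ (Set.range B)) (x : ℍ[ℚ,a,b]) :
    toCompl p x ∈ localize p I ↔ ∀ i, ‖(B.repr x i : ℚ_[p])‖ ≤ 1 := by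
  rw [mem_localize_iff_repr hB]
  refine forall_congr' fun i => ?_
  rw [toCompl, Algebra.TensorProduct.basis_repr_tmul, one_smul, Finsupp.mapRange_apply]
  rfl

/-- A rational coordinate that is `p`-integral for every `p` is an integer. -/
lemma IsFullLattice.mem_iff {I : AddSubgroup ℍ[ℚ,a,b]} (hI : IsFullLattice I) (x : ℍ[ℚ,a,b]) :
    x ∈ I ↔ ∀ (p : ℕ) [Fact p.Prime], toCompl p x ∈ localize p I := by
  refine ⟨fun h p _ => toCompl_mem_localize h, fun h => ?_⟩
  obtain ⟨n, B, hB⟩ := hI.exists_basis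
  rw [mem_iff_repr hB]
  intro i
  exact rat_isInt_of_forall_norm_le fun p _ => (toCompl_mem_localize_iff_repr hB x).1 (h p) i

lemma IsFullLattice.eq_of_localize_eq {I J : AddSubgroup ℍ[ℚ,a,b]} (hI : IsFullLattice I)
    (hJ : IsFullLattice J) (h : ∀ (p : ℕ) [Fact p.Prime], localize p I = localize p J) : I = J := by
  ext x
  rw [hI.mem_iff, hJ.mem_iff]
  refine forall_congr' fun p => forall_congr' fun _ => ?_
  rw [h p]

lemma IsFullLattice.exists_smul_mem {I : AddSubgroup ℍ[ℚ,a,b]} (hI : IsFullLattice I)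
    (x : ℍ[ℚ,a,b]) : ∃ n : ℕ, n ≠ 0 ∧ n • x ∈ I := by
  have hx : x ∈ Submodule.span ℚ (I : Set ℍ[ℚ,a,b]) := hI.2 ▸ Submodule.mem_top
  induction hx using Submodule.span_induction with
  | mem x hx => exact ⟨1, one_ne_zero, by simpa using hx⟩
  | zero => exact ⟨1, one_ne_zero, by simp⟩
  | add x y _ _ hx hy =>
    obtain ⟨n, hn, h1⟩ := hx
    obtain ⟨k, hk, h2⟩ := hy
    refine ⟨n * k, mul_ne_zero hn hk, ?_⟩
    rw [smul_add]
    refine I.add_mem ?_ ?_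
    · rw [mul_comm, mul_smul]; exact I.nsmul_mem h1 k
    · rw [mul_smul]; exact I.nsmul_mem h2 n
  | smul q x _ hx =>
    obtain ⟨n, hn, h1⟩ := hx
    refine ⟨q.den * n, mul_ne_zero q.den_nz hn, ?_⟩
    have : (q.den * n) • q • x = q.num • n • x := by
      have hq : (q.den : ℚ) * q = q.num := by rw [mul_comm]; exact Rat.mul_den_eq_num q
      simp only [← Nat.cast_smul_eq_nsmul ℚ, ← Int.cast_smul_eq_zsmul ℚ, smul_smul]
      rw [← hq]; push_cast; ring_nf
    rw [this]
    exact I.zsmul_mem h1 _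

lemma exists_smul_le_of_forall {I J : AddSubgroup ℍ[ℚ,a,b]} (hI : I.FG)
    (hJ : ∀ x, ∃ n : ℕ, n ≠ 0 ∧ n • x ∈ J) : ∃ n : ℕ, n ≠ 0 ∧ ∀ x ∈ I, n • x ∈ J := by
  classical
  obtain ⟨S, rfl⟩ := hI
  choose f hf0 hf using hJ
  refine ⟨∏ x ∈ S, f x, Finset.prod_ne_zero_iff.2 fun x _ => hf0 x, fun x hx => ?_⟩
  induction hx using AddSubgroup.closure_induction with
  | mem x hx =>
    rw [← Finset.prod_erase_mul S f hx, mul_smul]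
    exact J.nsmul_mem (hf x) _
  | zero => simp
  | add x y _ _ hx hy => rw [smul_add]; exact J.add_mem hx hy
  | neg x _ hx => rw [smul_neg]; exact J.neg_mem hx

lemma IsFullLattice.exists_smul_le {I J : AddSubgroup ℍ[ℚ,a,b]} (hI : I.FG)
    (hJ : IsFullLattice J) : ∃ n : ℕ, n ≠ 0 ∧ ∀ x ∈ I, n • x ∈ J :=
  exists_smul_le_of_forall hI hJ.exists_smul_mem

lemma isFullLattice_of_smul_le {I J : AddSubgroup ℍ[ℚ,a,b]} (hJ : IsFullLattice J) (hIJ : I ≤ J)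
    {n : ℕ} (hn : n ≠ 0) (h : ∀ x ∈ J, n • x ∈ I) : IsFullLattice I := by
  constructor
  · have : Module.Finite ℤ (AddSubgroup.toIntSubmodule J) := by
      rw [Module.Finite.iff_addGroup_fg]
      exact (AddGroup.fg_iff_addSubgroup_fg J).2 hJ.1
    have hfg : (AddSubgroup.toIntSubmodule I).FG := by
      have := isNoetherian_of_isNoetherianRing_of_finite ℤ (AddSubgroup.toIntSubmodule J)
      exact Submodule.FG.of_le (Module.Finite.iff_fg.1 inferInstance)
        (show _ ≤ AddSubgroup.toIntSubmodule J from hIJ)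
    rw [Submodule.fg_iff_addSubgroup_fg] at hfg
    exact hfg
  · rw [eq_top_iff, ← hJ.2, Submodule.span_le]
    intro x hx
    have h1 : (n : ℚ) • x ∈ Submodule.span ℚ (I : Set ℍ[ℚ,a,b]) := by
      rw [Nat.cast_smul_eq_nsmul]; exact Submodule.subset_span (h x hx)
    have h2 := Submodule.smul_mem _ ((n : ℚ)⁻¹) h1
    rwa [inv_smul_smul₀ (by exact_mod_cast hn)] at h2

lemma toCompl_nsmul (n : ℕ) (x : ℍ[ℚ,a,b]) : toCompl p (n • x) = (n : ℚ_[p]) • toCompl p x := by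
  rw [← Nat.cast_smul_eq_nsmul ℚ, toCompl_smul]; simp

/-- A lattice is `p`-adically dense in its localization: `p`-adic coefficients are replaced by
integers congruent to them modulo `p^k`. -/
lemma exists_toCompl_add_pow_smul {I : AddSubgroup ℍ[ℚ,a,b]} {y : Compl p a b}
    (hy : y ∈ localize p I) (k : ℕ) :
    ∃ x ∈ I, ∃ z ∈ localize p I, y = toCompl p x + (p : ℚ_[p]) ^ k • z := by
  have main : ∀ y ∈ localize p I,
      (∃ x ∈ I, ∃ z ∈ localize p I, y = toCompl p x + (p : ℤ_[p]) ^ k • z) := by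
    intro y hy
    induction hy using Submodule.span_induction with
    | mem x hx =>
      obtain ⟨x, hx, rfl⟩ := hx
      exact ⟨x, hx, 0, zero_mem _, by simp⟩
    | zero => exact ⟨0, zero_mem _, 0, zero_mem _, by simp [toCompl]⟩
    | add y y' _ _ hy hy' =>
      obtain ⟨x, hx, z, hz, rfl⟩ := hy
      obtain ⟨x', hx', z', hz', rfl⟩ := hy'
      refine ⟨x + x', add_mem hx hx', z + z', add_mem hz hz', ?_⟩
      rw [toCompl_add, smul_add]; abel
    | smul c y _ hy =>
      obtain ⟨x, hx, z, hz, rfl⟩ := hy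
      obtain ⟨d, hd⟩ := Ideal.mem_span_singleton'.1 (PadicInt.appr_spec k c)
      have hc : c = (c.appr k : ℤ_[p]) + p ^ k * d := by rw [mul_comm, hd]; ring
      refine ⟨c.appr k • x, nsmul_mem hx _, d • toCompl p x + c • z,
        add_mem (Submodule.smul_mem _ _ (toCompl_mem_localize hx)) (Submodule.smul_mem _ _ hz), ?_⟩
      have h1 : toCompl p (c.appr k • x) = (c.appr k : ℤ_[p]) • toCompl p x := by
        rw [toCompl_nsmul, Nat.cast_smul_eq_nsmul, Nat.cast_smul_eq_nsmul]
      rw [h1, smul_add, smul_add, smul_smul, smul_smul, ← add_assoc, ← add_smul, ← hc, mul_comm c,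
        mul_smul]
  obtain ⟨x, hx, z, hz, h⟩ := main y hy
  refine ⟨x, hx, z, hz, h.trans ?_⟩
  rw [← algebraMap_smul ℚ_[p] ((p : ℤ_[p]) ^ k) z]
  simp

/-- The lattice of all elements of `J` that lie in `P_p` for every `p`. -/
def latticeOfLocal (J : AddSubgroup ℍ[ℚ,a,b])
    (P : ∀ (p : ℕ) [Fact p.Prime], Submodule ℤ_[p] (Compl p a b)) : AddSubgroup ℍ[ℚ,a,b] where
  carrier := {x | x ∈ J ∧ ∀ (p : ℕ) [Fact p.Prime], toCompl p x ∈ P p}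
  zero_mem' := ⟨zero_mem _, fun p _ => by simp [toCompl]⟩
  add_mem' := fun hx hy => ⟨add_mem hx.1 hy.1, fun p _ => by
    rw [toCompl_add]; exact add_mem (hx.2 p) (hy.2 p)⟩
  neg_mem' := fun {x} hx => ⟨neg_mem hx.1, fun p _ => by
    have : toCompl p (-x) = - toCompl p x := TensorProduct.tmul_neg _ _
    rw [this]; exact neg_mem (hx.2 p)⟩

section LatticeOfLocal

variable {J : AddSubgroup ℍ[ℚ,a,b]} {P : ∀ (p : ℕ) [Fact p.Prime], Submodule ℤ_[p] (Compl p a b)}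
  {n : ℕ}

lemma smul_mem_latticeOfLocal
    (hn : ∀ (p : ℕ) [Fact p.Prime], ∀ z ∈ localize p J, (n : ℚ_[p]) • z ∈ P p)
    {x : ℍ[ℚ,a,b]} (hx : x ∈ J) : n • x ∈ latticeOfLocal J P :=
  ⟨nsmul_mem hx n, fun p _ => by
    rw [toCompl_nsmul]; exact hn p _ (toCompl_mem_localize hx)⟩

lemma isFullLattice_latticeOfLocal (hJ : IsFullLattice J) (hn0 : n ≠ 0)
    (hn : ∀ (p : ℕ) [Fact p.Prime], ∀ z ∈ localize p J, (n : ℚ_[p]) • z ∈ P p) :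
    IsFullLattice (latticeOfLocal J P) :=
  isFullLattice_of_smul_le hJ (fun _ hx => hx.1) hn0 fun _ hx => smul_mem_latticeOfLocal hn hx

/-- Prescribed local lattices come from a global one. The bounds `n J_p ⊆ P_p ⊆ J_p`, with `n`
independent of `p`, hold `P_p` equal to `J_p` at almost all primes and reduce the claim at `p` to an
approximation modulo `p^k`. -/
lemma localize_latticeOfLocal (hP : ∀ (p : ℕ) [Fact p.Prime], P p ≤ localize p J) (hn0 : n ≠ 0)
    (hn : ∀ (p : ℕ) [Fact p.Prime], ∀ z ∈ localize p J, (n : ℚ_[p]) • z ∈ P p) (p : ℕ)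
    [hp : Fact p.Prime] :
    localize p (latticeOfLocal J P) = P p := by
  apply le_antisymm
  · rw [localize, Submodule.span_le]
    rintro _ ⟨x, hx, rfl⟩
    exact hx.2 p
  · have hnJ : ∀ z ∈ localize p J, (n : ℤ_[p]) • z ∈ localize p (latticeOfLocal J P) := by
      intro z hz
      induction hz using Submodule.span_induction with
      | mem x hx =>
        obtain ⟨x, hx, rfl⟩ := hx
        have := toCompl_mem_localize (p := p) (smul_mem_latticeOfLocal (n := n) hn hx)
        rwa [toCompl_nsmul, Nat.cast_smul_eq_nsmul, ← Nat.cast_smul_eq_nsmul ℤ_[p]] at this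
      | zero => simp
      | add y y' _ _ hy hy' => rw [smul_add]; exact add_mem hy hy'
      | smul c y _ hy => rw [smul_comm]; exact Submodule.smul_mem _ _ hy
    intro y hy
    -- At `p` only the `p`-part of `n` matters, so `p^k J_p` already lies in the localization.
    obtain ⟨k, n', hn', rfl⟩ := Nat.exists_eq_pow_mul_and_not_dvd hn0 p hp.out.ne_one
    have hcop : n'.Coprime (p ^ k) :=
      (Nat.Coprime.pow_left k ((Nat.Prime.coprime_iff_not_dvd hp.out).2 hn')).symm
    have hn'1 : ‖(n' : ℚ_[p])‖ = 1 := Padic.norm_natCast_eq_one_iff.2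
      ((Nat.Prime.coprime_iff_not_dvd hp.out).2 hn')
    have hn'0 : (n' : ℚ_[p]) ≠ 0 := norm_ne_zero_iff.1 (by rw [hn'1]; exact one_ne_zero)
    have hpk : ∀ z ∈ localize p J, (p : ℚ_[p]) ^ k • z ∈ localize p (latticeOfLocal J P) := by
      intro z hz
      have h1 := hnJ ((n' : ℚ_[p])⁻¹ • z) (smul_mem_localize (by rw [norm_inv, hn'1, inv_one]) hz)
      rw [Nat.cast_smul_eq_nsmul, ← Nat.cast_smul_eq_nsmul ℚ_[p], smul_smul] at h1
      push_cast at h1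
      rwa [mul_assoc, mul_inv_cancel₀ hn'0, mul_one] at h1
    have hle : localize p (latticeOfLocal J P) ≤ P p := by
      rw [localize, Submodule.span_le]
      rintro _ ⟨x, hx, rfl⟩
      exact hx.2 p
    obtain ⟨x, hx, z, hz, rfl⟩ := exists_toCompl_add_pow_smul (hP p hy) k
    have hxP : toCompl p x ∈ P p := by
      have := sub_mem hy (hle (hpk z hz))
      rwa [add_sub_cancel_right] at this
    -- Multiplication by `c` with `c ≡ 0 mod n'` and `c ≡ 1 mod p^k` moves `x` into `P_q` at the
    -- other primes `q` and changes it at `p` only by an element of `p^k J_p`.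
    obtain ⟨c, hc1, hc0⟩ := Nat.chineseRemainder hcop 0 1
    obtain ⟨e, rfl⟩ := (Nat.modEq_zero_iff_dvd).1 hc1
    have hcx : (n' * e) • x ∈ latticeOfLocal J P := by
      refine ⟨nsmul_mem hx _, fun q hq => ?_⟩
      by_cases hqp : q = p
      · subst hqp
        rw [toCompl_nsmul, Nat.cast_smul_eq_nsmul]
        exact nsmul_mem hxP _
      · have hpq1 : ‖((p ^ k : ℕ) : ℚ_[q])‖ = 1 := Padic.norm_natCast_eq_one_iff.2
          (((Nat.coprime_primes hq.out hp.out).2 hqp).pow_right k)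
        have hpq0 : ((p ^ k : ℕ) : ℚ_[q]) ≠ 0 := norm_ne_zero_iff.1 (by rw [hpq1]; exact one_ne_zero)
        have h1 := hn q (((p ^ k : ℕ) : ℚ_[q])⁻¹ • toCompl q x)
          (smul_mem_localize (by rw [norm_inv, hpq1, inv_one]) (toCompl_mem_localize hx))
        have h2 := nsmul_mem h1 e
        rw [← Nat.cast_smul_eq_nsmul ℚ_[q], smul_smul, smul_smul, Nat.cast_mul] at h2
        rw [toCompl_nsmul, Nat.cast_mul]
        convert h2 using 2
        field_simp
    obtain ⟨d, hd⟩ := (Nat.modEq_iff_dvd.1 hc0)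
    have h1 : toCompl p x = toCompl p ((n' * e) • x) + (p : ℚ_[p]) ^ k • ((d : ℚ_[p]) • toCompl p x) := by
      rw [toCompl_nsmul, smul_smul, ← add_smul]
      have : ((1 : ℤ) : ℚ_[p]) - ((n' * e : ℕ) : ℤ) = ((p ^ k : ℕ) : ℤ) * d := by
        rw [← Int.cast_mul, ← hd]; push_cast; ring
      have h2 : ((n' * e : ℕ) : ℚ_[p]) + (p : ℚ_[p]) ^ k * d = 1 := by
        push_cast at this ⊢
        linear_combination -this
      rw [h2, one_smul]
    rw [h1]
    refine add_mem (add_mem (toCompl_mem_localize hcx) (hpk _ ?_)) (hpk z hz)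
    exact smul_mem_localize (Padic.norm_int_le_one d) (toCompl_mem_localize hx)

end LatticeOfLocal

lemma mem_localize_mulRight {I : AddSubgroup ℍ[ℚ,a,b]} (x : (ℍ[ℚ,a,b])ˣ) (z : Compl p a b) :
    z ∈ localize p (mulRight I x) ↔
      z * (((toComplUnits p x)⁻¹ : (Compl p a b)ˣ) : Compl p a b) ∈ localize p I := by
  have h : localize p (mulRight I x) =
      (localize p I).map (LinearMap.mulRight ℤ_[p] (toCompl p (x : ℍ[ℚ,a,b]))) := by
    rw [localize, localize, Submodule.map_span]
    congr 1
    ext y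
    constructor
    · rintro ⟨_, ⟨w, hw, rfl⟩, rfl⟩
      exact ⟨_, ⟨w, hw, rfl⟩, (toCompl_mul _ _).symm⟩
    · rintro ⟨_, ⟨w, hw, rfl⟩, rfl⟩
      exact ⟨_, ⟨w, hw, rfl⟩, toCompl_mul _ _⟩
  rw [h]
  constructor
  · rintro ⟨y, hy, rfl⟩
    rw [LinearMap.mulRight_apply, ← coe_toComplUnits, Units.mul_inv_cancel_right]
    exact hy
  · intro hz
    refine ⟨_, hz, ?_⟩
    rw [LinearMap.mulRight_apply, ← coe_toComplUnits, Units.inv_mul_cancel_right]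

lemma IsFullLattice.mulRight {I : AddSubgroup ℍ[ℚ,a,b]} (hI : IsFullLattice I)
    (x : (ℍ[ℚ,a,b])ˣ) : IsFullLattice (mulRight I x) := by
  constructor
  · classical
    obtain ⟨S, hS⟩ := hI.1
    refine ⟨S.image (AddMonoidHom.mulRight (x : ℍ[ℚ,a,b])), ?_⟩
    rw [Finset.coe_image, ← AddMonoidHom.map_closure, hS]
    rfl
  · have h : ((QuatLevel.mulRight I x : AddSubgroup ℍ[ℚ,a,b]) : Set ℍ[ℚ,a,b]) =
        (LinearMap.mulRight ℚ (x : ℍ[ℚ,a,b])) '' I := rfl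
    rw [h, ← Submodule.map_span, hI.2, Submodule.map_top, LinearMap.range_eq_top]
    intro y
    exact ⟨y * ((x⁻¹ : (ℍ[ℚ,a,b])ˣ) : ℍ[ℚ,a,b]), by simp⟩

end Lattice

/-! ### Local generators of ideals -/

section LocalGroup

variable {p : ℕ} [hp : Fact p.Prime]

lemma Normalizes.one {Λ : Submodule ℤ_[p] (Compl p a b)} : Normalizes Λ 1 := by
  intro z; simp

lemma Normalizes.mul {Λ : Submodule ℤ_[p] (Compl p a b)} {x y : (Compl p a b)ˣ}
    (hx : Normalizes Λ x) (hy : Normalizes Λ y) : Normalizes Λ (x * y) := by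
  intro z
  rw [← hy z, ← hx (y * z * _), mul_inv_rev, Units.val_mul, Units.val_mul]
  simp only [mul_assoc]

lemma Normalizes.inv {Λ : Submodule ℤ_[p] (Compl p a b)} {x : (Compl p a b)ˣ}
    (hx : Normalizes Λ x) : Normalizes Λ x⁻¹ := by
  intro z
  rw [← hx]
  simp only [mul_assoc, inv_inv, Units.mul_inv, mul_one, Units.mul_inv_cancel_left]

lemma IsLocalUnit.inv {Λ : Submodule ℤ_[p] (Compl p a b)} {u : (Compl p a b)ˣ}
    (hu : IsLocalUnit Λ u) : IsLocalUnit Λ u⁻¹ := ⟨hu.2, by rw [inv_inv]; exact hu.1⟩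

lemma IsLocalUnit.mul_mem_iff {O : Subring ℍ[ℚ,a,b]} {u : (Compl p a b)ˣ}
    (hu : IsLocalUnit (localize p O.toAddSubgroup) u) (z : Compl p a b) :
    (u : Compl p a b) * z ∈ localize p O.toAddSubgroup ↔ z ∈ localize p O.toAddSubgroup :=
  ⟨fun h => by simpa using mul_mem_localize hu.2 h, fun h => mul_mem_localize hu.1 h⟩

lemma IsLocalUnit.mem_mul_iff {O : Subring ℍ[ℚ,a,b]} {u : (Compl p a b)ˣ}
    (hu : IsLocalUnit (localize p O.toAddSubgroup) u) (z : Compl p a b) :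
    z * u ∈ localize p O.toAddSubgroup ↔ z ∈ localize p O.toAddSubgroup :=
  ⟨fun h => by simpa using mul_mem_localize h hu.2, fun h => mul_mem_localize h hu.1⟩

lemma IsLocalUnit.normalizes {O : Subring ℍ[ℚ,a,b]} {u : (Compl p a b)ˣ}
    (hu : IsLocalUnit (localize p O.toAddSubgroup) u) :
    Normalizes (localize p O.toAddSubgroup) u := by
  intro z
  rw [hu.inv.mem_mul_iff, hu.mul_mem_iff]

/-- `I_p = y O_p`. -/
def IsGen (O : Subring ℍ[ℚ,a,b]) (I : AddSubgroup ℍ[ℚ,a,b]) (p : ℕ) [Fact p.Prime]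
    (y : (Compl p a b)ˣ) : Prop :=
  ∀ z : Compl p a b, z ∈ localize p I ↔
    ((y⁻¹ : (Compl p a b)ˣ) : Compl p a b) * z ∈ localize p O.toAddSubgroup

lemma isGen_one (O : Subring ℍ[ℚ,a,b]) : IsGen O O.toAddSubgroup p 1 := by
  intro z; simp

lemma IsGen.isLocalUnit {O : Subring ℍ[ℚ,a,b]} {I : AddSubgroup ℍ[ℚ,a,b]} {x y : (Compl p a b)ˣ}
    (hx : IsGen O I p x) (hy : IsGen O I p y) :
    IsLocalUnit (localize p O.toAddSubgroup) (x⁻¹ * y) := by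
  constructor
  · rw [Units.val_mul, ← hx, hy, Units.inv_mul]; exact one_mem_localize O
  · rw [mul_inv_rev, inv_inv, Units.val_mul, ← hy, hx, Units.inv_mul]; exact one_mem_localize O

lemma IsGen.mul_unit {O : Subring ℍ[ℚ,a,b]} {I : AddSubgroup ℍ[ℚ,a,b]} {y u : (Compl p a b)ˣ}
    (hy : IsGen O I p y) (hu : IsLocalUnit (localize p O.toAddSubgroup) u) :
    IsGen O I p (y * u) := by
  intro z
  rw [hy, mul_inv_rev, Units.val_mul, mul_assoc, hu.inv.mul_mem_iff]

lemma IsGen.localize_eq {O : Subring ℍ[ℚ,a,b]} {I J : AddSubgroup ℍ[ℚ,a,b]} {y : (Compl p a b)ˣ}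
    (hI : IsGen O I p y) (hJ : IsGen O J p y) : localize p I = localize p J := by
  ext z; rw [hI, hJ]

lemma IsGen.mulRight {O : Subring ℍ[ℚ,a,b]} {I : AddSubgroup ℍ[ℚ,a,b]} {y : (Compl p a b)ˣ}
    (hI : IsGen O I p y) {x : (ℍ[ℚ,a,b])ˣ}
    (hx : Normalizes (localize p O.toAddSubgroup) (toComplUnits p x)) :
    IsGen O (mulRight I x) p (y * toComplUnits p x) := by
  intro z
  rw [mem_localize_mulRight, hI, ← hx.inv, mul_inv_rev, Units.val_mul]
  simp only [mul_assoc, inv_inv, Units.inv_mul, mul_one]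

/-- The unit `p` of `Q_p`. -/
def primeUnit (p : ℕ) [hp : Fact p.Prime] (a b : ℚ) : (Compl p a b)ˣ :=
  Units.map (algebraMap ℚ_[p] (Compl p a b)).toMonoidHom (Units.mk0 (p : ℚ_[p]) padic_prime_ne_zero)

lemma coe_primeUnit_zpow (k : ℤ) :
    ((primeUnit p a b ^ k : (Compl p a b)ˣ) : Compl p a b) =
      algebraMap ℚ_[p] _ ((p : ℚ_[p]) ^ k) := by
  rw [primeUnit, ← map_zpow, Units.coe_map, Units.val_zpow_eq_zpow_val]
  rfl

lemma primeUnit_zpow_mul_comm (k : ℤ) (x : (Compl p a b)ˣ) :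
    primeUnit p a b ^ k * x = x * primeUnit p a b ^ k := by
  ext1
  rw [Units.val_mul, Units.val_mul, coe_primeUnit_zpow, Algebra.commutes]

lemma normalizes_of_comm {Λ : Submodule ℤ_[p] (Compl p a b)} {x : (Compl p a b)ˣ}
    (h : ∀ z : Compl p a b, (x : Compl p a b) * z = z * x) : Normalizes Λ x := by
  intro z
  rw [h, Units.mul_inv_cancel_right]

/-- The element `q ∈ ℚ^×` of `Q^×`. -/
def ratUnit (a b : ℚ) : ℚˣ →* (ℍ[ℚ,a,b])ˣ := Units.map (algebraMap ℚ ℍ[ℚ,a,b]).toMonoidHom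

@[simp] lemma coe_ratUnit (q : ℚˣ) : (ratUnit a b q : ℍ[ℚ,a,b]) = algebraMap ℚ _ (q : ℚ) := rfl

lemma coe_toComplUnits_ratUnit (q : ℚˣ) :
    (toComplUnits p (ratUnit a b q) : Compl p a b) = algebraMap ℚ_[p] _ ((q : ℚ) : ℚ_[p]) := by
  rw [coe_toComplUnits, coe_ratUnit, Algebra.algebraMap_eq_smul_one, toCompl_smul, toCompl_one,
    Algebra.algebraMap_eq_smul_one]

lemma toComplUnits_ratUnit_comm (q : ℚˣ) (z : Compl p a b) :
    (toComplUnits p (ratUnit a b q) : Compl p a b) * z = z * toComplUnits p (ratUnit a b q) := by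
  rw [coe_toComplUnits_ratUnit, Algebra.commutes]

lemma isLocalUnit_algebraMap {O : Subring ℍ[ℚ,a,b]} {u : (Compl p a b)ˣ} {c : ℚ_[p]}
    (hu : (u : Compl p a b) = algebraMap ℚ_[p] _ c) (hc : ‖c‖ = 1) :
    IsLocalUnit (localize p O.toAddSubgroup) u := by
  have hc0 : c ≠ 0 := norm_ne_zero_iff.1 (by rw [hc]; exact one_ne_zero)
  have hinv : ((u⁻¹ : (Compl p a b)ˣ) : Compl p a b) = algebraMap ℚ_[p] _ c⁻¹ := by
    rw [Units.inv_eq_of_mul_eq_one_right]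
    rw [hu, ← map_mul, mul_inv_cancel₀ hc0, map_one]
  constructor
  · rw [hu, Algebra.algebraMap_eq_smul_one]
    exact smul_mem_localize hc.le (one_mem_localize O)
  · rw [hinv, Algebra.algebraMap_eq_smul_one]
    exact smul_mem_localize (by rw [norm_inv, hc, inv_one]) (one_mem_localize O)

lemma exists_toComplUnits_ratUnit_eq (O : Subring ℍ[ℚ,a,b]) (q : ℚˣ) :
    ∃ u, IsLocalUnit (localize p O.toAddSubgroup) u ∧
      toComplUnits p (ratUnit a b q) = primeUnit p a b ^ (padicValRat p (q : ℚ)) * u := by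
  refine ⟨(primeUnit p a b ^ (padicValRat p (q : ℚ)))⁻¹ * toComplUnits p (ratUnit a b q), ?_, by simp⟩
  refine isLocalUnit_algebraMap (c := (p : ℚ_[p]) ^ (-padicValRat p (q : ℚ)) * ((q : ℚ) : ℚ_[p])) ?_ ?_
  · rw [← zpow_neg, Units.val_mul, coe_primeUnit_zpow, coe_toComplUnits_ratUnit, ← map_mul]
  · rw [norm_mul, Padic.norm_p_zpow, (norm_ratCast_eq_iff q.ne_zero _).2 rfl,
      ← zpow_add₀ prime_cast_pos.ne']
    simp

/-- At `p` a rational number is `p` to its valuation times a unit, so it moves the generator only by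
that power of `p`. -/
lemma isGen_ratUnit {O : Subring ℍ[ℚ,a,b]} {I : AddSubgroup ℍ[ℚ,a,b]} {y : (Compl p a b)ˣ}
    (hI : IsGen O I p y) (q : ℚˣ) :
    IsGen O (mulRight I (ratUnit a b q)) p (primeUnit p a b ^ (padicValRat p (q : ℚ)) * y) := by
  obtain ⟨u, hu, h⟩ := exists_toComplUnits_ratUnit_eq (p := p) O q
  have h1 := (hI.mulRight (normalizes_of_comm (toComplUnits_ratUnit_comm q))).mul_unit hu.inv
  rwa [h, mul_assoc, mul_assoc, mul_inv_cancel, mul_one, ← primeUnit_zpow_mul_comm] at h1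

end LocalGroup

/-! ### Two-sided ideals and the normalizer of `O` -/

section TwoSided

/-- If `I_p = O_p x = y O_p`, then the left order of `I_p` is `O_p` by the first description and `y
O_p y⁻¹` by the second. -/
lemma isTwoSidedIdeal_iff {O : Subring ℍ[ℚ,a,b]} {I : AddSubgroup ℍ[ℚ,a,b]} :
    IsTwoSidedIdeal O I ↔ IsFullLattice I ∧ ∀ (p : ℕ) [Fact p.Prime], ∃ y : (Compl p a b)ˣ,
      Normalizes (localize p O.toAddSubgroup) y ∧ IsGen O I p y := by
  constructor
  · rintro ⟨⟨hI, hl⟩, -, hr⟩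
    refine ⟨hI, fun p _ => ?_⟩
    obtain ⟨x, hx⟩ := hl p
    obtain ⟨y, hy⟩ := hr p
    have hx' : ∀ z, z ∈ localize p I ↔
        z * ((x⁻¹ : (Compl p a b)ˣ) : Compl p a b) ∈ localize p O.toAddSubgroup := by
      intro z
      rw [← SetLike.mem_coe, hx]
      constructor
      · rintro ⟨w, hw, rfl⟩; simpa using hw
      · intro h; exact ⟨_, h, by simp⟩
    have hy' : IsGen O I p y := by
      intro z
      rw [← SetLike.mem_coe, hy]
      constructor
      · rintro ⟨w, hw, rfl⟩; simpa using hw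
      · intro h; exact ⟨_, h, by simp⟩
    refine ⟨y, fun z => ?_, hy'⟩
    have h1 : ∀ t, t ∈ localize p O.toAddSubgroup ↔ ∀ s ∈ localize p I, t * s ∈ localize p I := by
      intro t
      constructor
      · intro ht s hs
        rw [hx'] at hs ⊢
        rw [mul_assoc]; exact mul_mem_localize ht hs
      · intro h
        have h2 := h x (by rw [hx', Units.mul_inv]; exact one_mem_localize O)
        rwa [hx', Units.mul_inv_cancel_right] at h2
    rw [h1]
    constructor
    · intro h
      have h2 := h y (by rw [hy', Units.inv_mul]; exact one_mem_localize O)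
      rwa [hy', Units.inv_mul_cancel_right, Units.inv_mul_cancel_left] at h2
    · intro hz s hs
      rw [hy'] at hs ⊢
      rw [mul_assoc, mul_assoc, Units.inv_mul_cancel_left]
      exact mul_mem_localize hz hs
  · rintro ⟨hI, h⟩
    refine ⟨⟨hI, fun p _ => ?_⟩, hI, fun p _ => ?_⟩ <;> obtain ⟨y, hy, hg⟩ := h p <;> refine ⟨y, ?_⟩
    · ext z
      rw [SetLike.mem_coe, hg]
      constructor
      · intro hz
        refine ⟨_, (hy _).2 hz, ?_⟩
        simp
      · rintro ⟨w, hw, rfl⟩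
        rw [SetLike.mem_coe, ← hy.inv, inv_inv] at hw
        simpa [mul_assoc] using hw
    · ext z
      rw [SetLike.mem_coe, hg]
      constructor
      · intro hz; exact ⟨_, hz, by simp⟩
      · rintro ⟨w, hw, rfl⟩; simpa using hw

lemma isTwoSidedIdeal_self {O : Subring ℍ[ℚ,a,b]} (hO : IsOrder O) :
    IsTwoSidedIdeal O O.toAddSubgroup :=
  isTwoSidedIdeal_iff.2 ⟨hO, fun _ _ => ⟨1, Normalizes.one, isGen_one O⟩⟩

/-- The normalizer of `O` in `Q^×`. -/
def orderNormalizer (O : Subring ℍ[ℚ,a,b]) : Subgroup (ℍ[ℚ,a,b])ˣ where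
  carrier := {x | ∀ z : ℍ[ℚ,a,b], (x : ℍ[ℚ,a,b]) * z * ((x⁻¹ : (ℍ[ℚ,a,b])ˣ) : ℍ[ℚ,a,b]) ∈ O ↔ z ∈ O}
  one_mem' := by intro z; simp
  mul_mem' := by
    intro x y hx hy z
    rw [← hy z, ← hx (y * z * _), mul_inv_rev, Units.val_mul, Units.val_mul]
    simp only [mul_assoc]
  inv_mem' := by
    intro x hx z
    rw [← hx]
    simp only [mul_assoc, inv_inv, Units.mul_inv, mul_one, Units.mul_inv_cancel_left]

lemma normalizes_toComplUnits {O : Subring ℍ[ℚ,a,b]} {x : (ℍ[ℚ,a,b])ˣ}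
    (hx : x ∈ orderNormalizer O) (p : ℕ) [Fact p.Prime] :
    Normalizes (localize p O.toAddSubgroup) (toComplUnits p x) := by
  have main : ∀ x ∈ orderNormalizer O, ∀ z ∈ localize p O.toAddSubgroup,
      (toComplUnits p x : Compl p a b) * z *
        (((toComplUnits p x)⁻¹ : (Compl p a b)ˣ) : Compl p a b) ∈ localize p O.toAddSubgroup := by
    intro x hx z hz
    induction hz using Submodule.span_induction with
    | mem z hz =>
      obtain ⟨z, hz, rfl⟩ := hz
      rw [← map_inv, coe_toComplUnits, coe_toComplUnits, ← toCompl_mul, ← toCompl_mul]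
      exact toCompl_mem_localize ((hx z).2 hz)
    | zero => simp
    | add y z _ _ hy hz => rw [mul_add, add_mul]; exact add_mem hy hz
    | smul c y _ hy => rw [mul_smul_comm, smul_mul_assoc]; exact Submodule.smul_mem _ _ hy
  intro z
  refine ⟨fun h => ?_, main x hx z⟩
  have h1 := main x⁻¹ (inv_mem hx) _ h
  rw [map_inv, inv_inv] at h1
  simpa only [mul_assoc, Units.inv_mul, mul_one, Units.inv_mul_cancel_left] using h1

lemma mem_orderNormalizer_of_forall {O : Subring ℍ[ℚ,a,b]} (hO : IsOrder O) {x : (ℍ[ℚ,a,b])ˣ}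
    (h : ∀ (p : ℕ) [Fact p.Prime], Normalizes (localize p O.toAddSubgroup) (toComplUnits p x)) :
    x ∈ orderNormalizer O := by
  intro z
  have hmem : ∀ z, z ∈ O ↔ ∀ (p : ℕ) [Fact p.Prime], toCompl p z ∈ localize p O.toAddSubgroup :=
    fun z => IsFullLattice.mem_iff hO z
  rw [hmem, hmem]
  refine forall_congr' fun p => forall_congr' fun _ => ?_
  rw [← h p (toCompl p z), ← map_inv, coe_toComplUnits, coe_toComplUnits, toCompl_mul, toCompl_mul]

lemma IsTwoSidedIdeal.mulRight {O : Subring ℍ[ℚ,a,b]} {I : AddSubgroup ℍ[ℚ,a,b]}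
    (hI : IsTwoSidedIdeal O I) {x : (ℍ[ℚ,a,b])ˣ} (hx : x ∈ orderNormalizer O) :
    IsTwoSidedIdeal O (mulRight I x) := by
  rw [isTwoSidedIdeal_iff] at hI ⊢
  refine ⟨hI.1.mulRight x, fun p _ => ?_⟩
  obtain ⟨y, hy, hg⟩ := hI.2 p
  have hxp := normalizes_toComplUnits hx p
  exact ⟨_, hy.mul hxp, hg.mulRight hxp⟩

/-- If `I_p = y O_p` and `(I x)_p = y' O_p`, then `O_p x = y⁻¹ y' O_p`. So `x` is locally an element
of the normalizer times a unit, and normalizing `O` is a local property. -/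
lemma IsTwoSidedIdeal.mem_orderNormalizer {O : Subring ℍ[ℚ,a,b]} (hO : IsOrder O)
    {I : AddSubgroup ℍ[ℚ,a,b]} (hI : IsTwoSidedIdeal O I) {x : (ℍ[ℚ,a,b])ˣ}
    (hIx : IsTwoSidedIdeal O (QuatLevel.mulRight I x)) : x ∈ orderNormalizer O := by
  rw [isTwoSidedIdeal_iff] at hI hIx
  refine mem_orderNormalizer_of_forall hO fun p _ => ?_
  obtain ⟨y, hy, hg⟩ := hI.2 p
  obtain ⟨y', hy', hg'⟩ := hIx.2 p
  have hiff : ∀ z, ((y'⁻¹ : (Compl p a b)ˣ) : Compl p a b) * z ∈ localize p O.toAddSubgroup ↔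
      ((y⁻¹ : (Compl p a b)ˣ) : Compl p a b) *
        (z * (((toComplUnits p x)⁻¹ : (Compl p a b)ˣ) : Compl p a b)) ∈
          localize p O.toAddSubgroup := by
    intro z
    rw [← hg', mem_localize_mulRight, hg]
  have hn : Normalizes (localize p O.toAddSubgroup) (y⁻¹ * y') := hy.inv.mul hy'
  have hu : IsLocalUnit (localize p O.toAddSubgroup) ((y⁻¹ * y')⁻¹ * toComplUnits p x) := by
    constructor
    · rw [mul_inv_rev, inv_inv, mul_assoc, Units.val_mul, hiff, Units.val_mul,
        Units.mul_inv_cancel_right, Units.inv_mul]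
      exact one_mem_localize O
    · have h1 := (hiff y').1 (by rw [Units.inv_mul]; exact one_mem_localize O)
      rw [← hn.inv, inv_inv, ← Units.val_mul, ← Units.val_mul, ← Units.val_mul, ← Units.val_mul] at h1
      convert h1 using 2
      group
  have : toComplUnits p x = (y⁻¹ * y') * ((y⁻¹ * y')⁻¹ * toComplUnits p x) := by group
  rw [this]
  exact hn.mul hu.normalizes

/-- The condition on `x` does not involve `I`; this makes all stabilizers equal later on. -/
lemma IsTwoSidedIdeal.mulRight_eq_self_iff {O : Subring ℍ[ℚ,a,b]} (hO : IsOrder O)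
    {I : AddSubgroup ℍ[ℚ,a,b]} (hI : IsTwoSidedIdeal O I) (x : (ℍ[ℚ,a,b])ˣ) :
    QuatLevel.mulRight I x = I ↔ (x : ℍ[ℚ,a,b]) ∈ O ∧ ((x⁻¹ : (ℍ[ℚ,a,b])ˣ) : ℍ[ℚ,a,b]) ∈ O := by
  have hmem : ∀ z, z ∈ O ↔ ∀ (p : ℕ) [Fact p.Prime], toCompl p z ∈ localize p O.toAddSubgroup :=
    fun z => IsFullLattice.mem_iff hO z
  constructor
  · intro h
    have hx : x ∈ orderNormalizer O := hI.mem_orderNormalizer hO (by rwa [h])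
    rw [isTwoSidedIdeal_iff] at hI
    have hu : ∀ (p : ℕ) [Fact p.Prime],
        IsLocalUnit (localize p O.toAddSubgroup) (toComplUnits p x) := by
      intro p _
      obtain ⟨y, hy, hg⟩ := hI.2 p
      have hg' := hg.mulRight (normalizes_toComplUnits hx p)
      rw [h] at hg'
      simpa using hg.isLocalUnit hg'
    rw [hmem, hmem]
    refine ⟨fun p _ => (hu p).1, fun p _ => ?_⟩
    rw [← coe_toComplUnits, map_inv]
    exact (hu p).2
  · rintro ⟨h1, h2⟩
    have hx : x ∈ orderNormalizer O := by
      intro z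
      refine ⟨fun h => ?_, fun h => O.mul_mem (O.mul_mem h1 h) h2⟩
      simpa [mul_assoc] using O.mul_mem (O.mul_mem h2 h) h1
    rw [isTwoSidedIdeal_iff] at hI
    refine IsFullLattice.eq_of_localize_eq (hI.1.mulRight x) hI.1 fun p _ => ?_
    obtain ⟨y, hy, hg⟩ := hI.2 p
    have hu : IsLocalUnit (localize p O.toAddSubgroup) (toComplUnits p x) := by
      refine ⟨toCompl_mem_localize h1, ?_⟩
      rw [← map_inv]; exact toCompl_mem_localize h2
    exact (hg.mulRight (normalizes_toComplUnits hx p)).localize_eq (hg.mul_unit hu)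

end TwoSided

/-! ### Classification of two-sided ideals modulo `ℚ^×` -/

/-- A choice, for every prime, of a generator of the local normalizer. -/
structure LocalData (O : Subring ℍ[ℚ,a,b]) (N : ℕ)
    (C : ∀ (p : ℕ) [Fact p.Prime], ℍ[ℚ,a,b] → Prop) where
  w : ∀ (p : ℕ) [Fact p.Prime], (Compl p a b)ˣ
  spec : ∀ (p : ℕ) [Fact p.Prime], IsLocalNormalizer O p (N.factorization p) (C p) (w p)

/-- This is the class number one of `ℚ`: local scalars can be removed by one global scalar. -/
lemma exists_rat_of_padicVal (s : Finset ℕ) (f : ℕ → ℤ) (hf : ∀ p : ℕ, p.Prime → p ∉ s → f p = 0) :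
    ∃ q : ℚˣ, ∀ p : ℕ, p.Prime → padicValRat p (q : ℚ) = f p := by
  classical
  have main : ∀ t : Finset ℕ, (∀ p ∈ t, p.Prime) →
      ∃ q : ℚˣ, ∀ p : ℕ, p.Prime → padicValRat p (q : ℚ) = if p ∈ t then f p else 0 := by
    intro t
    induction t using Finset.induction_on with
    | empty => intro _; exact ⟨1, fun p _ => by simp⟩
    | insert r t hr ih =>
      intro ht
      obtain ⟨q, hq⟩ := ih fun p hp => ht p (Finset.mem_insert_of_mem hp)
      have hrp := ht r (Finset.mem_insert_self r t)
      have hr0 : (r : ℚ) ≠ 0 := by exact_mod_cast hrp.ne_zero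
      refine ⟨Units.mk0 (r : ℚ) hr0 ^ (f r) * q, fun p hp => ?_⟩
      have : Fact p.Prime := ⟨hp⟩
      have : Fact r.Prime := ⟨hrp⟩
      rw [Units.val_mul, Units.val_zpow_eq_zpow_val, Units.val_mk0,
        padicValRat.mul (zpow_ne_zero _ hr0) q.ne_zero, padicValRat.zpow, hq p hp]
      by_cases hpr : p = r
      · subst hpr
        rw [padicValRat.self hp.one_lt]
        simp [hr]
      · have : padicValRat p (r : ℚ) = 0 := by
          rw [padicValRat.of_nat, padicValNat_primes hpr]; rfl
        rw [this]
        simp [hpr]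
  obtain ⟨q, hq⟩ := main (s.filter Nat.Prime) fun p hp => (Finset.mem_filter.1 hp).2
  refine ⟨q, fun p hp => ?_⟩
  rw [hq p hp]
  split_ifs with h
  · rfl
  · exact (hf p hp fun hps => h (Finset.mem_filter.2 ⟨hps, hp⟩)).symm

lemma rat_eq_one_or_neg_one {q : ℚ} (hq0 : q ≠ 0)
    (h : ∀ p : ℕ, p.Prime → padicValRat p q = 0) : q = 1 ∨ q = -1 := by
  have hn : ∀ r : ℚ, r ≠ 0 → (∀ p : ℕ, p.Prime → padicValRat p r = 0) → ∃ z : ℤ, (z : ℚ) = r := by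
    intro r hr hv
    refine rat_isInt_of_forall_norm_le fun p hp => ?_
    rw [(norm_ratCast_eq_iff hr 0).2 (hv p hp.out)]
    simp
  obtain ⟨z, hz⟩ := hn q hq0 h
  obtain ⟨z', hz'⟩ := hn q⁻¹ (inv_ne_zero hq0) fun p hp => by
    have : Fact p.Prime := ⟨hp⟩
    rw [padicValRat.inv, h p hp, neg_zero]
  have hzz : z * z' = 1 := by
    have : (z : ℚ) * z' = 1 := by rw [hz, hz', mul_inv_cancel₀ hq0]
    exact_mod_cast this
  rcases Int.eq_one_or_neg_one_of_mul_eq_one hzz with h | h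
  · left; rw [← hz, h]; simp
  · right; rw [← hz, h]; simp

section

variable {p : ℕ} [hp : Fact p.Prime]

lemma localize_le_of_smul_mem {I J : AddSubgroup ℍ[ℚ,a,b]} {n : ℕ} (hn : ¬ p ∣ n)
    (h : ∀ x ∈ I, n • x ∈ J) : localize p I ≤ localize p J := by
  have hn1 : ‖(n : ℚ_[p])‖ = 1 := Padic.norm_natCast_eq_one_iff.2
    ((Nat.Prime.coprime_iff_not_dvd hp.out).2 hn)
  have hn0 : (n : ℚ_[p]) ≠ 0 := norm_ne_zero_iff.1 (by rw [hn1]; exact one_ne_zero)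
  rw [localize, Submodule.span_le]
  rintro _ ⟨x, hx, rfl⟩
  have h1 := toCompl_mem_localize (p := p) (h x hx)
  rw [toCompl_nsmul] at h1
  have h2 := smul_mem_localize (c := (n : ℚ_[p])⁻¹) (by rw [norm_inv, hn1, inv_one]) h1
  rwa [inv_smul_smul₀ hn0] at h2

lemma coe_primeUnit_zpow_eq_toCompl (k : ℤ) :
    ((primeUnit p a b ^ k : (Compl p a b)ˣ) : Compl p a b) =
      toCompl p (algebraMap ℚ ℍ[ℚ,a,b] ((p : ℚ) ^ k)) := by
  rw [coe_primeUnit_zpow, Algebra.algebraMap_eq_smul_one, Algebra.algebraMap_eq_smul_one,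
    toCompl_smul, toCompl_one]
  push_cast
  rfl

lemma nrd_algebraMap (q : ℚ) : nrd (algebraMap ℚ ℍ[ℚ,a,b] q) = q ^ 2 := by
  rw [nrd_eq, QuaternionAlgebra.algebraMap_eq]; simp

variable {O : Subring ℍ[ℚ,a,b]} {v : ℕ} {C : ℍ[ℚ,a,b] → Prop} {w : (Compl p a b)ˣ}

/-- The reduced norm `p^(2k)` is integral for both `p^k` and its inverse. -/
lemma IsLocalNormalizer.eq_zero_of_isLocalUnit_zpow (hw : IsLocalNormalizer O p v C w) {k : ℤ}
    (hk : IsLocalUnit (localize p O.toAddSubgroup) (primeUnit p a b ^ k)) : k = 0 := by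
  have main : ∀ k : ℤ, ((primeUnit p a b ^ k : (Compl p a b)ˣ) : Compl p a b) ∈
      localize p O.toAddSubgroup → 0 ≤ k := by
    intro k hk
    rw [coe_primeUnit_zpow_eq_toCompl] at hk
    have h1 := (hw.norm_le _ hk).1
    rw [nrd_algebraMap] at h1
    push_cast at h1
    rw [norm_pow, Padic.norm_p_zpow, sq_le_one_iff₀ (by positivity), ← zpow_zero (p : ℝ),
      zpow_le_zpow_iff_right₀ one_lt_prime_cast] at h1
    omega
  have h1 := main k hk.1
  have h2 := main (-k) (by rw [zpow_neg]; exact hk.2)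
  omega

lemma IsLocalNormalizer.isLocalUnit_of_eq_zero (hw : IsLocalNormalizer O p 0 C w) :
    IsLocalUnit (localize p O.toAddSubgroup) w := by
  refine ⟨hw.mem, ?_⟩
  have : w⁻¹ = w := by
    rw [inv_eq_iff_mul_eq_one]
    ext1
    rw [Units.val_mul, hw.sq, pow_zero, map_one, Units.val_one]
  rw [this]; exact hw.mem

lemma coe_primeUnit_zpow_mul (k : ℤ) (u : (Compl p a b)ˣ) :
    ((primeUnit p a b ^ k * u : (Compl p a b)ˣ) : Compl p a b) = (p : ℚ_[p]) ^ k • (u : Compl p a b) := by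
  rw [Units.val_mul, coe_primeUnit_zpow, Algebra.algebraMap_eq_smul_one, smul_mul_assoc, one_mul]

lemma IsLocalNormalizer.exists_eq (hw : IsLocalNormalizer O p v C w) {y : (Compl p a b)ˣ}
    (hy : Normalizes (localize p O.toAddSubgroup) y) :
    ∃ k : ℤ, ∃ u, IsLocalUnit (localize p O.toAddSubgroup) u ∧
      (y = primeUnit p a b ^ k * u ∨ y = primeUnit p a b ^ k * (w * u)) := by
  obtain ⟨k, u, hu, h⟩ := hw.classify y hy
  refine ⟨k, u, hu, h.imp (fun h => Units.ext ?_) (fun h => Units.ext ?_)⟩ <;>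
  rw [h, coe_primeUnit_zpow_mul]

lemma IsLocalNormalizer.not_isGen_both (hw : IsLocalNormalizer O p v C w) (hv : 0 < v)
    {I : AddSubgroup ℍ[ℚ,a,b]} {j k : ℤ} (h1 : IsGen O I p (primeUnit p a b ^ j))
    (h2 : IsGen O I p (primeUnit p a b ^ k * w)) : False := by
  have hu := h1.isLocalUnit h2
  refine hw.not_unit hv (j - k) _ hu ?_
  rw [← coe_primeUnit_zpow_mul]
  congr 1
  rw [zpow_sub]; group

end

namespace LocalData

variable {O : Subring ℍ[ℚ,a,b]} {N : ℕ} {C : ∀ (p : ℕ) [Fact p.Prime], ℍ[ℚ,a,b] → Prop}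
  (D : LocalData O N C)

/-- The local generators of the two-sided ideal belonging to a set `S` of primes. -/
def typeUnit (S : Finset ℕ) (p : ℕ) [Fact p.Prime] : (Compl p a b)ˣ := if p ∈ S then D.w p else 1

open Classical in
/-- The set of the primes at which `I` is not locally generated by a scalar. -/
def typeSet (I : AddSubgroup ℍ[ℚ,a,b]) : Finset ℕ :=
  N.primeFactors.filter fun p =>
    ∃ _ : Fact p.Prime, ∃ k : ℤ, IsGen O I p (primeUnit p a b ^ k * D.w p)

lemma mem_typeSet {I : AddSubgroup ℍ[ℚ,a,b]} {p : ℕ} : p ∈ D.typeSet I ↔ p ∈ N.primeFactors ∧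
    ∃ _ : Fact p.Prime, ∃ k : ℤ, IsGen O I p (primeUnit p a b ^ k * D.w p) := by
  classical
  rw [typeSet, Finset.mem_filter]

lemma typeSet_subset (I : AddSubgroup ℍ[ℚ,a,b]) : D.typeSet I ⊆ N.primeFactors :=
  fun _ hp => (D.mem_typeSet.1 hp).1

lemma factorization_pos {p : ℕ} (h : p ∈ N.primeFactors) : 0 < N.factorization p := by
  rw [← Nat.support_factorization, Finsupp.mem_support_iff] at h
  omega

lemma factorization_eq_zero {p : ℕ} (h : p ∉ N.primeFactors) : N.factorization p = 0 := by
  rwa [← Nat.support_factorization, Finsupp.notMem_support_iff] at h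

lemma normalizes_typeUnit (S : Finset ℕ) (p : ℕ) [Fact p.Prime] :
    Normalizes (localize p O.toAddSubgroup) (D.typeUnit S p) := by
  unfold typeUnit
  split_ifs
  · exact (D.spec p).normalizes
  · exact Normalizes.one

/-- At primes not dividing `N` the element `w_p` is itself a unit, because its square is `1`; so it
never occurs there. -/
lemma exists_isGen_typeUnit {I : AddSubgroup ℍ[ℚ,a,b]} (hI : IsTwoSidedIdeal O I) (p : ℕ)
    [hp : Fact p.Prime] :
    ∃ k : ℤ, IsGen O I p (primeUnit p a b ^ k * D.typeUnit (D.typeSet I) p) := by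
  unfold typeUnit
  split_ifs with h
  · obtain ⟨_, k, hk⟩ := (D.mem_typeSet.1 h).2
    exact ⟨k, hk⟩
  · obtain ⟨y, hy, hg⟩ := (isTwoSidedIdeal_iff.1 hI).2 p
    obtain ⟨k, u, hu, rfl | rfl⟩ := (D.spec p).exists_eq hy
    · refine ⟨k, ?_⟩
      have := hg.mul_unit hu.inv
      rwa [mul_assoc, mul_inv_cancel] at this
    · have h1 := hg.mul_unit hu.inv
      rw [mul_assoc, mul_inv_cancel_right] at h1
      have hpN : p ∉ N.primeFactors := fun hpN => h (D.mem_typeSet.2 ⟨hpN, hp, k, h1⟩)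
      have hw := D.spec p
      rw [factorization_eq_zero hpN] at hw
      have h2 := h1.mul_unit hw.isLocalUnit_of_eq_zero.inv
      refine ⟨k, ?_⟩
      rwa [mul_assoc, mul_inv_cancel] at h2

/-- The type is well defined because, at a prime dividing `N`, no ideal is generated both by a power
of `p` and by such a power times `w_p`. -/
lemma typeSet_eq {I : AddSubgroup ℍ[ℚ,a,b]} {S : Finset ℕ} (hS : S ⊆ N.primeFactors)
    (h : ∀ (p : ℕ) [Fact p.Prime], ∃ k : ℤ, IsGen O I p (primeUnit p a b ^ k * D.typeUnit S p)) :
    D.typeSet I = S := by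
  ext p
  constructor
  · intro hp
    obtain ⟨hpN, hp1, k, hk⟩ := D.mem_typeSet.1 hp
    by_contra hpS
    obtain ⟨j, hj⟩ := h p
    rw [typeUnit, if_neg hpS, mul_one] at hj
    exact (D.spec p).not_isGen_both (factorization_pos hpN) hj hk
  · intro hp
    have hp1 : Fact p.Prime := ⟨Nat.prime_of_mem_primeFactors (hS hp)⟩
    obtain ⟨j, hj⟩ := h p
    rw [typeUnit, if_pos hp] at hj
    exact D.mem_typeSet.2 ⟨hS hp, hp1, j, hj⟩

lemma exists_isGen_mulRight {I : AddSubgroup ℍ[ℚ,a,b]} {S : Finset ℕ}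
    (h : ∀ (p : ℕ) [Fact p.Prime], ∃ k : ℤ, IsGen O I p (primeUnit p a b ^ k * D.typeUnit S p))
    (q : ℚˣ) (p : ℕ) [Fact p.Prime] :
    ∃ k : ℤ, IsGen O (mulRight I (ratUnit a b q)) p (primeUnit p a b ^ k * D.typeUnit S p) := by
  obtain ⟨k, hk⟩ := h p
  refine ⟨padicValRat p (q : ℚ) + k, ?_⟩
  rw [zpow_add, mul_assoc]
  exact isGen_ratUnit hk q

lemma typeSet_mulRight {I : AddSubgroup ℍ[ℚ,a,b]} (hI : IsTwoSidedIdeal O I) (q : ℚˣ) :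
    D.typeSet (mulRight I (ratUnit a b q)) = D.typeSet I :=
  D.typeSet_eq (D.typeSet_subset I) fun p _ =>
    D.exists_isGen_mulRight (fun p _ => D.exists_isGen_typeUnit hI p) q p

lemma exists_rat_isGen (hN : N ≠ 0) (hO : IsOrder O) {I : AddSubgroup ℍ[ℚ,a,b]}
    (hI : IsTwoSidedIdeal O I) : ∃ q : ℚˣ, ∀ (p : ℕ) [Fact p.Prime],
      IsGen O (mulRight I (ratUnit a b q)) p (D.typeUnit (D.typeSet I) p) := by
  classical
  have hIf := (isTwoSidedIdeal_iff.1 hI).1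
  -- With `n I ⊆ O` and `n' O ⊆ I`, the two lattices agree at all primes not dividing `n n'`; so
  -- almost all exponents vanish and one rational number cancels the others.
  obtain ⟨n, hn0, hn⟩ := IsFullLattice.exists_smul_le hIf.1 hO
  obtain ⟨n', hn0', hn'⟩ := IsFullLattice.exists_smul_le hO.1 hIf
  choose k hk using fun (p : ℕ) (hp : Fact p.Prime) => D.exists_isGen_typeUnit hI p
  have hk0 : ∀ (p : ℕ) (hp : Fact p.Prime), p ∉ (n * n' * N).primeFactors → k p hp = 0 := by
    intro p hp h
    have hd : ¬ p ∣ n * n' * N := fun hd =>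
      h (Nat.mem_primeFactors.2 ⟨hp.out, hd, mul_ne_zero (mul_ne_zero hn0 hn0') hN⟩)
    rw [Nat.Prime.dvd_mul hp.out, Nat.Prime.dvd_mul hp.out] at hd
    push Not at hd
    have heq : localize p I = localize p O.toAddSubgroup :=
      le_antisymm (localize_le_of_smul_mem hd.1.1 hn) (localize_le_of_smul_mem hd.1.2 hn')
    have h1 : IsGen O I p 1 := by intro z; rw [heq]; simp
    have h2 := hk p hp
    have hpS : p ∉ D.typeSet I := fun hpS =>
      hd.2 (Nat.dvd_of_mem_primeFactors (D.typeSet_subset I hpS))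
    rw [typeUnit, if_neg hpS, mul_one] at h2
    have h3 := h1.isLocalUnit h2
    rw [inv_one, one_mul] at h3
    exact (D.spec p).eq_zero_of_isLocalUnit_zpow h3
  obtain ⟨q, hq⟩ := exists_rat_of_padicVal (n * n' * N).primeFactors
    (fun p => if hp : p.Prime then - k p ⟨hp⟩ else 0) fun p hp hps => by
      simp only [dif_pos hp, hk0 p ⟨hp⟩ hps, neg_zero]
  refine ⟨q, fun p hp => ?_⟩
  have h1 := isGen_ratUnit (hk p hp) q
  rw [hq p hp.out] at h1
  simp only [dif_pos hp.out] at h1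
  rwa [← mul_assoc, ← zpow_add, neg_add_cancel, zpow_zero, one_mul] at h1

lemma exists_eq_mulRight_of_typeSet_eq (hN : N ≠ 0) (hO : IsOrder O) {I J : AddSubgroup ℍ[ℚ,a,b]}
    (hI : IsTwoSidedIdeal O I) (hJ : IsTwoSidedIdeal O J) (h : D.typeSet I = D.typeSet J) :
    ∃ q : ℚˣ, J = mulRight I (ratUnit a b q) := by
  obtain ⟨q, hq⟩ := D.exists_rat_isGen hN hO hI
  obtain ⟨r, hr⟩ := D.exists_rat_isGen hN hO hJ
  have heq : mulRight I (ratUnit a b q) = mulRight J (ratUnit a b r) := by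
    refine IsFullLattice.eq_of_localize_eq ((isTwoSidedIdeal_iff.1 hI).1.mulRight _)
      ((isTwoSidedIdeal_iff.1 hJ).1.mulRight _) fun p _ => ?_
    refine (hq p).localize_eq ?_
    rw [h]; exact hr p
  refine ⟨q * r⁻¹, ?_⟩
  rw [map_mul, Units.val_mul, ← mulRight_mul, heq, mulRight_mul, ← Units.val_mul, ← map_mul,
    mul_inv_cancel, map_one, Units.val_one, mulRight_one]

/-- Once the local scalars are normalized to `1`, the only remaining rational scalars are those that
are units at every prime. -/
lemma eq_one_or_neg_one_of_isGen {I : AddSubgroup ℍ[ℚ,a,b]} {S S' : Finset ℕ}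
    (hS : S ⊆ N.primeFactors) (hS' : S' ⊆ N.primeFactors) {q : ℚˣ}
    (h : ∀ (p : ℕ) [Fact p.Prime], IsGen O I p (D.typeUnit S p))
    (h' : ∀ (p : ℕ) [Fact p.Prime], IsGen O (mulRight I (ratUnit a b q)) p (D.typeUnit S' p)) :
    (q : ℚ) = 1 ∨ (q : ℚ) = -1 := by
  have hSS : S = S' := by
    rw [← D.typeSet_eq hS' fun p _ => ⟨0, by simpa using h' p⟩]
    exact (D.typeSet_eq hS fun p _ =>
      D.exists_isGen_mulRight (fun p _ => ⟨0, by simpa using h p⟩) q p).symm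
  subst hSS
  refine rat_eq_one_or_neg_one q.ne_zero fun p hp => ?_
  have : Fact p.Prime := ⟨hp⟩
  have h1 := (h' p).isLocalUnit (isGen_ratUnit (h p) q)
  rw [primeUnit_zpow_mul_comm, inv_mul_cancel_left] at h1
  exact (D.spec p).eq_zero_of_isLocalUnit_zpow h1

/-- The ideal is glued from the local lattices `w_p O_p` at the primes of `S` and `O_p` elsewhere;
these contain `N O_p` because `w_p⁻¹ = p^(-v) w_p`. -/
lemma exists_twoSided_of_subset (hN : N ≠ 0) (hO : IsOrder O) {S : Finset ℕ}
    (hS : S ⊆ N.primeFactors) : ∃ I, IsTwoSidedIdeal O I ∧ D.typeSet I = S := by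
  let P : ∀ (p : ℕ) [Fact p.Prime], Submodule ℤ_[p] (Compl p a b) := fun p _ =>
    (localize p O.toAddSubgroup).comap (LinearMap.mulLeft ℤ_[p]
      (((D.typeUnit S p)⁻¹ : (Compl p a b)ˣ) : Compl p a b))
  have hP : ∀ (p : ℕ) [Fact p.Prime], P p ≤ localize p O.toAddSubgroup := by
    intro p _ z hz
    have hz' : (((D.typeUnit S p)⁻¹ : (Compl p a b)ˣ) : Compl p a b) * z ∈
      localize p O.toAddSubgroup := hz
    have hmem : (D.typeUnit S p : Compl p a b) ∈ localize p O.toAddSubgroup := by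
      unfold typeUnit
      split_ifs
      · exact (D.spec p).mem
      · exact one_mem_localize O
    simpa using mul_mem_localize hmem hz'
  have hn : ∀ (p : ℕ) [Fact p.Prime], ∀ z ∈ localize p O.toAddSubgroup, (N : ℚ_[p]) • z ∈ P p := by
    intro p hp z hz
    have hNn : ‖(N : ℚ_[p])‖ ≤ 1 := by exact_mod_cast Padic.norm_int_le_one (N : ℤ)
    change (((D.typeUnit S p)⁻¹ : (Compl p a b)ˣ) : Compl p a b) * ((N : ℚ_[p]) • z) ∈
      localize p O.toAddSubgroup
    rw [mul_smul_comm, ← smul_mul_assoc]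
    refine mul_mem_localize ?_ hz
    unfold typeUnit
    split_ifs
    · have hpv : ((p : ℚ_[p]) ^ (N.factorization p)) ≠ 0 := pow_ne_zero _ padic_prime_ne_zero
      have hinv : (((D.w p)⁻¹ : (Compl p a b)ˣ) : Compl p a b) =
          ((p : ℚ_[p]) ^ (N.factorization p))⁻¹ • (D.w p : Compl p a b) := by
        rw [Units.inv_eq_of_mul_eq_one_right]
        rw [mul_smul_comm, (D.spec p).sq, Algebra.algebraMap_eq_smul_one, inv_smul_smul₀ hpv]
      rw [hinv, smul_smul]
      refine smul_mem_localize ?_ (D.spec p).mem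
      rw [norm_mul, norm_natCast_eq_factorization hN, norm_inv, Padic.norm_p_pow,
        mul_inv_cancel₀ (zpow_ne_zero _ prime_cast_pos.ne')]
    · rw [inv_one]
      exact smul_mem_localize hNn (one_mem_localize O)
  have hgen : ∀ (p : ℕ) [Fact p.Prime],
      IsGen O (latticeOfLocal O.toAddSubgroup P) p (D.typeUnit S p) := by
    intro p _ z
    rw [localize_latticeOfLocal hP hN hn]
    rfl
  refine ⟨latticeOfLocal O.toAddSubgroup P, isTwoSidedIdeal_iff.2
    ⟨isFullLattice_latticeOfLocal hO hN hn, fun p _ => ⟨_, D.normalizes_typeUnit S p, hgen p⟩⟩, ?_⟩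
  exact D.typeSet_eq hS fun p _ => ⟨0, by simpa using hgen p⟩

end LocalData

/-! ### The action of the normalizer on two-sided ideals modulo `ℚ^×` -/

/-- Two-sided ideals modulo multiplication by `ℚ^×`. -/
def twoSidedSetoid (O : Subring ℍ[ℚ,a,b]) : Setoid {I : AddSubgroup ℍ[ℚ,a,b] // IsTwoSidedIdeal O I} where
  r I J := ∃ q : ℚˣ, J.1 = mulRight I.1 (ratUnit a b q)
  iseqv :=
    { refl := fun I => ⟨1, by rw [map_one, Units.val_one, mulRight_one]⟩
      symm := by
        rintro I J ⟨q, h⟩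
        exact ⟨q⁻¹, by rw [h, mulRight_mul, ← Units.val_mul, ← map_mul, mul_inv_cancel, map_one,
          Units.val_one, mulRight_one]⟩
      trans := by
        rintro I J K ⟨q, h⟩ ⟨q', h'⟩
        exact ⟨q * q', by rw [h', h, mulRight_mul, map_mul, Units.val_mul]⟩ }

/-- The classes of two-sided ideals modulo `ℚ^×`. -/
abbrev TwoSidedMod (O : Subring ℍ[ℚ,a,b]) : Type := Quotient (twoSidedSetoid O)

lemma ratUnit_comm (q : ℚˣ) (x : (ℍ[ℚ,a,b])ˣ) : ratUnit a b q * x = x * ratUnit a b q := by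
  ext1
  rw [Units.val_mul, Units.val_mul, coe_ratUnit, Algebra.commutes]

lemma ratUnit_mem_orderNormalizer (O : Subring ℍ[ℚ,a,b]) (q : ℚˣ) :
    ratUnit a b q ∈ orderNormalizer O := by
  intro z
  rw [coe_ratUnit, Algebra.commutes, mul_assoc, ← coe_ratUnit, Units.mul_inv, mul_one]

/-- The inverse turns right multiplication into a left action. -/
instance (O : Subring ℍ[ℚ,a,b]) : MulAction (orderNormalizer O) (TwoSidedMod O) where
  smul h := Quotient.map
    (fun I => ⟨mulRight I.1 ((h⁻¹ : orderNormalizer O) : (ℍ[ℚ,a,b])ˣ), I.2.mulRight (h⁻¹).2⟩) (by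
      rintro I J ⟨q, hq⟩
      refine ⟨q, ?_⟩
      change mulRight J.1 _ = mulRight (mulRight I.1 _) _
      rw [hq, mulRight_mul, mulRight_mul, ← Units.val_mul, ← Units.val_mul, ratUnit_comm])
  one_smul t := by
    induction t using Quotient.inductionOn with
    | h I => exact congr_arg (Quotient.mk _) (Subtype.ext (by simp [mulRight_one]))
  mul_smul g h t := by
    induction t using Quotient.inductionOn with
    | h I =>
      refine congr_arg (Quotient.mk _) (Subtype.ext ?_)
      change mulRight I.1 _ = mulRight (mulRight I.1 _) _
      rw [mulRight_mul, ← Units.val_mul]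
      congr 2

lemma smul_mk_twoSided {O : Subring ℍ[ℚ,a,b]} (h : orderNormalizer O)
    (I : {I : AddSubgroup ℍ[ℚ,a,b] // IsTwoSidedIdeal O I}) :
    h • (Quotient.mk (twoSidedSetoid O) I) = Quotient.mk (twoSidedSetoid O)
      ⟨mulRight I.1 ((h⁻¹ : orderNormalizer O) : (ℍ[ℚ,a,b])ˣ), I.2.mulRight (h⁻¹).2⟩ := rfl

/-- The type is a complete invariant with values in the subsets of the set of prime divisors of `N`,
and every subset occurs. -/
lemma LocalData.card_twoSidedMod {O : Subring ℍ[ℚ,a,b]} {N : ℕ}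
    {C : ∀ (p : ℕ) [Fact p.Prime], ℍ[ℚ,a,b] → Prop} (D : LocalData O N C) (hN : N ≠ 0)
    (hO : IsOrder O) : Nat.card (TwoSidedMod O) = 2 ^ N.primeFactors.card := by
  let f : TwoSidedMod O → N.primeFactors.powerset := Quotient.lift
    (fun I => ⟨D.typeSet I.1, Finset.mem_powerset.2 (D.typeSet_subset _)⟩) (by
      rintro I J ⟨q, hq⟩
      refine Subtype.ext ?_
      change D.typeSet I.1 = D.typeSet J.1
      rw [hq, D.typeSet_mulRight I.2])
  have hf : Function.Bijective f := by
    constructor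
    · intro s t
      induction s using Quotient.inductionOn with
      | h I =>
        induction t using Quotient.inductionOn with
        | h J =>
          intro h
          exact Quotient.sound (D.exists_eq_mulRight_of_typeSet_eq hN hO I.2 J.2
            (congr_arg Subtype.val h))
    · rintro ⟨S, hS⟩
      obtain ⟨I, hI, h⟩ := D.exists_twoSided_of_subset hN hO (Finset.mem_powerset.1 hS)
      exact ⟨Quotient.mk _ ⟨I, hI⟩, Subtype.ext h⟩
  rw [Nat.card_congr (Equiv.ofBijective f hf), Nat.card_eq_fintype_card, Fintype.card_coe,
    Finset.card_powerset]

/-- An element `h` fixes the class of `I` exactly if `h⁻¹ q` is a unit of `O` for some rational `q`,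
whatever `I` is. Hence all orbits have the same size. -/
lemma stabilizer_twoSidedMod {O : Subring ℍ[ℚ,a,b]} (hO : IsOrder O) (s t : TwoSidedMod O) :
    MulAction.stabilizer (orderNormalizer O) s = MulAction.stabilizer (orderNormalizer O) t := by
  have key : ∀ (s : TwoSidedMod O) (h : orderNormalizer O), h • s = s ↔
      ∃ q : ℚˣ, (((h : (ℍ[ℚ,a,b])ˣ)⁻¹ * ratUnit a b q : (ℍ[ℚ,a,b])ˣ) : ℍ[ℚ,a,b]) ∈ O ∧
        ((((h : (ℍ[ℚ,a,b])ˣ)⁻¹ * ratUnit a b q)⁻¹ : (ℍ[ℚ,a,b])ˣ) : ℍ[ℚ,a,b]) ∈ O := by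
    intro s h
    induction s using Quotient.inductionOn with
    | h I =>
      rw [smul_mk_twoSided, Quotient.eq]
      refine exists_congr fun q => ?_
      rw [← I.2.mulRight_eq_self_iff hO]
      rw [Units.val_mul, ← mulRight_mul]
      exact eq_comm
  ext h
  rw [MulAction.mem_stabilizer_iff, MulAction.mem_stabilizer_iff, key, key]

/-- The number of two-sided ideals modulo `ℚ^×` is the number of classes of two-sided ideals
times the number of principal two-sided ideals modulo `ℚ^×`. -/
lemma card_twoSidedMod_eq_mul {O : Subring ℍ[ℚ,a,b]} (hO : IsOrder O) :
    Nat.card (TwoSidedMod O) = m O * cardPrincipal O := by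
  let t₀ : TwoSidedMod O := Quotient.mk _ ⟨O.toAddSubgroup, isTwoSidedIdeal_self hO⟩
  have h1 : Nat.card (Quotient (MulAction.orbitRel (orderNormalizer O) (TwoSidedMod O))) = m O := by
    let g : TwoSidedMod O → Quotient (leftIdealSetoid O) := Quotient.lift
      (fun I => Quotient.mk _ ⟨I.1, I.2.1⟩) (by
        rintro I J ⟨q, hq⟩
        exact Quotient.sound ⟨ratUnit a b q, hq⟩)
    have hg : ∀ s t, g s = g t ↔ MulAction.orbitRel (orderNormalizer O) (TwoSidedMod O) s t := by
      intro s t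
      induction s using Quotient.inductionOn with
      | h I =>
        induction t using Quotient.inductionOn with
        | h J =>
          rw [MulAction.orbitRel_apply, MulAction.mem_orbit_iff]
          change Quotient.mk _ _ = Quotient.mk _ _ ↔ _
          rw [eq_comm, Quotient.eq]
          constructor
          · rintro ⟨x, hx⟩
            change I.1 = mulRight J.1 x at hx
            have hxm : x ∈ orderNormalizer O := J.2.mem_orderNormalizer hO (hx ▸ I.2)
            refine ⟨⟨x, hxm⟩⁻¹, ?_⟩
            rw [smul_mk_twoSided]
            refine congr_arg (Quotient.mk _) (Subtype.ext ?_)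
            rw [hx, inv_inv]
          · rintro ⟨h, hh⟩
            rw [smul_mk_twoSided, Quotient.eq] at hh
            obtain ⟨q, hq⟩ := hh
            refine ⟨((h⁻¹ : orderNormalizer O) : (ℍ[ℚ,a,b])ˣ) * ratUnit a b q, ?_⟩
            change I.1 = _
            rw [Units.val_mul, ← mulRight_mul]
            exact hq
    let g' : Quotient (MulAction.orbitRel (orderNormalizer O) (TwoSidedMod O)) →
        {c : Quotient (leftIdealSetoid O) // ∃ I : {I : AddSubgroup ℍ[ℚ,a,b] // IsLeftIdeal O I},
          IsTwoSidedIdeal O I.1 ∧ Quotient.mk (leftIdealSetoid O) I = c} :=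
      Quotient.lift (fun t => ⟨g t, by
        induction t using Quotient.inductionOn with
        | h I => exact ⟨⟨I.1, I.2.1⟩, I.2, rfl⟩⟩) fun s t h => Subtype.ext ((hg s t).2 h)
    refine Nat.card_congr (Equiv.ofBijective g' ⟨?_, ?_⟩)
    · intro s t
      induction s using Quotient.inductionOn with
      | h s =>
        induction t using Quotient.inductionOn with
        | h t => exact fun h => Quotient.sound ((hg s t).1 (congr_arg Subtype.val h))
    · rintro ⟨c, I, hI, rfl⟩
      exact ⟨Quotient.mk _ (Quotient.mk _ ⟨I.1, hI⟩), rfl⟩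
  have h2 : Nat.card (MulAction.orbit (orderNormalizer O) t₀) = cardPrincipal O := by
    let f : Quotient (principalSetoid O) → MulAction.orbit (orderNormalizer O) t₀ :=
      Quotient.lift (fun I => ⟨Quotient.mk _ ⟨I.1, I.2.1⟩, by
        obtain ⟨x, hx⟩ := I.2.2
        have hxm : x ∈ orderNormalizer O :=
          (isTwoSidedIdeal_self hO).mem_orderNormalizer hO (hx ▸ I.2.1)
        refine ⟨⟨x, hxm⟩⁻¹, ?_⟩
        change ((⟨x, hxm⟩⁻¹ : orderNormalizer O)) • t₀ = _
        rw [smul_mk_twoSided]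
        refine congr_arg (Quotient.mk _) (Subtype.ext ?_)
        rw [hx, inv_inv]⟩) (by
        rintro I J ⟨q, hq⟩
        exact Subtype.ext (Quotient.sound ⟨q, hq⟩))
    refine (Nat.card_congr (Equiv.ofBijective f ⟨?_, ?_⟩)).symm
    · intro s t
      induction s using Quotient.inductionOn with
      | h I =>
        induction t using Quotient.inductionOn with
        | h J =>
          intro h
          obtain ⟨q, hq⟩ := Quotient.exact (congr_arg Subtype.val h)
          exact Quotient.sound ⟨q, hq⟩
    · rintro ⟨_, h, rfl⟩
      exact ⟨Quotient.mk _ ⟨_, (isTwoSidedIdeal_self hO).mulRight (h⁻¹).2, _, rfl⟩, rfl⟩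
  have h3 : Nat.card (orderNormalizer O ⧸ MulAction.stabilizer (orderNormalizer O) t₀) =
      cardPrincipal O := by
    rw [← h2]
    exact Nat.card_congr (MulAction.orbitEquivQuotientStabilizer _ _).symm
  rw [← h1, ← h3, ← Nat.card_prod]
  refine Nat.card_congr ((MulAction.selfEquivSigmaOrbitsQuotientStabilizer (orderNormalizer O)
    (TwoSidedMod O)).trans ((Equiv.sigmaCongrRight fun ω =>
      Subgroup.quotientEquivOfEq (stabilizer_twoSidedMod hO _ t₀)).trans (Equiv.sigmaEquivProd _ _)))

/-! ### Consequences of definiteness -/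

section Definite

lemma nrd_nonneg (ha : a < 0) (hb : b < 0) (x : ℍ[ℚ,a,b]) : 0 ≤ nrd x := by
  rw [nrd_eq]
  have := mul_pos_of_neg_of_neg ha hb
  nlinarith [sq_nonneg x.re, mul_nonneg (neg_nonneg.2 ha.le) (sq_nonneg x.imI),
    mul_nonneg (neg_nonneg.2 hb.le) (sq_nonneg x.imJ), mul_nonneg this.le (sq_nonneg x.imK)]

lemma eq_zero_of_nrd_eq_zero (ha : a < 0) (hb : b < 0) {x : ℍ[ℚ,a,b]} (h : nrd x = 0) : x = 0 := by
  rw [nrd_eq] at h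
  have hab := mul_pos_of_neg_of_neg ha hb
  have h0 := sq_nonneg x.re
  have h1 := mul_nonneg (neg_nonneg.2 ha.le) (sq_nonneg x.imI)
  have h2 := mul_nonneg (neg_nonneg.2 hb.le) (sq_nonneg x.imJ)
  have h3 := mul_nonneg hab.le (sq_nonneg x.imK)
  have e0 : x.re ^ 2 = 0 := by linarith
  have e1 : -a * x.imI ^ 2 = 0 := by linarith
  have e2 : -b * x.imJ ^ 2 = 0 := by linarith
  have e3 : a * b * x.imK ^ 2 = 0 := by linarith
  ext
  · simpa using e0
  · simpa [ha.ne] using e1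
  · simpa [hb.ne] using e2
  · simpa [ha.ne, hb.ne] using e3

lemma nrd_unit_ne_zero (x : (ℍ[ℚ,a,b])ˣ) : nrd (x : ℍ[ℚ,a,b]) ≠ 0 := by
  intro h
  have h1 := nrd_mul (x : ℍ[ℚ,a,b]) ((x⁻¹ : (ℍ[ℚ,a,b])ˣ) : ℍ[ℚ,a,b])
  rw [Units.mul_inv, nrd_one, h, zero_mul] at h1
  exact one_ne_zero h1

lemma exists_unit_eq {x : ℍ[ℚ,a,b]} (h : nrd x ≠ 0) : ∃ u : (ℍ[ℚ,a,b])ˣ, (u : ℍ[ℚ,a,b]) = x := by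
  refine ⟨⟨x, (nrd x)⁻¹ • star x, ?_, ?_⟩, rfl⟩
  · rw [mul_smul_comm, mul_star_eq_nrd, Algebra.algebraMap_eq_smul_one, inv_smul_smul₀ h]
  · rw [smul_mul_assoc, star_mul_eq_nrd, Algebra.algebraMap_eq_smul_one, inv_smul_smul₀ h]

/-- The quaternions with integral coordinates. -/
def integralQuaternions (a b : ℚ) : AddSubgroup ℍ[ℚ,a,b] where
  carrier := {x | ∃ r s t u : ℤ, x = ⟨r, s, t, u⟩}
  zero_mem' := ⟨0, 0, 0, 0, by ext <;> simp⟩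
  add_mem' := by
    rintro _ _ ⟨r, s, t, u, rfl⟩ ⟨r', s', t', u', rfl⟩
    exact ⟨r + r', s + s', t + t', u + u', by ext <;> simp⟩
  neg_mem' := by
    rintro _ ⟨r, s, t, u, rfl⟩
    exact ⟨-r, -s, -t, -u, by ext <;> simp⟩

lemma exists_smul_mem_integralQuaternions (x : ℍ[ℚ,a,b]) :
    ∃ n : ℕ, n ≠ 0 ∧ n • x ∈ integralQuaternions a b := by
  have hq : ∀ q : ℚ, (q.den : ℚ) * q = q.num := fun q => by
    rw [mul_comm]; exact Rat.mul_den_eq_num q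
  refine ⟨x.re.den * x.imI.den * x.imJ.den * x.imK.den, by simp,
    x.re.num * x.imI.den * x.imJ.den * x.imK.den, x.re.den * x.imI.num * x.imJ.den * x.imK.den,
    x.re.den * x.imI.den * x.imJ.num * x.imK.den, x.re.den * x.imI.den * x.imJ.den * x.imK.num, ?_⟩
  have h0 := hq x.re
  have h1 := hq x.imI
  have h2 := hq x.imJ
  have h3 := hq x.imK
  rw [← Nat.cast_smul_eq_nsmul ℚ]
  ext
  · simp only [QuaternionAlgebra.re_smul, smul_eq_mul]
    push_cast
    linear_combination (x.imI.den * x.imJ.den * x.imK.den : ℚ) * h0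
  · simp only [QuaternionAlgebra.imI_smul, smul_eq_mul]
    push_cast
    linear_combination (x.re.den * x.imJ.den * x.imK.den : ℚ) * h1
  · simp only [QuaternionAlgebra.imJ_smul, smul_eq_mul]
    push_cast
    linear_combination (x.re.den * x.imI.den * x.imK.den : ℚ) * h2
  · simp only [QuaternionAlgebra.imK_smul, smul_eq_mul]
    push_cast
    linear_combination (x.re.den * x.imI.den * x.imJ.den : ℚ) * h3

/-- After multiplication by a common denominator `D` the coordinates are integers, and each is
bounded because the norm form is positive definite and diagonal. -/
lemma finite_nrd_eq (ha : a < 0) (hb : b < 0) {I : AddSubgroup ℍ[ℚ,a,b]} (hI : I.FG) (c : ℚ) :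
    {x : ℍ[ℚ,a,b] | x ∈ I ∧ nrd x = c}.Finite := by
  have hab := mul_pos_of_neg_of_neg ha hb
  obtain ⟨D, hD0, hD⟩ := exists_smul_le_of_forall hI
    (exists_smul_mem_integralQuaternions (a := a) (b := b))
  have hD0' : (D : ℚ) ≠ 0 := by exact_mod_cast hD0
  -- The sum dominates the bounds `D² |c| / e` for the four coefficients `e = 1, -a, -b, ab`, so
  -- that one box serves all coordinates.
  obtain ⟨M, hM⟩ := exists_nat_ge ((D : ℚ) ^ 2 * c / 1 + D ^ 2 * |c| / (-a) + D ^ 2 * |c| / (-b) +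
    D ^ 2 * |c| / (a * b) + D ^ 2 * |c|)
  have hbox : ∀ e : ℚ, 0 < e → D ^ 2 * |c| / e ≤ M → ∀ z : ℤ, e * (z : ℚ) ^ 2 ≤ D ^ 2 * c →
      z ∈ Set.Icc (-(M : ℤ)) M := by
    intro e he hM z hz
    have h1 : (z : ℚ) ^ 2 ≤ M := by
      refine le_trans ?_ hM
      rw [le_div_iff₀ he, mul_comm]
      exact hz.trans (mul_le_mul_of_nonneg_left (le_abs_self c) (by positivity))
    have h2 : z ^ 2 ≤ (M : ℤ) := by exact_mod_cast h1
    rw [Set.mem_Icc]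
    constructor <;> nlinarith
  have hfin : (Set.Icc (-(M : ℤ)) M ×ˢ Set.Icc (-(M : ℤ)) M ×ˢ Set.Icc (-(M : ℤ)) M ×ˢ
      Set.Icc (-(M : ℤ)) M).Finite :=
    (Set.finite_Icc _ _).prod ((Set.finite_Icc _ _).prod ((Set.finite_Icc _ _).prod
      (Set.finite_Icc _ _)))
  refine (hfin.image (fun z => ((D : ℚ)⁻¹ • (⟨z.1, z.2.1, z.2.2.1, z.2.2.2⟩ : ℍ[ℚ,a,b])))).subset ?_
  rintro x ⟨hx, hxc⟩
  obtain ⟨r, s, t, u, h⟩ := hD x hx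
  have hx' : x = (D : ℚ)⁻¹ • (⟨r, s, t, u⟩ : ℍ[ℚ,a,b]) := by
    rw [← h, ← Nat.cast_smul_eq_nsmul ℚ, inv_smul_smul₀ hD0']
  refine ⟨(r, s, t, u), ?_, hx'.symm⟩
  have hn : D ^ 2 * c = (r : ℚ) ^ 2 + -a * (s : ℚ) ^ 2 + -b * (t : ℚ) ^ 2 + a * b * (u : ℚ) ^ 2 := by
    rw [← hxc, hx', nrd_eq]
    simp
    field_simp
    ring
  have p0 := sq_nonneg (r : ℚ)
  have p1 := mul_nonneg (neg_nonneg.2 ha.le) (sq_nonneg (s : ℚ))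
  have p2 := mul_nonneg (neg_nonneg.2 hb.le) (sq_nonneg (t : ℚ))
  have p3 := mul_nonneg hab.le (sq_nonneg (u : ℚ))
  have hc : 0 ≤ c := hxc ▸ nrd_nonneg ha hb x
  have q0 : 0 ≤ (D : ℚ) ^ 2 * c / 1 := by positivity
  have q1 : 0 ≤ (D : ℚ) ^ 2 * |c| / (-a) := div_nonneg (by positivity) (by linarith)
  have q2 : 0 ≤ (D : ℚ) ^ 2 * |c| / (-b) := div_nonneg (by positivity) (by linarith)
  have q3 : 0 ≤ (D : ℚ) ^ 2 * |c| / (a * b) := div_nonneg (by positivity) hab.le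
  have q4 : 0 ≤ (D : ℚ) ^ 2 * |c| := by positivity
  exact ⟨hbox 1 one_pos (by rw [div_one]; linarith) r (by linarith),
    hbox (-a) (by linarith) (by linarith) s (by linarith),
    hbox (-b) (by linarith) (by linarith) t (by linarith),
    hbox (a * b) hab (by linarith) u (by linarith)⟩

/-- A non-rational zero has the given polynomial as its characteristic polynomial. For a rational
zero this can fail, hence the second alternative. -/
lemma mem_zeros_iff {O : Subring ℍ[ℚ,a,b]} {n r : ℤ} {x : ℍ[ℚ,a,b]} :
    x ∈ zeros O n r ↔ x ∈ O ∧ (2 * x.re = r ∧ nrd x = n ∨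
      x.imI = 0 ∧ x.imJ = 0 ∧ x.imK = 0 ∧ x.re ^ 2 - r * x.re + n = 0) := by
  refine and_congr_right fun _ => ?_
  have hcomp : x ^ 2 - (r : ℍ[ℚ,a,b]) * x + (n : ℍ[ℚ,a,b]) = 0 ↔
      (x.re ^ 2 + a * x.imI ^ 2 + b * x.imJ ^ 2 - a * b * x.imK ^ 2 - r * x.re + n = 0 ∧
        (2 * x.re - r) * x.imI = 0 ∧ (2 * x.re - r) * x.imJ = 0 ∧ (2 * x.re - r) * x.imK = 0) := by
    rw [QuaternionAlgebra.ext_iff]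
    simp only [sq]
    simp
    refine and_congr (by ring_nf) (and_congr ?_ (and_congr ?_ ?_)) <;>
    · rw [← mul_eq_zero]
      ring_nf
  rw [hcomp, nrd_eq]
  constructor
  · rintro ⟨h0, h1, h2, h3⟩
    by_cases h : 2 * x.re - r = 0
    · left
      have hr : 2 * x.re = r := by linarith
      refine ⟨hr, ?_⟩
      rw [← hr] at h0
      linarith
    · right
      have e1 := (mul_eq_zero.1 h1).resolve_left h
      have e2 := (mul_eq_zero.1 h2).resolve_left h
      have e3 := (mul_eq_zero.1 h3).resolve_left h
      refine ⟨e1, e2, e3, ?_⟩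
      rw [e1, e2, e3] at h0
      linarith
  · rintro (⟨h1, h2⟩ | ⟨h1, h2, h3, h4⟩)
    · rw [← h1, ← h2]
      refine ⟨by ring, ?_, ?_, ?_⟩ <;> ring
    · rw [h1, h2, h3]
      refine ⟨by linarith, ?_, ?_, ?_⟩ <;> ring

/-- When the discriminant is not positive, a rational zero is a double zero, and then trace and norm
are `r` and `n` as well. -/
lemma mem_zeros_iff_of_sq_le {O : Subring ℍ[ℚ,a,b]} {n r : ℤ} (h : r ^ 2 ≤ 4 * n)
    {x : ℍ[ℚ,a,b]} : x ∈ zeros O n r ↔ x ∈ O ∧ 2 * x.re = r ∧ nrd x = n := by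
  rw [mem_zeros_iff]
  refine and_congr_right fun _ => ⟨?_, Or.inl⟩
  rintro (h1 | ⟨h1, h2, h3, h4⟩)
  · exact h1
  · have hq : (r : ℚ) ^ 2 ≤ 4 * n := by exact_mod_cast h
    have h5 : (2 * x.re - r) ^ 2 = 0 := by
      apply le_antisymm _ (sq_nonneg _)
      nlinarith
    have h6 : 2 * x.re = r := by
      have := pow_eq_zero_iff two_ne_zero |>.1 h5
      linarith
    refine ⟨h6, ?_⟩
    rw [nrd_eq, h1, h2, h3]
    rw [← h6] at h4
    linarith

lemma finite_zeros (ha : a < 0) (hb : b < 0) {O : Subring ℍ[ℚ,a,b]} (hO : IsOrder O) (n r : ℤ) :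
    (zeros O n r).Finite := by
  have h2 : {c : ℚ | c ^ 2 - r * c + n = 0}.Finite := by
    rcases Set.eq_empty_or_nonempty {c : ℚ | c ^ 2 - r * c + n = 0} with h | ⟨c₀, h₀⟩
    · rw [h]; exact Set.finite_empty
    · refine (Set.toFinite {c₀, r - c₀}).subset fun c hc => ?_
      have h1 : (c - c₀) * (c - (r - c₀)) = 0 := by
        have h3 : c ^ 2 - r * c + n = 0 := hc
        have h4 : c₀ ^ 2 - r * c₀ + n = 0 := h₀
        linear_combination h3 - h4
      rcases mul_eq_zero.1 h1 with h | h
      · left; exact sub_eq_zero.1 h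
      · right; exact sub_eq_zero.1 h
  refine ((finite_nrd_eq ha hb hO.1 n).union (h2.image fun c => (⟨c, 0, 0, 0⟩ : ℍ[ℚ,a,b]))).subset ?_
  intro x hx
  obtain ⟨hxO, ⟨-, h⟩ | ⟨h1, h2, h3, h4⟩⟩ := mem_zeros_iff.1 hx
  · exact Or.inl ⟨hxO, h⟩
  · exact Or.inr ⟨x.re, h4, by ext <;> simp [h1, h2, h3]⟩

end Definite

/-! ### Automorphisms of an order are inner in `Q` -/

section SkolemNoether

/-- Averaging: `X y`, the sum of `T(e) y e⁻¹` over `e = 1, i, j, k`, satisfies `T(z) X(y) = X(y) z`.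
Some `X y` is nonzero, and nonzero elements of a definite algebra are invertible. -/
lemma exists_intertwiner (ha : a < 0) (hb : b < 0) (T : ℍ[ℚ,a,b] →ₗ[ℚ] ℍ[ℚ,a,b]) (h1 : T 1 = 1)
    (hT : ∀ x y, T (x * y) = T x * T y) :
    ∃ u : (ℍ[ℚ,a,b])ˣ, ∀ z, T z * u = u * z := by
  let I : ℍ[ℚ,a,b] := ⟨0, 1, 0, 0⟩
  let J : ℍ[ℚ,a,b] := ⟨0, 0, 1, 0⟩
  let K : ℍ[ℚ,a,b] := ⟨0, 0, 0, 1⟩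
  have ha0 := ha.ne
  have hb0 := hb.ne
  have mulT : ∀ (x y z : ℍ[ℚ,a,b]) (c : ℚ), x * y = c • z → T x * T y = c • T z := by
    intro x y z c h
    rw [← hT, h, map_smul]
  have hII : T I * T I = a • (1 : ℍ[ℚ,a,b]) := by
    rw [← h1]; exact mulT _ _ _ _ (by ext <;> simp [I])
  have hIJ : T I * T J = (1 : ℚ) • T K := mulT _ _ _ _ (by ext <;> simp [I, J, K])
  have hIK : T I * T K = a • T J := mulT _ _ _ _ (by ext <;> simp [I, J, K])
  have hJI : T J * T I = (-1 : ℚ) • T K := mulT _ _ _ _ (by ext <;> simp [I, J, K])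
  have hJJ : T J * T J = b • (1 : ℍ[ℚ,a,b]) := by
    rw [← h1]; exact mulT _ _ _ _ (by ext <;> simp [J])
  have hJK : T J * T K = (-b) • T I := mulT _ _ _ _ (by ext <;> simp [I, J, K])
  -- The coefficients come from `i⁻¹ = i/a`, `j⁻¹ = j/b` and `k⁻¹ = -k/(ab)`.
  let X : ℍ[ℚ,a,b] → ℍ[ℚ,a,b] := fun y =>
    y + a⁻¹ • (T I * y * I) + b⁻¹ • (T J * y * J) - (a * b)⁻¹ • (T K * y * K)
  have XI : ∀ y, T I * X y = X y * I := by
    intro y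
    have e : T I * X y = T I * y + a⁻¹ • (a • (y * I)) + b⁻¹ • ((T K * y) * J) -
        (a * b)⁻¹ • (a • ((T J * y) * K)) := by
      simp only [X, mul_add, mul_sub, mul_smul_comm, ← mul_assoc, hII, hIJ, hIK, smul_mul_assoc,
        one_mul, one_smul]
    rw [e]
    simp only [X]
    generalize T I * y = P
    generalize T J * y = R
    generalize T K * y = S
    ext <;> simp [I, J, K] <;> field_simp <;> ring
  have XJ : ∀ y, T J * X y = X y * J := by
    intro y
    have e : T J * X y = T J * y + a⁻¹ • ((-1 : ℚ) • ((T K * y) * I)) + b⁻¹ • (b • (y * J)) -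
        (a * b)⁻¹ • ((-b) • ((T I * y) * K)) := by
      simp only [X, mul_add, mul_sub, mul_smul_comm, ← mul_assoc, hJI, hJJ, hJK, smul_mul_assoc,
        one_mul]
    rw [e]
    simp only [X]
    generalize T I * y = P
    generalize T J * y = R
    generalize T K * y = S
    ext <;> simp [I, J, K] <;> field_simp <;> ring
  -- The sum of `X(e) e⁻¹` is `4`: the contributions of `T(i)`, `T(j)`, `T(k)` cancel. So `X` does
  -- not vanish identically.
  have hsum : X 1 + a⁻¹ • (X I * I) + b⁻¹ • (X J * J) - (a * b)⁻¹ • (X K * K) =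
      (4 : ℚ) • (1 : ℍ[ℚ,a,b]) := by
    simp only [X]
    generalize T I = P
    generalize T J = R
    generalize T K = S
    ext <;> simp [I, J, K] <;> field_simp <;> ring
  obtain ⟨y, hy⟩ : ∃ y, X y ≠ 0 := by
    by_contra! h
    rw [h, h, h, h] at hsum
    have := congr_arg QuaternionAlgebra.re hsum
    simp at this
  obtain ⟨u, hu⟩ := exists_unit_eq (mt (eq_zero_of_nrd_eq_zero ha hb) hy)
  refine ⟨u, fun z => ?_⟩
  rw [hu]
  have hK : T K * X y = X y * K := by
    have h2 : T K = T I * T J := by rw [hIJ, one_smul]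
    have h3 : K = I * J := by ext <;> simp [I, J, K]
    rw [h2, mul_assoc, XJ, ← mul_assoc, XI, mul_assoc, ← h3]
  have hz : z = z.re • (1 : ℍ[ℚ,a,b]) + z.imI • I + z.imJ • J + z.imK • K := by
    ext <;> simp [I, J, K]
  rw [hz]
  simp only [map_add, map_smul, add_mul, mul_add, smul_mul_assoc, mul_smul_comm, XI, XJ, hK, h1,
    one_mul, mul_one]

lemma exists_linear_extension {O : Subring ℍ[ℚ,a,b]} (hO : IsOrder O) (σ : O ≃+* O) :
    ∃ T : ℍ[ℚ,a,b] →ₗ[ℚ] ℍ[ℚ,a,b], (∀ x : O, T x = σ x) ∧ ∀ x y, T (x * y) = T x * T y := by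
  obtain ⟨n, B, hB⟩ := IsFullLattice.exists_basis hO
  have hBO : ∀ i, B i ∈ O := by
    intro i
    have : B i ∈ AddSubgroup.toIntSubmodule O.toAddSubgroup := by
      rw [hB]; exact Submodule.subset_span ⟨i, rfl⟩
    exact this
  let T : ℍ[ℚ,a,b] →ₗ[ℚ] ℍ[ℚ,a,b] := B.constr ℚ fun i => (σ ⟨B i, hBO i⟩ : ℍ[ℚ,a,b])
  have hTO : ∀ x : O, T x = σ x := by
    rintro ⟨x, hx⟩
    have hx' : x ∈ Submodule.span ℤ (Set.range B) := by rw [← hB]; exact hx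
    suffices H : ∃ h : x ∈ O, T x = σ ⟨x, h⟩ from H.2
    clear hx
    induction hx' using Submodule.span_induction with
    | mem x hx =>
      obtain ⟨i, rfl⟩ := hx
      exact ⟨hBO i, B.constr_basis ℚ _ i⟩
    | zero => exact ⟨O.zero_mem, by rw [map_zero]; exact (congr_arg Subtype.val (map_zero σ)).symm⟩
    | add x y _ _ hx hy =>
      obtain ⟨h1, e1⟩ := hx
      obtain ⟨h2, e2⟩ := hy
      exact ⟨O.add_mem h1 h2, by
        rw [map_add, e1, e2]; exact (congr_arg Subtype.val (map_add σ ⟨x, h1⟩ ⟨y, h2⟩)).symm⟩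
    | smul c x _ hx =>
      obtain ⟨h1, e1⟩ := hx
      exact ⟨O.zsmul_mem h1 c, by
        rw [map_zsmul, e1]; exact (congr_arg Subtype.val (map_zsmul σ c ⟨x, h1⟩)).symm⟩
  refine ⟨T, hTO, fun x y => ?_⟩
  have hspan : ∀ x : ℍ[ℚ,a,b], x ∈ Submodule.span ℚ (O : Set ℍ[ℚ,a,b]) := by
    intro x
    have : Submodule.span ℚ (O : Set ℍ[ℚ,a,b]) = ⊤ := hO.2
    rw [this]; trivial
  -- Multiplicativity is extended from `O` to its `ℚ`-span in one factor at a time.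
  have step : ∀ x ∈ O, ∀ y, T (x * y) = T x * T y := by
    intro x hx y
    have hy := hspan y
    induction hy using Submodule.span_induction with
    | mem y hy =>
      have h1 := hTO ⟨x, hx⟩
      have h2 := hTO ⟨y, hy⟩
      have h3 := hTO (⟨x, hx⟩ * ⟨y, hy⟩)
      rw [map_mul, Subring.coe_mul, Subring.coe_mul, ← h1, ← h2] at h3
      exact h3
    | zero => simp
    | add y z _ _ hy hz => rw [mul_add, map_add, hy, hz, map_add, mul_add]
    | smul c y _ hy => rw [mul_smul_comm, map_smul, hy, map_smul, mul_smul_comm]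
  have hx := hspan x
  induction hx using Submodule.span_induction with
  | mem x hx => exact step x hx y
  | zero => simp
  | add x z _ _ hx hz => rw [add_mul, map_add, hx, hz, map_add, add_mul]
  | smul c x _ hx => rw [smul_mul_assoc, map_smul, hx, map_smul, smul_mul_assoc]

/-- Every automorphism of an order is conjugation by an element of its normalizer. -/
lemma exists_conj_eq (ha : a < 0) (hb : b < 0) {O : Subring ℍ[ℚ,a,b]} (hO : IsOrder O)
    (σ : O ≃+* O) : ∃ u ∈ orderNormalizer O, ∀ z : O,
      (σ z : ℍ[ℚ,a,b]) = (u : ℍ[ℚ,a,b]) * z * ((u⁻¹ : (ℍ[ℚ,a,b])ˣ) : ℍ[ℚ,a,b]) := by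
  obtain ⟨T, hTO, hT⟩ := exists_linear_extension hO σ
  have h1 : T 1 = 1 := by
    have := hTO 1
    rw [map_one] at this
    exact this
  obtain ⟨u, hu⟩ := exists_intertwiner ha hb T h1 hT
  have key : ∀ z : O, (σ z : ℍ[ℚ,a,b]) =
      (u : ℍ[ℚ,a,b]) * z * ((u⁻¹ : (ℍ[ℚ,a,b])ˣ) : ℍ[ℚ,a,b]) := by
    intro z
    rw [← hTO, ← hu, Units.mul_inv_cancel_right]
  refine ⟨u, fun z => ⟨fun h => ?_, fun h => ?_⟩, key⟩
  · have h2 := key (σ.symm ⟨_, h⟩)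
    rw [RingEquiv.apply_symm_apply] at h2
    have h3 : z = (σ.symm ⟨_, h⟩ : O) := by
      have h4 : (u : ℍ[ℚ,a,b]) * z * ((u⁻¹ : (ℍ[ℚ,a,b])ˣ) : ℍ[ℚ,a,b]) = _ := h2
      rwa [Units.mul_left_inj, Units.mul_right_inj] at h4
    rw [h3]; exact Subtype.prop _
  · rw [← key ⟨z, h⟩]; exact Subtype.prop _

end SkolemNoether

/-- Because `k ≠ 0` the fibres are genuinely finite, which `Nat.card` alone would not guarantee. -/
lemma card_eq_mul_of_card_fiber {X Y : Type*} {f : X → Y} {k : ℕ} (hk : k ≠ 0)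
    (hf : ∀ y, Nat.card {x // f x = y} = k) : Nat.card X = k * Nat.card Y := by
  have e : ∀ y, Nonempty ({x // f x = y} ≃ Fin k) := fun y => by
    have : Finite {x // f x = y} := Nat.finite_of_card_ne_zero (by rw [hf]; exact hk)
    exact ⟨Finite.equivFinOfCardEq (hf y)⟩
  rw [Nat.card_congr ((Equiv.sigmaFiberEquiv f).symm.trans ((Equiv.sigmaCongrRight fun y =>
    (e y).some).trans (Equiv.sigmaEquivProd _ _))), Nat.card_prod, Nat.card_fin, mul_comm]

/-! ### Normalized generators of principal two-sided ideals -/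

namespace LocalData

variable {O : Subring ℍ[ℚ,a,b]} {N : ℕ} {C : ∀ (p : ℕ) [Fact p.Prime], ℍ[ℚ,a,b] → Prop}

/-- The `x ∈ Q^×` that generate a two-sided ideal `O x` and are, at every prime, a unit or a unit
times the generator of the local normalizer. -/
def primitiveSet (D : LocalData O N C) : Set (ℍ[ℚ,a,b])ˣ :=
  {x | IsTwoSidedIdeal O (mulRight O.toAddSubgroup x) ∧ ∃ S ⊆ N.primeFactors,
    ∀ (p : ℕ) [Fact p.Prime], IsGen O (mulRight O.toAddSubgroup x) p (D.typeUnit S p)}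

variable (D : LocalData O N C)

lemma mem_orderNormalizer_of_mem_primitiveSet (hO : IsOrder O) {x : (ℍ[ℚ,a,b])ˣ}
    (hx : x ∈ D.primitiveSet) : x ∈ orderNormalizer O :=
  (isTwoSidedIdeal_self hO).mem_orderNormalizer hO hx.1

lemma isGen_mulRight_self {x : (ℍ[ℚ,a,b])ˣ} {p : ℕ} [Fact p.Prime]
    (hx : Normalizes (localize p O.toAddSubgroup) (toComplUnits p x)) :
    IsGen O (mulRight O.toAddSubgroup x) p (toComplUnits p x) := by
  have h := (isGen_one (p := p) O).mulRight hx
  rwa [one_mul] at h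

/-- This makes membership a condition on `x` at each prime separately; the set `S` is recovered as
the set of primes where the second alternative holds. -/
lemma mem_primitiveSet_iff (hO : IsOrder O) {x : (ℍ[ℚ,a,b])ˣ} :
    x ∈ D.primitiveSet ↔ ∀ (p : ℕ) [Fact p.Prime],
      IsLocalUnit (localize p O.toAddSubgroup) (toComplUnits p x) ∨ p ∈ N.primeFactors ∧
        ∃ u, IsLocalUnit (localize p O.toAddSubgroup) u ∧ toComplUnits p x = D.w p * u := by
  classical
  constructor
  · intro hx p _
    have hg := isGen_mulRight_self
      (normalizes_toComplUnits (D.mem_orderNormalizer_of_mem_primitiveSet hO hx) p)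
    obtain ⟨-, S, hS, h⟩ := hx
    have hu := (h p).isLocalUnit hg
    unfold typeUnit at hu
    split_ifs at hu with hp
    · exact Or.inr ⟨hS hp, _, hu, by simp⟩
    · left
      simpa using hu
  · intro h
    have hn : ∀ (p : ℕ) [Fact p.Prime],
        Normalizes (localize p O.toAddSubgroup) (toComplUnits p x) := by
      intro p _
      obtain hu | ⟨-, u, hu, h⟩ := h p
      · exact hu.normalizes
      · rw [h]; exact (D.spec p).normalizes.mul hu.normalizes
    refine ⟨(isTwoSidedIdeal_self hO).mulRight (mem_orderNormalizer_of_forall hO hn),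
      N.primeFactors.filter fun p => ∃ _ : Fact p.Prime,
        ∃ u, IsLocalUnit (localize p O.toAddSubgroup) u ∧ toComplUnits p x = D.w p * u,
      Finset.filter_subset _ _, fun p hp => ?_⟩
    have hg := isGen_mulRight_self (hn p)
    unfold typeUnit
    split_ifs with hpS
    · obtain ⟨-, _, u, hu, h⟩ := Finset.mem_filter.1 hpS
      have h1 := hg.mul_unit hu.inv
      rwa [h, mul_inv_cancel_right] at h1
    · obtain hu | ⟨hpN, u, hu, h⟩ := h p
      · have h1 := hg.mul_unit hu.inv
        rwa [mul_inv_cancel] at h1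
      · exact absurd (Finset.mem_filter.2 ⟨hpN, hp, u, hu, h⟩) hpS

lemma exists_mul_ratUnit_mem_primitiveSet (hN : N ≠ 0) (hO : IsOrder O) {x : (ℍ[ℚ,a,b])ˣ}
    (hx : x ∈ orderNormalizer O) : ∃ q : ℚˣ, x * ratUnit a b q ∈ D.primitiveSet := by
  have hI := (isTwoSidedIdeal_self hO).mulRight hx
  obtain ⟨q, hq⟩ := D.exists_rat_isGen hN hO hI
  refine ⟨q, ?_, D.typeSet (mulRight O.toAddSubgroup x), D.typeSet_subset _, ?_⟩
  · exact (isTwoSidedIdeal_self hO).mulRight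
      (mul_mem hx (ratUnit_mem_orderNormalizer O q))
  · rw [Units.val_mul, ← mulRight_mul]
    exact hq

lemma eq_one_or_neg_one_of_mem_primitiveSet {x y : (ℍ[ℚ,a,b])ˣ} (hx : x ∈ D.primitiveSet)
    (hy : y ∈ D.primitiveSet) {q : ℚˣ}
    (h : mulRight O.toAddSubgroup y = mulRight (mulRight O.toAddSubgroup x) (ratUnit a b q)) :
    (q : ℚ) = 1 ∨ (q : ℚ) = -1 := by
  obtain ⟨-, S, hS, hx⟩ := hx
  obtain ⟨-, S', hS', hy⟩ := hy
  rw [h] at hy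
  exact D.eq_one_or_neg_one_of_isGen hS hS' hx hy

lemma mem_primitiveSet_of_mulRight_eq {x y : (ℍ[ℚ,a,b])ˣ} (hx : x ∈ D.primitiveSet)
    (h : mulRight O.toAddSubgroup y = mulRight O.toAddSubgroup x) : y ∈ D.primitiveSet := by
  refine ⟨?_, ?_⟩ <;> rw [h]
  exacts [hx.1, hx.2]

lemma mulRight_ratUnit_eq_self (I : AddSubgroup ℍ[ℚ,a,b]) {q : ℚˣ}
    (hq : (q : ℚ) = 1 ∨ (q : ℚ) = -1) : mulRight I (ratUnit a b q) = I := by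
  rw [coe_ratUnit]
  obtain hq | hq := hq
  · rw [hq, map_one, mulRight_one]
  · rw [hq, map_neg, map_one]
    ext z
    rw [mulRight, AddSubgroup.mem_map]
    constructor
    · rintro ⟨y, hy, rfl⟩
      simpa using hy
    · intro hz
      exact ⟨-z, neg_mem hz, by simp⟩

end LocalData

lemma map_units_inv_mem {O : Subring ℍ[ℚ,a,b]} (u : Oˣ) :
    (Units.map O.subtype.toMonoidHom u : ℍ[ℚ,a,b]) ∈ O ∧
      (((Units.map O.subtype.toMonoidHom u)⁻¹ : (ℍ[ℚ,a,b])ˣ) : ℍ[ℚ,a,b]) ∈ O := by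
  rw [← map_inv]
  exact ⟨(u : O).2, ((u⁻¹ : Oˣ) : O).2⟩

lemma exists_map_units_eq {O : Subring ℍ[ℚ,a,b]} {x : (ℍ[ℚ,a,b])ˣ} (h : (x : ℍ[ℚ,a,b]) ∈ O)
    (h' : ((x⁻¹ : (ℍ[ℚ,a,b])ˣ) : ℍ[ℚ,a,b]) ∈ O) :
    ∃ u : Oˣ, Units.map O.subtype.toMonoidHom u = x :=
  ⟨⟨⟨x, h⟩, ⟨_, h'⟩, Subtype.ext (Units.mul_inv x), Subtype.ext (Units.inv_mul x)⟩, Units.ext rfl⟩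

lemma map_units_injective (O : Subring ℍ[ℚ,a,b]) :
    Function.Injective (Units.map (O.subtype : O →* ℍ[ℚ,a,b])) := fun _ _ h =>
  Units.ext (Subtype.ext (congr_arg Units.val h))

namespace LocalData

variable {O : Subring ℍ[ℚ,a,b]} {N : ℕ} {C : ∀ (p : ℕ) [Fact p.Prime], ℍ[ℚ,a,b] → Prop}
  (D : LocalData O N C)

/-- The reduced norm of a unit is a unit at every prime and nonnegative, hence `1`, and finitely
many elements of `O` have norm `1`. -/
lemma finite_units (D : LocalData O N C) (ha : a < 0) (hb : b < 0) (hO : IsOrder O) : Finite Oˣ := by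
  have hfin := finite_nrd_eq ha hb hO.1 1
  have hn : ∀ u : Oˣ, nrd ((u : O) : ℍ[ℚ,a,b]) = 1 := by
    intro u
    obtain ⟨h1, h2⟩ := map_units_inv_mem u
    set x := Units.map O.subtype.toMonoidHom u with hx
    change nrd (x : ℍ[ℚ,a,b]) = 1
    have h0 := nrd_unit_ne_zero x
    have hv : ∀ p : ℕ, p.Prime → padicValRat p (nrd (x : ℍ[ℚ,a,b])) = 0 := by
      intro p hp
      have : Fact p.Prime := ⟨hp⟩
      rw [← norm_ratCast_eq_iff h0, neg_zero, zpow_zero,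
        ← (D.spec p).isLocalUnit_iff x (toCompl_mem_localize h1)]
      refine ⟨toCompl_mem_localize h1, ?_⟩
      rw [← map_inv]
      exact toCompl_mem_localize h2
    obtain h | h := rat_eq_one_or_neg_one h0 hv
    · exact h
    · have := nrd_nonneg ha hb (x : ℍ[ℚ,a,b])
      rw [h] at this
      norm_num at this
  have : Finite {x : ℍ[ℚ,a,b] | x ∈ O.toAddSubgroup ∧ nrd x = 1} := hfin
  let f : Oˣ → {x : ℍ[ℚ,a,b] | x ∈ O.toAddSubgroup ∧ nrd x = 1} := fun u => ⟨(u : O), (u : O).2, hn u⟩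
  have hf : Function.Injective f := fun u v h =>
    Units.ext (Subtype.ext (show f u = (f v : ℍ[ℚ,a,b]) from congr_arg Subtype.val h))
  exact Finite.of_injective f hf

lemma card_units_ne_zero (D : LocalData O N C) (ha : a < 0) (hb : b < 0) (hO : IsOrder O) : Nat.card Oˣ ≠ 0 := by
  have := D.finite_units ha hb hO
  exact Nat.card_pos.ne'

/-- The fibre of `x ↦ O x` modulo `ℚ^×` through `x` is `O^× x`: normalized generators of
proportional ideals generate the same ideal, since the rational factor can only be `1` or `-1`. -/
lemma card_primitiveSet_eq_card_units_mul (ha : a < 0) (hb : b < 0) (hN : N ≠ 0) (hO : IsOrder O) :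
    Nat.card D.primitiveSet = Nat.card Oˣ * cardPrincipal O := by
  let f : D.primitiveSet → Quotient (principalSetoid O) := fun x =>
    Quotient.mk _ ⟨mulRight O.toAddSubgroup (x : (ℍ[ℚ,a,b])ˣ), x.2.1, _, rfl⟩
  have hf : Function.Surjective f := by
    intro t
    induction t using Quotient.inductionOn with
    | h I =>
      obtain ⟨I, hI, x, rfl⟩ := I
      obtain ⟨q, hq⟩ := D.exists_mul_ratUnit_mem_primitiveSet hN hO
        ((isTwoSidedIdeal_self hO).mem_orderNormalizer hO hI)
      refine ⟨⟨_, hq⟩, Eq.symm (Quotient.sound ?_)⟩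
      refine ⟨q, ?_⟩
      change mulRight _ _ = mulRight (mulRight _ _) _
      rw [mulRight_mul, Units.val_mul, coe_ratUnit]
  have hunit : ∀ (u : Oˣ) (x : (ℍ[ℚ,a,b])ˣ), mulRight O.toAddSubgroup
      ((Units.map O.subtype.toMonoidHom u * x : (ℍ[ℚ,a,b])ˣ) : ℍ[ℚ,a,b]) =
        mulRight O.toAddSubgroup x := by
    intro u x
    rw [Units.val_mul, ← mulRight_mul,
      ((isTwoSidedIdeal_self hO).mulRight_eq_self_iff hO _).2 (map_units_inv_mem u)]
  refine card_eq_mul_of_card_fiber (f := f) (D.card_units_ne_zero ha hb hO) fun t => ?_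
  obtain ⟨x, rfl⟩ := hf t
  refine (Nat.card_congr (Equiv.ofBijective (fun u : Oˣ =>
    (⟨⟨Units.map O.subtype.toMonoidHom u * x, D.mem_primitiveSet_of_mulRight_eq x.2 (hunit u x)⟩,
      congr_arg (Quotient.mk _) (Subtype.ext (hunit u x))⟩ : {y // f y = f x})) ⟨?_, ?_⟩)).symm
  · intro u v h
    have h1 : Units.map O.subtype.toMonoidHom u * (x : (ℍ[ℚ,a,b])ˣ) =
      Units.map O.subtype.toMonoidHom v * x := congr_arg (fun y => (y.1.1 : (ℍ[ℚ,a,b])ˣ)) h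
    exact map_units_injective O (mul_right_cancel h1)
  · rintro ⟨y, hy⟩
    obtain ⟨q, hq⟩ := Quotient.exact hy
    change mulRight O.toAddSubgroup ((x : (ℍ[ℚ,a,b])ˣ) : ℍ[ℚ,a,b]) =
      mulRight (mulRight O.toAddSubgroup ((y : (ℍ[ℚ,a,b])ˣ) : ℍ[ℚ,a,b])) (ratUnit a b q) at hq
    rw [mulRight_ratUnit_eq_self _ (D.eq_one_or_neg_one_of_mem_primitiveSet y.2 x.2 hq)] at hq
    have h1 : mulRight O.toAddSubgroup (((y : (ℍ[ℚ,a,b])ˣ) * (x : (ℍ[ℚ,a,b])ˣ)⁻¹ :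
        (ℍ[ℚ,a,b])ˣ) : ℍ[ℚ,a,b]) = O.toAddSubgroup := by
      rw [Units.val_mul, ← mulRight_mul, ← hq, mulRight_mul, Units.mul_inv, mulRight_one]
    obtain ⟨h2, h3⟩ := ((isTwoSidedIdeal_self hO).mulRight_eq_self_iff hO _).1 h1
    obtain ⟨u, hu⟩ := exists_map_units_eq h2 h3
    refine ⟨u, Subtype.ext (Subtype.ext ?_)⟩
    change Units.map O.subtype.toMonoidHom u * (x : (ℍ[ℚ,a,b])ˣ) = y
    rw [hu, inv_mul_cancel_right]

end LocalData

/-! ### Counting automorphisms -/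

section Automorphisms

/-- Conjugation of `O` by an element of its normalizer. -/
def conjAut {O : Subring ℍ[ℚ,a,b]} (x : orderNormalizer O) : O ≃+* O where
  toFun z := ⟨((x : (ℍ[ℚ,a,b])ˣ) : ℍ[ℚ,a,b]) * z * (((x : (ℍ[ℚ,a,b])ˣ)⁻¹ : (ℍ[ℚ,a,b])ˣ) : ℍ[ℚ,a,b]),
    (x.2 z).2 z.2⟩
  invFun z := ⟨(((x : (ℍ[ℚ,a,b])ˣ)⁻¹ : (ℍ[ℚ,a,b])ˣ) : ℍ[ℚ,a,b]) * z * ((x : (ℍ[ℚ,a,b])ˣ) : ℍ[ℚ,a,b]),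
    (x.2 _).1 (by simp only [mul_assoc, Units.mul_inv, mul_one, Units.mul_inv_cancel_left]; exact z.2)⟩
  left_inv z := Subtype.ext (by simp [mul_assoc])
  right_inv z := Subtype.ext (by simp [mul_assoc])
  map_mul' y z := Subtype.ext (by simp [mul_assoc])
  map_add' y z := Subtype.ext (by simp [mul_add, add_mul])

lemma coe_conjAut {O : Subring ℍ[ℚ,a,b]} (x : orderNormalizer O) (z : O) :
    (conjAut x z : ℍ[ℚ,a,b]) = ((x : (ℍ[ℚ,a,b])ˣ) : ℍ[ℚ,a,b]) * z *
      (((x : (ℍ[ℚ,a,b])ˣ)⁻¹ : (ℍ[ℚ,a,b])ˣ) : ℍ[ℚ,a,b]) := rfl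

/-- `O` spans `Q`, so an element commuting with `O` lies in the centre of `Q`, which is `ℚ`. -/
lemma exists_ratUnit_eq_of_comm (ha : a ≠ 0) {O : Subring ℍ[ℚ,a,b]} (hO : IsOrder O)
    {y : (ℍ[ℚ,a,b])ˣ} (h : ∀ z ∈ O, (y : ℍ[ℚ,a,b]) * z = z * y) : ∃ q : ℚˣ, y = ratUnit a b q := by
  have hall : ∀ z : ℍ[ℚ,a,b], (y : ℍ[ℚ,a,b]) * z = z * y := by
    intro z
    have hz : z ∈ Submodule.span ℚ (O : Set ℍ[ℚ,a,b]) := by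
      have h1 : Submodule.span ℚ (O : Set ℍ[ℚ,a,b]) = ⊤ := hO.2
      rw [h1]; trivial
    induction hz using Submodule.span_induction with
    | mem z hz => exact h z hz
    | zero => simp
    | add z w _ _ hz hw => rw [mul_add, add_mul, hz, hw]
    | smul c z _ hz => rw [mul_smul_comm, smul_mul_assoc, hz]
  have hI := hall ⟨0, 1, 0, 0⟩
  have hJ := hall ⟨0, 0, 1, 0⟩
  have h1 := congr_arg QuaternionAlgebra.imK hI
  have h2 := congr_arg QuaternionAlgebra.imJ hI
  have h3 := congr_arg QuaternionAlgebra.imK hJ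
  simp at h1 h2 h3
  have e1 : (y : ℍ[ℚ,a,b]).imI = 0 := by linarith
  have e2 : (y : ℍ[ℚ,a,b]).imJ = 0 := by linarith
  have e3 : (y : ℍ[ℚ,a,b]).imK = 0 := by
    have : a * (y : ℍ[ℚ,a,b]).imK = 0 := by linarith
    exact (mul_eq_zero.1 this).resolve_left ha
  have hy : (y : ℍ[ℚ,a,b]) = algebraMap ℚ _ (y : ℍ[ℚ,a,b]).re := by
    ext <;> simp [e1, e2, e3]
  have h0 : (y : ℍ[ℚ,a,b]).re ≠ 0 := by
    intro h
    rw [h, map_zero] at hy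
    exact y.ne_zero hy
  exact ⟨Units.mk0 _ h0, Units.ext hy⟩

variable {O : Subring ℍ[ℚ,a,b]} {N : ℕ} {C : ∀ (p : ℕ) [Fact p.Prime], ℍ[ℚ,a,b] → Prop}

/-- Elements inducing the same conjugation differ by a rational factor, which for two normalized
elements is `1` or `-1`; so the fibres are the pairs `x, -x`. -/
lemma LocalData.card_primitiveSet_eq_two_mul (D : LocalData O N C) (ha : a < 0) (hb : b < 0)
    (hN : N ≠ 0) (hO : IsOrder O) : Nat.card D.primitiveSet = 2 * Nat.card (O ≃+* O) := by
  let f : D.primitiveSet → (O ≃+* O) := fun x =>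
    conjAut ⟨x, D.mem_orderNormalizer_of_mem_primitiveSet hO x.2⟩
  have hconj : ∀ (x y : orderNormalizer O) (q : ℚˣ),
      (y : (ℍ[ℚ,a,b])ˣ) = (x : (ℍ[ℚ,a,b])ˣ) * ratUnit a b q → conjAut y = conjAut x := by
    intro x y q h
    refine RingEquiv.ext fun z => Subtype.ext ?_
    rw [coe_conjAut, coe_conjAut, h, mul_inv_rev, Units.val_mul, Units.val_mul]
    simp only [mul_assoc]
    rw [← mul_assoc _ (z : ℍ[ℚ,a,b]), coe_ratUnit, Algebra.commutes]
    simp only [mul_assoc]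
    rw [← coe_ratUnit, Units.mul_inv_cancel_left]
  have hf : Function.Surjective f := by
    intro σ
    obtain ⟨u, hu, h⟩ := exists_conj_eq ha hb hO σ
    obtain ⟨q, hq⟩ := D.exists_mul_ratUnit_mem_primitiveSet hN hO hu
    refine ⟨⟨_, hq⟩, ?_⟩
    change conjAut _ = _
    rw [hconj ⟨u, hu⟩ _ q rfl]
    exact RingEquiv.ext fun z => Subtype.ext (h z).symm
  refine card_eq_mul_of_card_fiber (f := f) two_ne_zero fun t => ?_
  obtain ⟨x, rfl⟩ := hf t
  have hneg : (x : (ℍ[ℚ,a,b])ˣ) * ratUnit a b (-1) ∈ D.primitiveSet := by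
    refine D.mem_primitiveSet_of_mulRight_eq x.2 ?_
    rw [Units.val_mul, ← mulRight_mul, mulRight_ratUnit_eq_self _ (Or.inr rfl)]
  rw [Nat.card_eq_two_iff]
  refine ⟨⟨x, rfl⟩, ⟨⟨_, hneg⟩, hconj _ _ _ rfl⟩, ?_, ?_⟩
  · intro h
    have h1 : (x : (ℍ[ℚ,a,b])ˣ) = x * ratUnit a b (-1) :=
      congr_arg (fun y => (y.1.1 : (ℍ[ℚ,a,b])ˣ)) h
    have h2 := congr_arg (fun y : (ℍ[ℚ,a,b])ˣ => (y : ℍ[ℚ,a,b]).re) (left_eq_mul.1 h1)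
    simp at h2
    norm_num at h2
  · refine Set.eq_univ_of_forall ?_
    rintro ⟨y, hy⟩
    have hxy : ∀ z ∈ O, ((((x : (ℍ[ℚ,a,b])ˣ)⁻¹ * y : (ℍ[ℚ,a,b])ˣ)) : ℍ[ℚ,a,b]) * z =
        z * (((x : (ℍ[ℚ,a,b])ˣ)⁻¹ * y : (ℍ[ℚ,a,b])ˣ)) := by
      intro z hz
      have h1 := congr_arg Subtype.val (RingEquiv.congr_fun hy ⟨z, hz⟩)
      change ((y : (ℍ[ℚ,a,b])ˣ) : ℍ[ℚ,a,b]) * z * _ = ((x : (ℍ[ℚ,a,b])ˣ) : ℍ[ℚ,a,b]) * z * _ at h1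
      rw [Units.mul_inv_eq_iff_eq_mul] at h1
      rw [Units.val_mul, mul_assoc, h1]
      simp only [mul_assoc, Units.inv_mul_cancel_left]
    obtain ⟨q, hq⟩ := exists_ratUnit_eq_of_comm ha.ne hO hxy
    rw [inv_mul_eq_iff_eq_mul] at hq
    have hq1 := D.eq_one_or_neg_one_of_mem_primitiveSet x.2 y.2 (q := q) (by
      rw [hq, Units.val_mul, mulRight_mul])
    rw [Set.mem_insert_iff, Set.mem_singleton_iff, Subtype.ext_iff, Subtype.ext_iff,
      Subtype.ext_iff, Subtype.ext_iff]
    change (y : (ℍ[ℚ,a,b])ˣ) = x ∨ (y : (ℍ[ℚ,a,b])ˣ) = x * ratUnit a b (-1)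
    rw [hq]
    obtain h | h := hq1
    · left
      rw [Units.ext (v := 1) h, map_one, mul_one]
    · right
      rw [Units.ext (v := -1) h]

end Automorphisms

/-! ### Normalized generators as zeros of quadratic polynomials -/

lemma mem_exactDivisors_iff {N n : ℕ} (hN : N ≠ 0) :
    n ∈ exactDivisors N ↔ n ≠ 0 ∧
      ∀ p : ℕ, p.Prime → n.factorization p = 0 ∨ n.factorization p = N.factorization p := by
  rw [exactDivisors, Finset.mem_filter, Nat.mem_divisors]
  constructor
  · rintro ⟨⟨⟨k, rfl⟩, -⟩, hc⟩
    have hn0 : n ≠ 0 := left_ne_zero_of_mul hN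
    have hk0 : k ≠ 0 := right_ne_zero_of_mul hN
    rw [Nat.mul_div_cancel_left k (Nat.pos_of_ne_zero hn0)] at hc
    refine ⟨hn0, fun p hp => ?_⟩
    by_cases hpn : p ∣ n
    · right
      have hpk : ¬ p ∣ k := fun h => Nat.Prime.not_coprime_iff_dvd.2 ⟨p, hp, hpn, h⟩ hc
      rw [Nat.factorization_mul hn0 hk0, Finsupp.add_apply,
        Nat.factorization_eq_zero_of_not_dvd hpk, add_zero]
    · exact Or.inl (Nat.factorization_eq_zero_of_not_dvd hpn)
  · rintro ⟨hn0, h⟩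
    have hdvd : n ∣ N := by
      rw [← Nat.factorization_le_iff_dvd hn0 hN]
      intro p
      by_cases hp : p.Prime
      · rcases h p hp with h | h <;> omega
      · rw [Nat.factorization_eq_zero_of_not_prime _ hp]; exact Nat.zero_le _
    refine ⟨⟨hdvd, hN⟩, ?_⟩
    obtain ⟨k, rfl⟩ := hdvd
    have hk0 : k ≠ 0 := right_ne_zero_of_mul hN
    rw [Nat.mul_div_cancel_left k (Nat.pos_of_ne_zero hn0)]
    by_contra hc
    obtain ⟨p, hp, h1, h2⟩ := Nat.Prime.not_coprime_iff_dvd.1 hc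
    have h3 := hp.factorization_pos_of_dvd hn0 h1
    have h4 := hp.factorization_pos_of_dvd hk0 h2
    have h5 := h p hp
    rw [Nat.factorization_mul hn0 hk0, Finsupp.add_apply] at h5
    omega

lemma exists_int_mul_eq {n : ℕ} (hn : n ≠ 0) {t : ℚ}
    (h : ∀ (p : ℕ) [Fact p.Prime], ‖(t : ℚ_[p])‖ ≤ ‖(n : ℚ_[p])‖) : ∃ z : ℤ, t = n * z := by
  have hn0 : (n : ℚ) ≠ 0 := by exact_mod_cast hn
  obtain ⟨z, hz⟩ := rat_isInt_of_forall_norm_le (q := t / n) fun p _ => by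
    have hnp : (0 : ℝ) < ‖(n : ℚ_[p])‖ := norm_pos_iff.2 (by exact_mod_cast hn)
    rw [Rat.cast_div, norm_div, Rat.cast_natCast, div_le_one hnp]
    exact h p
  exact ⟨z, by rw [hz]; field_simp⟩

/-- Definiteness makes the discriminant of the characteristic polynomial nonpositive; hence the
range of `r` in the sum. -/
lemma sq_le_four_mul_nrd (ha : a < 0) (hb : b < 0) (x : ℍ[ℚ,a,b]) : (2 * x.re) ^ 2 ≤ 4 * nrd x := by
  rw [nrd_eq]
  have hab := mul_pos_of_neg_of_neg ha hb
  nlinarith [mul_nonneg (neg_nonneg.2 ha.le) (sq_nonneg x.imI),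
    mul_nonneg (neg_nonneg.2 hb.le) (sq_nonneg x.imJ), mul_nonneg hab.le (sq_nonneg x.imK)]

namespace LocalData

variable {O : Subring ℍ[ℚ,a,b]} {N : ℕ} {C : ∀ (p : ℕ) [Fact p.Prime], ℍ[ℚ,a,b] → Prop}
  (D : LocalData O N C)

lemma mem_primitiveSet_iff_norm (hO : IsOrder O) {x : (ℍ[ℚ,a,b])ˣ} :
    x ∈ D.primitiveSet ↔ (x : ℍ[ℚ,a,b]) ∈ O ∧ ∀ (p : ℕ) [Fact p.Prime],
      ‖(nrd (x : ℍ[ℚ,a,b]) : ℚ_[p])‖ = 1 ∨ p ∈ N.primeFactors ∧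
        ‖(nrd (x : ℍ[ℚ,a,b]) : ℚ_[p])‖ = (p : ℝ) ^ (-(N.factorization p) : ℤ) ∧
        ‖((2 * (x : ℍ[ℚ,a,b]).re : ℚ) : ℚ_[p])‖ ≤ (p : ℝ) ^ (-(N.factorization p) : ℤ) ∧
        C p x := by
  rw [D.mem_primitiveSet_iff hO]
  constructor
  · intro h
    have hx : ∀ (p : ℕ) [Fact p.Prime], toCompl p (x : ℍ[ℚ,a,b]) ∈ localize p O.toAddSubgroup := by
      intro p _
      rw [← coe_toComplUnits]
      obtain hu | ⟨-, u, hu, h⟩ := h p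
      · exact hu.1
      · rw [h, Units.val_mul]
        exact mul_mem_localize (D.spec p).mem hu.1
    refine ⟨(IsFullLattice.mem_iff hO _).2 hx, fun p _ => ?_⟩
    refine (h p).imp ((D.spec p).isLocalUnit_iff x (hx p)).1 fun ⟨hp, h⟩ => ⟨hp, ?_⟩
    exact ((D.spec p).corner_iff (factorization_pos hp) x (hx p)).2 h
  · rintro ⟨hx, h⟩ p _
    have hxp := toCompl_mem_localize (p := p) (show (x : ℍ[ℚ,a,b]) ∈ O.toAddSubgroup from hx)
    refine (h p).imp ((D.spec p).isLocalUnit_iff x hxp).2 fun ⟨hp, h⟩ => ⟨hp, ?_⟩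
    exact ((D.spec p).corner_iff (factorization_pos hp) x hxp).1 h

/-- Globally, a norm whose valuation at each `p` is `0` or that of `N` is an exact divisor `n` of
`N`, and the local bounds on the trace together say `n ∣ r`. -/
lemma mem_primitiveSet_iff_exists (ha : a < 0) (hb : b < 0) (hN : N ≠ 0) (hO : IsOrder O)
    {x : (ℍ[ℚ,a,b])ˣ} :
    x ∈ D.primitiveSet ↔ ∃ n ∈ exactDivisors N, ∃ r ∈ traceRange n,
      (x : ℍ[ℚ,a,b]) ∈ zeros O n r ∧ ∀ (p : ℕ) [Fact p.Prime], 0 < N.factorization p →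
        padicValRat p (nrd (x : ℍ[ℚ,a,b])) = N.factorization p → C p x := by
  have h0 := nrd_unit_ne_zero x
  rw [D.mem_primitiveSet_iff_norm hO]
  constructor
  · rintro ⟨hx, h⟩
    have hxp : ∀ (p : ℕ) [Fact p.Prime], toCompl p (x : ℍ[ℚ,a,b]) ∈ localize p O.toAddSubgroup :=
      fun p _ => toCompl_mem_localize (show (x : ℍ[ℚ,a,b]) ∈ O.toAddSubgroup from hx)
    obtain ⟨z, hz⟩ := rat_isInt_of_forall_norm_le fun p _ => ((D.spec p).norm_le _ (hxp p)).1
    have hz0 : 0 ≤ z := by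
      have := nrd_nonneg ha hb (x : ℍ[ℚ,a,b])
      rw [← hz] at this
      exact_mod_cast this
    obtain ⟨n, rfl⟩ := Int.eq_ofNat_of_zero_le hz0
    rw [Int.cast_natCast] at hz
    have hn0 : n ≠ 0 := by
      rintro rfl
      exact h0 (by rw [← hz, Nat.cast_zero])
    have hn : ∀ (p : ℕ) [Fact p.Prime], ‖(nrd (x : ℍ[ℚ,a,b]) : ℚ_[p])‖ = ‖(n : ℚ_[p])‖ :=
      fun p _ => by rw [← hz, Rat.cast_natCast]
    obtain ⟨r, hr⟩ := exists_int_mul_eq hn0 (t := 2 * (x : ℍ[ℚ,a,b]).re) fun p _ => by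
      rw [← hn]
      obtain h1 | ⟨-, h1, h2, -⟩ := h p
      · rw [h1]; exact ((D.spec p).norm_le _ (hxp p)).2
      · rw [h1]; exact h2
    have hsq : ((n : ℤ) * r) ^ 2 ≤ 4 * n := by
      -- The trace is written as `n * r`, so this is the inequality required of the trace by
      -- `traceRange`.
      have := sq_le_four_mul_nrd ha hb (x : ℍ[ℚ,a,b])
      rw [hr, ← hz] at this
      exact_mod_cast this
    refine ⟨n, ?_, n * r, ?_, ?_, fun p _ hv hval => ?_⟩
    · refine (mem_exactDivisors_iff hN).2 ⟨hn0, fun p hp => ?_⟩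
      have : Fact p.Prime := ⟨hp⟩
      have hval : ∀ k : ℕ, ‖(nrd (x : ℍ[ℚ,a,b]) : ℚ_[p])‖ = (p : ℝ) ^ (-(k : ℤ)) →
          n.factorization p = k := by
        intro k hk
        rw [hn, norm_natCast_eq_factorization hn0] at hk
        have := zpow_right_injective₀ prime_cast_pos one_lt_prime_cast.ne' hk
        omega
      refine (h p).imp (fun h1 => hval 0 (by simpa using h1)) fun h1 => hval _ h1.2.1
    · have h1 : (1 : ℤ) ≤ n := by omega
      rw [traceRange, Finset.mem_filter, Finset.mem_Icc]
      refine ⟨⟨?_, ?_⟩, dvd_mul_right _ _, hsq⟩ <;> nlinarith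
    · rw [mem_zeros_iff_of_sq_le hsq]
      exact ⟨hx, by rw [hr]; push_cast; rfl, by rw [← hz]; push_cast; rfl⟩
    · obtain h1 | ⟨-, -, -, h1⟩ := h p
      · have h2 := (norm_ratCast_eq_iff (p := p) h0 0).1 (by simpa using h1)
        omega
      · exact h1
  · rintro ⟨n, hn, r, hr, hx, hC⟩
    rw [traceRange, Finset.mem_filter] at hr
    obtain ⟨-, ⟨s, rfl⟩, hsq⟩ := hr
    rw [mem_zeros_iff_of_sq_le hsq] at hx
    obtain ⟨hxO, htr, hnrd⟩ := hx
    obtain ⟨hn0, hn⟩ := (mem_exactDivisors_iff hN).1 hn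
    refine ⟨hxO, fun p hp => ?_⟩
    have hnorm : ‖(nrd (x : ℍ[ℚ,a,b]) : ℚ_[p])‖ = (p : ℝ) ^ (-(n.factorization p : ℤ)) := by
      rw [← norm_natCast_eq_factorization hn0, hnrd]; norm_cast
    by_cases hv : n.factorization p = 0
    · left
      rw [hnorm, hv]; simp
    · right
      have hpN := (hn p hp.out).resolve_left hv
      rw [hpN] at hnorm hv
      refine ⟨?_, hnorm, ?_, hC p (Nat.pos_of_ne_zero hv) ((norm_ratCast_eq_iff h0 _).1 hnorm)⟩
      · rwa [← Nat.support_factorization, Finsupp.mem_support_iff]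
      · rw [← hpN, ← norm_natCast_eq_factorization hn0, htr]
        push_cast
        rw [norm_mul]
        exact mul_le_of_le_one_right (norm_nonneg _) (Padic.norm_int_le_one s)

end LocalData

/-- An element determines its norm and trace, so the zero sets for different pairs `(n, r)` in the
sum are disjoint; a zero has norm `n ≠ 0` and is therefore invertible. -/
lemma card_primitiveSet_eq_sum (ha : a < 0) (hb : b < 0) {O : Subring ℍ[ℚ,a,b]} {N₁ N₂ : ℕ}
    (hN : IsLevelPair N₁ N₂) (hO : IsOrder O) (φ : LevelCoords O N₁ N₂)
    (D : LocalData O (N₁ * N₂) (fun p _ => CornerAt φ p)) :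
    Nat.card D.primitiveSet =
      ∑ n ∈ exactDivisors (N₁ * N₂), ∑ r ∈ traceRange n, restrictedRho φ n r := by
  have hN0 : N₁ * N₂ ≠ 0 := mul_ne_zero hN.ne_zero₁ hN.ne_zero₂
  let T := (exactDivisors (N₁ * N₂)).sigma traceRange
  let Z : T → Type := fun t => {x : ℍ[ℚ,a,b] // x ∈ zeros O t.1.1 t.1.2 ∧ CornerCondition φ x}
  have hsq : ∀ t : T, t.1.2 ^ 2 ≤ 4 * (t.1.1 : ℤ) := fun t =>
    (Finset.mem_filter.1 (Finset.mem_sigma.1 t.2).2).2.2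
  have hmem : ∀ (t : T) (x : Z t), ∃ u ∈ D.primitiveSet, (u : ℍ[ℚ,a,b]) = x.1 := by
    intro t x
    have hne : nrd x.1 ≠ 0 := by
      rw [((mem_zeros_iff_of_sq_le (hsq t)).1 x.2.1).2.2]
      have := ((mem_exactDivisors_iff hN0).1 (Finset.mem_sigma.1 t.2).1).1
      exact_mod_cast this
    obtain ⟨u, hu⟩ := exists_unit_eq hne
    refine ⟨u, (D.mem_primitiveSet_iff_exists ha hb hN0 hO).2 ⟨_, (Finset.mem_sigma.1 t.2).1, _,
      (Finset.mem_sigma.1 t.2).2, ?_⟩, hu⟩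
    rw [hu, ← cornerCondition_iff hN]
    exact x.2
  choose g hg hgx using hmem
  let f : (Σ t, Z t) → D.primitiveSet := fun s => ⟨g s.1 s.2, hg s.1 s.2⟩
  have hf : Function.Bijective f := by
    constructor
    · rintro ⟨⟨⟨n, r⟩, ht⟩, ⟨x, hx⟩⟩ ⟨⟨⟨n', r'⟩, ht'⟩, ⟨x', hx'⟩⟩ h
      have hxx : x = x' := by
        have h1 := congr_arg (fun u => ((u.1 : (ℍ[ℚ,a,b])ˣ) : ℍ[ℚ,a,b])) h
        simpa only [f, hgx] using h1
      subst hxx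
      obtain ⟨-, h1, h2⟩ := (mem_zeros_iff_of_sq_le (hsq ⟨⟨n, r⟩, ht⟩)).1 hx.1
      obtain ⟨-, h1', h2'⟩ := (mem_zeros_iff_of_sq_le (hsq ⟨⟨n', r'⟩, ht'⟩)).1 hx'.1
      obtain rfl : n = n' := by exact_mod_cast h2.symm.trans h2'
      obtain rfl : r = r' := by exact_mod_cast h1.symm.trans h1'
      rfl
    · rintro ⟨u, hu⟩
      obtain ⟨n, hn, r, hr, hx, hC⟩ := (D.mem_primitiveSet_iff_exists ha hb hN0 hO).1 hu
      refine ⟨⟨⟨⟨n, r⟩, Finset.mem_sigma.2 ⟨hn, hr⟩⟩, ⟨u, hx, (cornerCondition_iff hN φ _).2 hC⟩⟩, ?_⟩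
      exact Subtype.ext (Units.ext (hgx _ _))
  have : ∀ t, Finite (Z t) := fun t =>
    ((finite_zeros ha hb hO t.1.1 t.1.2).subset fun x hx => hx.1 :
      {x | x ∈ zeros O t.1.1 t.1.2 ∧ CornerCondition φ x}.Finite)
  rw [← Nat.card_congr (Equiv.ofBijective f hf), Nat.card_sigma, Finset.sum_sigma']
  exact Finset.sum_coe_sort T fun t => restrictedRho φ t.1 t.2

lemma exists_localData (ha : a < 0) (hb : b < 0) {O : Subring ℍ[ℚ,a,b]} {N₁ N₂ : ℕ}
    (hN : IsLevelPair N₁ N₂) (hO : IsOrder O) (φ : LevelCoords O N₁ N₂) :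
    Nonempty (LocalData O (N₁ * N₂) (fun p _ => CornerAt φ p)) := by
  choose w hw using fun (p : ℕ) (hp : Fact p.Prime) =>
    exists_isLocalNormalizer ha.ne hb.ne hN hO φ p
  exact ⟨⟨fun p hp => w p hp, fun p hp => hw p hp⟩⟩

end QuatLevel

end

open QuatLevel in
theorem theorem3 (a b : ℚ) (ha : a < 0) (hb : b < 0) (N₁ N₂ : ℕ)
    (O : Subring ℍ[ℚ,a,b]) (hO : IsOfLevel O N₁ N₂) :
    (0 < m O ∧ (cardPrincipal O : ℚ) = 2 ^ e (N₁ * N₂) / m O) ∧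
    (Finite Oˣ ∧ (∀ n r : ℤ, (zeros O n r).Finite) ∧
      ∀ φ : LevelCoords O N₁ N₂,
        (cardPrincipal O : ℚ) =
          ∑ n ∈ exactDivisors (N₁ * N₂), ∑ r ∈ traceRange n,
            (restrictedRho φ n r : ℚ) / Nat.card Oˣ) ∧
    (Nat.card (O ≃+* O) : ℚ) = 2 ^ e (N₁ * N₂) * Nat.card Oˣ / (2 * m O) := by
  obtain ⟨hN, hOr, ⟨φ₀⟩⟩ := hO
  have hN0 : N₁ * N₂ ≠ 0 := mul_ne_zero hN.ne_zero₁ hN.ne_zero₂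
  obtain ⟨D⟩ := exists_localData ha hb hN hOr φ₀
  have hmc : (m O * cardPrincipal O : ℚ) = 2 ^ e (N₁ * N₂) := by
    have h := (card_twoSidedMod_eq_mul hOr).symm.trans (D.card_twoSidedMod hN0 hOr)
    exact_mod_cast h
  -- Should there be infinitely many classes, `m O` would be `0` by the convention for `Nat.card`;
  -- the product being a power of `2` excludes this.
  have hm : (m O : ℚ) ≠ 0 := by
    intro h
    rw [h, zero_mul] at hmc
    exact pow_ne_zero _ two_ne_zero hmc.symm
  have hU : (Nat.card Oˣ : ℚ) ≠ 0 := by exact_mod_cast D.card_units_ne_zero ha hb hOr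
  have hc : (cardPrincipal O : ℚ) = 2 ^ e (N₁ * N₂) / m O := by
    rw [← hmc, mul_div_cancel_left₀ _ hm]
  refine ⟨⟨Nat.pos_of_ne_zero (by exact_mod_cast hm), hc⟩, ⟨D.finite_units ha hb hOr,
    finite_zeros ha hb hOr, fun φ => ?_⟩, ?_⟩
  -- The local data are rebuilt from the given `φ`, since the corner condition is tied to the chosen
  -- coordinates while the left side is not.
  · obtain ⟨D'⟩ := exists_localData ha hb hN hOr φ
    have h := (card_primitiveSet_eq_sum ha hb hN hOr φ D').symm.trans
      (D'.card_primitiveSet_eq_card_units_mul ha hb hN0 hOr)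
    simp only [← Finset.sum_div]
    rw [eq_div_iff hU, mul_comm]
    exact_mod_cast h.symm
  · have h := (D.card_primitiveSet_eq_two_mul ha hb hN0 hOr).symm.trans
      (D.card_primitiveSet_eq_card_units_mul ha hb hN0 hOr)
    have h' : (2 : ℚ) * Nat.card (O ≃+* O) = Nat.card Oˣ * cardPrincipal O := by exact_mod_cast h
    rw [eq_div_iff (mul_ne_zero two_ne_zero hm), ← hmc]
    linear_combination (m O : ℚ) * h'
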